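/- **Setting.** Let $d\ge 1$, let $\Omega\subset\mathbb R^d$ be a bounded polyhedral domain, and let $\mathbb M$ be a field of symmetric $d\times d$ matrices that is $C^1$ on a neighbourhood of $\overline\Omega$ and satisfies $\underline m I\le \mathbb M(x)\le\overline m I$ for $x\in\Omega$, with constants $0<\underline m\le\overline m$. Let $\hat K$ be an equilateral simplex with $|\hat K|=1$. Consider simplicial meshes $\mathcal T_h$ of $\Omega$ with $N$ elements and $N_v$ vertices $x_1,\dots,x_{N_v}$ and a fixed connectivity, where $N\ge 2$ if $d=1$; a mesh is *nonsingular* if its elements are nondegenerate simplices that do not overlap and that cover $\overline\Omega$. For an element $K$ let $F_K'$ be the Jacobian matrix of the affine map $\hat K\to K$, $\mathbb M_K$ the average of $\mathbb M$ over $K$, and $a_{K,\mathbb M}$ the minimum altitude of $K$ in the metric $\mathbb M_K$. Let $p>1$, $4p>d$, and $$I_h(\mathcal T_h)=\sum_{K\in\mathcal T_h}|K|\det(\mathbb M_K)^{1/2}\Big\|(F_K')^{-1}\mathbb M_K^{-1}(F_K')^{-T}-\gamma_h I\Big\|_F^{2p},\qquad \gamma_h=\Big(\frac{\sigma_h}{N}\Big)^{-2/d},$$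 where $\sigma_h=\sum_{K}|K|\det(\mathbb M_K)^{1/2}$, or where $\sigma_h$ is replaced by a positive constant that does not depend on the mesh. Let $\tau>0$, and let the $P_i$ be positive continuous functions on the set of nonsingular meshes. Let $\mathcal T_h(t)$, $t\ge 0$, be a trajectory of the semi-discrete MMPDE $$\frac{dx_i}{dt}=-\frac{P_i}{\tau}\,\Pi_i\Big(\frac{\partial I_h}{\partial x_i}\Big)^T,\qquad i=1,\dots,N_v,\quad t>0,$$ continuous on $[0,\infty)$, whose initial mesh is nonsingular and face-to-face. Here $\Pi_i$ is the orthogonal projection onto a linear space $V_i$ of admissible velocities: $V_i=\mathbb R^d$ if $x_i(0)\in\Omega$; if $x_i(0)\in\partial\Omega$, then $V_i$ is any space parallel to every facet of the initial mesh that lies on $\partial\Omega$ and contains $x_i(0)$ (so boundary vertices slide along the boundary or are fixed, and corners are fixed). **Claim.** $\mathcal T_h(t)$ is a nonsingular mesh of $\Omega$ for all $t\ge 0$, and (a) $I_h(\mathcal T_h(t))$ converges to a real number $L$ as $t\to\infty$. (b) The trajectory has limit meshes, i.e. meshes $\mathcal T_h^*$ with $\mathcal T_h(t_n)\to\mathcal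 T_h^*$ for some $t_n\to\infty$. Every limit mesh is a nonsingular mesh of $\Omega$, and all its elements $K$ satisfy $$a_{K,\mathbb M}\ge C_1\,\overline m^{-\frac{d}{2(4p-d)}}N^{-\frac{4p}{d(4p-d)}},\qquad |K|\ge C_2\,\overline m^{-\frac{d^2}{2(4p-d)}-\frac d2}N^{-\frac{4p}{4p-d}},$$ where $$C_1=\left(\frac{2^{6p}\,(d!)^{4p/d}\,\alpha}{d^{4p}(d+1)^{4p-\frac{2p}{d}}\big(\beta|\Omega|+I_h(\mathcal T_h(0))\big)}\right)^{\frac1{4p-d}},\quad C_2=\frac{C_1^d}{d!},\quad \beta=\underline m^{d/2}(\gamma_h^2d)^p$$ (with the $\gamma_h$ of the limit mesh) and $\alpha=2^{1-2p}\,\underline m^{d/2}d^{-p}$. If $\sqrt d\,\overline m\ge 1$, the bounds hold also with $\alpha=2^{1-2p}\,\underline m^{d/2}\,\overline m^{-2p}d^{-2p}$. (c) Every limit mesh is a critical point of $I_h$: $I_h$ is differentiable there and $\Pi_i(\partial I_h/\partial x_i)^T=0$ for all $i$ (for vertices with $x_i(0)\in\Omega$ this says $\partial I_h/\partial x_i=0$).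 -/

import Mathlib

open MeasureTheory Filter Topology
open scoped Nat

noncomputable section

namespace MovingMesh

/-- Bounded polyhedral domain of `ℝ^d`: open, connected, bounded, with boundary contained in
finitely many hyperplanes. -/
structure IsPolyhedralDomain {d : ℕ} (Ω : Set (EuclideanSpace ℝ (Fin d))) : Prop where
  isOpen : IsOpen Ω
  isConnected : IsConnected Ω
  isBounded : Bornology.IsBounded Ω
  frontier_subset : ∃ H : Finset (AffineSubspace ℝ (EuclideanSpace ℝ (Fin d))),
    (∀ h ∈ H, Module.finrank ℝ h.direction + 1 = d) ∧
      frontier Ω ⊆ ⋃ h ∈ H, (h : Set (EuclideanSpace ℝ (Fin d)))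

/-- `M` is a `C¹` field of symmetric matrices (defined near the closure of `Ω`) with
`m I ≤ M ≤ mbar I` on `Ω`. -/
structure IsMetricTensor {d : ℕ} (Ω : Set (EuclideanSpace ℝ (Fin d))) (m mbar : ℝ)
    (M : EuclideanSpace ℝ (Fin d) → Matrix (Fin d) (Fin d) ℝ) : Prop where
  smooth : ∀ y ∈ closure Ω, ∀ a b, ContDiffAt ℝ 1 (fun z => M z a b) y
  symm : ∀ y ∈ Ω, (M y).IsSymm
  lower : ∀ y ∈ Ω, (M y - m • (1 : Matrix (Fin d) (Fin d) ℝ)).PosSemidef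
  upper : ∀ y ∈ Ω, (mbar • (1 : Matrix (Fin d) (Fin d) ℝ) - M y).PosSemidef

/-! ### Simplices -/

/-- The simplex with vertices `y 0, …, y d`. -/
def simplex {d : ℕ} (y : Fin (d + 1) → EuclideanSpace ℝ (Fin d)) :
    Set (EuclideanSpace ℝ (Fin d)) :=
  convexHull ℝ (Set.range y)

/-- The facet of the simplex opposite to the vertex `y j`. -/
def facet {d : ℕ} (y : Fin (d + 1) → EuclideanSpace ℝ (Fin d)) (j : Fin (d + 1)) :
    Set (EuclideanSpace ℝ (Fin d)) :=
  convexHull ℝ (y '' {j}ᶜ)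

/-- The Euclidean volume of the simplex. -/
def vol {d : ℕ} (y : Fin (d + 1) → EuclideanSpace ℝ (Fin d)) : ℝ :=
  volume.real (simplex y)

/-- The edge matrix `[y 1 - y 0, …, y d - y 0]`. -/
def edgeMatrix {d : ℕ} (y : Fin (d + 1) → EuclideanSpace ℝ (Fin d)) :
    Matrix (Fin d) (Fin d) ℝ :=
  Matrix.of fun a j => y j.succ a - y 0 a

/-- The Jacobian matrix of the affine map that takes `ξ j` to `y j` for all `j`. -/
def jacobian {d : ℕ} (ξ y : Fin (d + 1) → EuclideanSpace ℝ (Fin d)) :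
    Matrix (Fin d) (Fin d) ℝ :=
  edgeMatrix y * (edgeMatrix ξ)⁻¹

/-- Equilateral simplex of unit volume. -/
def IsReferenceElement {d : ℕ} (ξ : Fin (d + 1) → EuclideanSpace ℝ (Fin d)) : Prop :=
  (∃ ℓ : ℝ, 0 < ℓ ∧ ∀ i j, i ≠ j → dist (ξ i) (ξ j) = ℓ) ∧ vol ξ = 1

/-- The average of `M` over the simplex. -/
def averageMetric {d : ℕ} (M : EuclideanSpace ℝ (Fin d) → Matrix (Fin d) (Fin d) ℝ)
    (y : Fin (d + 1) → EuclideanSpace ℝ (Fin d)) : Matrix (Fin d) (Fin d) ℝ :=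
  Matrix.of fun a b => ⨍ z in simplex y, M z a b

/-- Distance of two points in the constant metric `A`. -/
def metricDist {d : ℕ} (A : Matrix (Fin d) (Fin d) ℝ) (y z : EuclideanSpace ℝ (Fin d)) : ℝ :=
  √(∑ a, ∑ b, (y a - z a) * A a b * (y b - z b))

/-- Altitude of the simplex from the vertex `y j` in the constant metric `A`: the distance of `y j`
from the affine hull of the opposite facet. -/
def altitude {d : ℕ} (A : Matrix (Fin d) (Fin d) ℝ)
    (y : Fin (d + 1) → EuclideanSpace ℝ (Fin d)) (j : Fin (d + 1)) : ℝ :=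
  sInf ((fun z => metricDist A (y j) z) ''
    (affineSpan ℝ (y '' {j}ᶜ) : Set (EuclideanSpace ℝ (Fin d))))

/-- Minimum altitude of the simplex in the constant metric `A`. -/
def minAltitude {d : ℕ} (A : Matrix (Fin d) (Fin d) ℝ)
    (y : Fin (d + 1) → EuclideanSpace ℝ (Fin d)) : ℝ :=
  ⨅ j, altitude A y j

/-- Frobenius norm. -/
def frobenius {d : ℕ} (A : Matrix (Fin d) (Fin d) ℝ) : ℝ :=
  √(∑ a, ∑ b, A a b ^ 2)

/-! ### Meshes

A mesh with `N` elements and `Nv` vertices is given by its connectivity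
`conn : Fin N → Fin (d + 1) → Fin Nv` (the global index of the local vertices of each element),
which does not change in time, and the positions `x : Fin Nv → ℝ^d` of the vertices. -/

/-- The vertices of the element `K`. -/
def elementVertices {d N Nv : ℕ} (conn : Fin N → Fin (d + 1) → Fin Nv)
    (x : Fin Nv → EuclideanSpace ℝ (Fin d)) (K : Fin N) :
    Fin (d + 1) → EuclideanSpace ℝ (Fin d) :=
  fun j => x (conn K j)

/-- The positions `x` make up a nonsingular simplicial mesh of `Ω`: the elements are nondegenerate
simplices that do not overlap and cover the closure of `Ω`. -/
structure IsNonsingularMesh {d N Nv : ℕ} (Ω : Set (EuclideanSpace ℝ (Fin d)))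
    (conn : Fin N → Fin (d + 1) → Fin Nv) (x : Fin Nv → EuclideanSpace ℝ (Fin d)) : Prop where
  nondegenerate : ∀ K, AffineIndependent ℝ (elementVertices conn x K)
  nonoverlapping : ∀ K L, K ≠ L → Disjoint (interior (simplex (elementVertices conn x K)))
    (interior (simplex (elementVertices conn x L)))
  covers : ⋃ K, simplex (elementVertices conn x K) = closure Ω

/-- The mesh is face-to-face (any two elements meet in the common face spanned by their common
vertices), and every vertex belongs to an element. -/
structure IsConforming {d N Nv : ℕ} (conn : Fin N → Fin (d + 1) → Fin Nv)
    (x : Fin Nv → EuclideanSpace ℝ (Fin d)) : Prop where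
  inter_eq : ∀ K L, simplex (elementVertices conn x K) ∩ simplex (elementVertices conn x L) =
    convexHull ℝ (x '' (Set.range (conn K) ∩ Set.range (conn L)))
  vertex_mem : ∀ i, ∃ K j, conn K j = i

/-! ### The functional -/

/-- `σ_h`, the sum over the elements of `|K| det(M_K)^{1/2}`. -/
def sigma {d N Nv : ℕ} (conn : Fin N → Fin (d + 1) → Fin Nv)
    (M : EuclideanSpace ℝ (Fin d) → Matrix (Fin d) (Fin d) ℝ)
    (x : Fin Nv → EuclideanSpace ℝ (Fin d)) : ℝ :=
  ∑ K, vol (elementVertices conn x K) * √(averageMetric M (elementVertices conn x K)).det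

/-- `γ_h = (s / N)^{-2/d}`. -/
def gammaH (d N : ℕ) (s : ℝ) : ℝ := (s / N) ^ (-(2 : ℝ) / d)

/-- The meshing functional, the sum over the elements of
`|K| det(M_K)^{1/2} ‖(F_K')⁻¹ M_K⁻¹ (F_K')⁻ᵀ - (σ/N)^{-2/d} I‖_F^{2p}`. -/
def energy {d N Nv : ℕ} (ξ : Fin (d + 1) → EuclideanSpace ℝ (Fin d))
    (conn : Fin N → Fin (d + 1) → Fin Nv)
    (M : EuclideanSpace ℝ (Fin d) → Matrix (Fin d) (Fin d) ℝ) (p : ℝ)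
    (σ : (Fin Nv → EuclideanSpace ℝ (Fin d)) → ℝ)
    (x : Fin Nv → EuclideanSpace ℝ (Fin d)) : ℝ :=
  ∑ K, vol (elementVertices conn x K) * √(averageMetric M (elementVertices conn x K)).det *
    frobenius ((jacobian ξ (elementVertices conn x K))⁻¹ *
        (averageMetric M (elementVertices conn x K))⁻¹ *
        ((jacobian ξ (elementVertices conn x K))⁻¹).transpose -
      gammaH d N (σ x) • (1 : Matrix (Fin d) (Fin d) ℝ)) ^ (2 * p)

/-! ### The moving mesh equation -/

/-- The spaces `V i` of admissible velocities of the vertices: no restriction at vertices inside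
`Ω`, while a boundary vertex may only move along all the boundary facets that contain it (so that
corners are fixed). Fixing further boundary directions, or all boundary vertices, is allowed. -/
structure IsBoundaryRule {d N Nv : ℕ} (Ω : Set (EuclideanSpace ℝ (Fin d)))
    (conn : Fin N → Fin (d + 1) → Fin Nv) (x₀ : Fin Nv → EuclideanSpace ℝ (Fin d))
    (V : Fin Nv → Submodule ℝ (EuclideanSpace ℝ (Fin d))) : Prop where
  interior_free : ∀ i, x₀ i ∈ Ω → V i = ⊤
  boundary_tangent : ∀ K j, facet (elementVertices conn x₀ K) j ⊆ frontier Ω →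
    ∀ k, k ≠ j → V (conn K k) ≤ (affineSpan ℝ (facet (elementVertices conn x₀ K) j)).direction

/-- The part of the partial gradient `∂I/∂x_i` along the admissible directions `V i`; it is all of
`∂I/∂x_i` where `V i = ⊤`. -/
def admissibleGradient {d Nv : ℕ} (V : Fin Nv → Submodule ℝ (EuclideanSpace ℝ (Fin d)))
    (I : (Fin Nv → EuclideanSpace ℝ (Fin d)) → ℝ) (x : Fin Nv → EuclideanSpace ℝ (Fin d))
    (i : Fin Nv) : EuclideanSpace ℝ (Fin d) :=
  (V i).starProjection (gradient (fun y => I (Function.update x i y)) (x i))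

/-- `x` solves the semi-discrete moving mesh equation `x_i' = -(P_i / τ) ∂I/∂x_i` for `t > 0` and is
continuous up to `t = 0`. -/
structure IsMMPDETrajectory {d Nv : ℕ} (V : Fin Nv → Submodule ℝ (EuclideanSpace ℝ (Fin d)))
    (I : (Fin Nv → EuclideanSpace ℝ (Fin d)) → ℝ) (τ : ℝ)
    (P : Fin Nv → (Fin Nv → EuclideanSpace ℝ (Fin d)) → ℝ)
    (x : ℝ → Fin Nv → EuclideanSpace ℝ (Fin d)) : Prop where
  continuousOn : ContinuousOn x (Set.Ici 0)
  equation : ∀ t, 0 < t → ∀ i, HasDerivAt (fun s => x s i)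
    (-(P i (x t) / τ) • admissibleGradient V I (x t) i) t

/-- `x` is a critical point of `I` (with respect to admissible displacements of the vertices). -/
def IsCriticalMesh {d Nv : ℕ} (V : Fin Nv → Submodule ℝ (EuclideanSpace ℝ (Fin d)))
    (I : (Fin Nv → EuclideanSpace ℝ (Fin d)) → ℝ)
    (x : Fin Nv → EuclideanSpace ℝ (Fin d)) : Prop :=
  DifferentiableAt ℝ I x ∧ ∀ i, admissibleGradient V I x i = 0

/-- `xlim` is a limit mesh of the trajectory: `x (t n) → xlim` for some times `t n → ∞`. -/
def IsLimitMesh {d Nv : ℕ} (x : ℝ → Fin Nv → EuclideanSpace ℝ (Fin d))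
    (xlim : Fin Nv → EuclideanSpace ℝ (Fin d)) : Prop :=
  ∃ t : ℕ → ℝ, Tendsto t atTop atTop ∧ Tendsto (fun n => x (t n)) atTop (𝓝 xlim)

/-! ### The lower bounds on altitudes and volumes -/

/-- The coercivity constant in `G ≥ α ‖J‖_F^{4p} - β`. -/
def alphaJ (d : ℕ) (p m mbar : ℝ) : ℝ :=
  2 ^ (1 - 2 * p) * m ^ ((d : ℝ) / 2) / (mbar ^ (2 * p) * (d : ℝ) ^ (2 * p))

/-- The coercivity constant in `G ≥ α tr(J M⁻¹ Jᵀ)^{2p} - β`. -/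
def alphaM (d : ℕ) (p m : ℝ) : ℝ :=
  2 ^ (1 - 2 * p) * m ^ ((d : ℝ) / 2) / (d : ℝ) ^ p

/-- The constant `β = m^{d/2} (γ² d)^p`. -/
def betaC (d : ℕ) (p m γ : ℝ) : ℝ :=
  m ^ ((d : ℝ) / 2) * (γ ^ 2 * d) ^ p

/-- The constant `C₁`, where `B = β |Ω| + I_h(T_h(0))`. -/
def constC₁ (d : ℕ) (p α B : ℝ) : ℝ :=
  (2 ^ (6 * p) * (d ! : ℝ) ^ (4 * p / d) * α /
    ((d : ℝ) ^ (4 * p) * ((d : ℝ) + 1) ^ (4 * p - 2 * p / d) * B)) ^ (1 / (4 * p - d))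

/-- The constant `C₂ = C₁^d / d!`. -/
def constC₂ (d : ℕ) (p α B : ℝ) : ℝ := constC₁ d p α B ^ d / (d ! : ℝ)

/-- The lower bounds on the minimum altitudes (in the metrics `M_K`) and volumes of the elements of
the mesh `x`, with `C₁` and `C₂` computed from the constants `α` and `B`. -/
def SatisfiesBounds {d N Nv : ℕ} (conn : Fin N → Fin (d + 1) → Fin Nv)
    (M : EuclideanSpace ℝ (Fin d) → Matrix (Fin d) (Fin d) ℝ) (p mbar α B : ℝ)
    (x : Fin Nv → EuclideanSpace ℝ (Fin d)) : Prop :=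
  ∀ K,
    constC₁ d p α B * mbar ^ (-(d : ℝ) / (2 * (4 * p - d))) *
        (N : ℝ) ^ (-(4 * p) / (d * (4 * p - d))) ≤
      minAltitude (averageMetric M (elementVertices conn x K)) (elementVertices conn x K) ∧
    constC₂ d p α B * mbar ^ (-(d : ℝ) ^ 2 / (2 * (4 * p - d)) - (d : ℝ) / 2) *
        (N : ℝ) ^ (-(4 * p) / (4 * p - d)) ≤
      vol (elementVertices conn x K)

end MovingMesh

end

/-!
The energy is coercive: along nonsingular meshes of bounded energy the elements keep a positive
distance from degeneracy. Signed indicator functions of simplices satisfy a cocycle identity, so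
moving one vertex changes the number of elements covering a point, counted with orientation, only
by contributions of facets. Interior facets cancel in pairs and boundary facets do not contribute,
since their vertices slide along them. Hence a mesh with unchanged orientations covers `closure Ω`
exactly once almost everywhere, i.e. it stays nonsingular, and then coercivity prevents the
orientations from ever changing along the flow. The trajectory therefore stays in a compact set of
nonsingular meshes. There the energy decreases to a limit, and by Barbalat's lemma its rate of
dissipation, a weighted sum of squares of the admissible gradients, tends to zero.
-/

noncomputable section

namespace MovingMesh

/-! ### Orientation and barycentric coordinates -/

section Orientation

variable {d : ℕ}

/-- The homogeneous coordinates `(1, q)` of a point `q`. In these coordinates the affine geometry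
of simplices becomes linear algebra. -/
def homCoords (q : EuclideanSpace ℝ (Fin d)) : Fin (d + 1) → ℝ :=
  Fin.cons 1 q.ofLp

/-- The matrix whose rows are the homogeneous coordinates of the vertices of a simplex. -/
def homMatrix (y : Fin (d + 1) → EuclideanSpace ℝ (Fin d)) :
    Matrix (Fin (d + 1)) (Fin (d + 1)) ℝ :=
  Matrix.of fun j => homCoords (y j)

/-- The oriented volume of a simplex, normalised to be `d!` times the signed Lebesgue measure. -/
def orient (y : Fin (d + 1) → EuclideanSpace ℝ (Fin d)) : ℝ :=
  (homMatrix y).det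

lemma sum_smul_homCoords {ι : Type*} (s : Finset ι) (w : ι → ℝ)
    (f : ι → EuclideanSpace ℝ (Fin d)) :
    ∑ i ∈ s, w i • homCoords (f i) = Fin.cons (∑ i ∈ s, w i) (∑ i ∈ s, w i • f i).ofLp := by
  ext k
  cases k using Fin.cases <;> simp [homCoords]

lemma vecMul_homMatrix (w : Fin (d + 1) → ℝ) (y : Fin (d + 1) → EuclideanSpace ℝ (Fin d)) :
    Matrix.vecMul w (homMatrix y) = Fin.cons (∑ i, w i) (∑ i, w i • y i).ofLp := by
  rw [Matrix.vecMul_eq_sum, ← sum_smul_homCoords]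
  rfl

lemma vecMul_homMatrix_eq_zero_iff {w : Fin (d + 1) → ℝ}
    {y : Fin (d + 1) → EuclideanSpace ℝ (Fin d)} :
    Matrix.vecMul w (homMatrix y) = 0 ↔ ∑ i, w i = 0 ∧ ∑ i, w i • y i = 0 := by
  rw [vecMul_homMatrix, funext_iff, Fin.forall_fin_succ, ← WithLp.ofLp_eq_zero 2, funext_iff]
  rfl

lemma homMatrix_update (y : Fin (d + 1) → EuclideanSpace ℝ (Fin d)) (j : Fin (d + 1))
    (q : EuclideanSpace ℝ (Fin d)) :
    homMatrix (Function.update y j q) = (homMatrix y).updateRow j (homCoords q) := by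
  ext k a
  rcases eq_or_ne k j with rfl | h
  · simp [homMatrix]
  · simp [homMatrix, h]

lemma orient_eq_det_edgeMatrix (y : Fin (d + 1) → EuclideanSpace ℝ (Fin d)) :
    orient y = (edgeMatrix y).det := by
  let B : Matrix (Fin (d + 1)) (Fin (d + 1)) ℝ :=
    Matrix.of fun j => if j = 0 then homCoords (y 0) else Fin.cons 0 (y j - y 0).ofLp
  have hB : orient y = B.det := by
    refine Matrix.det_eq_of_forall_row_eq_smul_add_const (fun j => if j = 0 then 0 else 1) 0
      (by simp) fun i j => ?_
    cases j using Fin.cases <;> by_cases hi : i = 0 <;> simp [B, homMatrix, homCoords, hi]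
  have hB₀ : B 0 0 = 1 := by simp [B, homCoords]
  have hBsucc : ∀ i : Fin d, B i.succ 0 = 0 := by simp [B]
  rw [hB, Matrix.det_succ_column_zero, Fin.sum_univ_succ,
    Finset.sum_eq_zero fun i _ => by rw [hBsucc]; ring, hB₀, ← Matrix.det_transpose]
  simp only [Fin.val_zero, pow_zero, one_mul, add_zero]
  congr 1

lemma orient_comp_perm (y : Fin (d + 1) → EuclideanSpace ℝ (Fin d))
    (π : Equiv.Perm (Fin (d + 1))) :
    orient (y ∘ π) = ((Equiv.Perm.sign π : ℤ) : ℝ) * orient y :=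
  Matrix.det_permute π (homMatrix y)

lemma continuous_orient :
    Continuous (orient : (Fin (d + 1) → EuclideanSpace ℝ (Fin d)) → ℝ) := by
  refine Continuous.matrix_det (continuous_matrix fun j k => ?_)
  cases k using Fin.cases <;> simp only [homMatrix, homCoords, Matrix.of_apply, Fin.cons_zero,
    Fin.cons_succ] <;> fun_prop

/-- The oriented volume as a linear form in the homogeneous coordinates of the vertex `j`. -/
def orientForm (y : Fin (d + 1) → EuclideanSpace ℝ (Fin d)) (j : Fin (d + 1)) :
    (Fin (d + 1) → ℝ) →ₗ[ℝ] ℝ :=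
  LinearMap.proj j ∘ₗ Matrix.cramer (homMatrix y).transpose

variable (y : Fin (d + 1) → EuclideanSpace ℝ (Fin d)) (j : Fin (d + 1))

lemma orient_update (q : EuclideanSpace ℝ (Fin d)) :
    orient (Function.update y j q) = orientForm y j (homCoords q) := by
  rw [orient, homMatrix_update, ← Matrix.cramer_transpose_apply]
  rfl

lemma orient_update_sum_smul {ι : Type*} {s : Finset ι} {w : ι → ℝ}
    (f : ι → EuclideanSpace ℝ (Fin d)) (hw : ∑ i ∈ s, w i = 1) :
    orient (Function.update y j (∑ i ∈ s, w i • f i)) =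
      ∑ i ∈ s, w i * orient (Function.update y j (f i)) := by
  have h : homCoords (∑ i ∈ s, w i • f i) = ∑ i ∈ s, w i • homCoords (f i) := by
    rw [sum_smul_homCoords, hw, homCoords]
  simp [orient_update, h]

/-- Cramer's rule in homogeneous coordinates. -/
lemma sum_orient_update_smul_homCoords (q : EuclideanSpace ℝ (Fin d)) :
    ∑ j, orient (Function.update y j q) • homCoords (y j) = orient y • homCoords q := by
  have h := Matrix.mulVec_cramer (homMatrix y).transpose (homCoords q)
  rw [Matrix.det_transpose, Matrix.mulVec_transpose, Matrix.vecMul_eq_sum] at h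
  simp only [orient_update]
  exact h

lemma sum_orient_update (q : EuclideanSpace ℝ (Fin d)) :
    ∑ j, orient (Function.update y j q) = orient y := by
  simpa [homCoords] using congrFun (sum_orient_update_smul_homCoords y q) 0

lemma sum_orient_update_smul (q : EuclideanSpace ℝ (Fin d)) :
    ∑ j, orient (Function.update y j q) • y j = orient y • q := by
  ext a
  simpa [homCoords] using congrFun (sum_orient_update_smul_homCoords y q) a.succ

lemma orient_mul_orient_update (w : Fin (d + 1) → EuclideanSpace ℝ (Fin d))
    (q : EuclideanSpace ℝ (Fin d)) :
    orient w * orient (Function.update y j q) =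
      ∑ k, orient (Function.update w k q) * orient (Function.update y j (w k)) := by
  have h := congrArg (orientForm y j) (sum_orient_update_smul_homCoords w q)
  simpa [orient_update] using h.symm

variable {y j}

lemma orient_update_vertex_of_ne {k : Fin (d + 1)} (h : k ≠ j) :
    orient (Function.update y j (y k)) = 0 := by
  refine Matrix.det_zero_of_row_eq h ?_
  ext a
  simp [homMatrix, h]

lemma orient_eq_zero_of_vertices_in_hyperplane {w : Fin (d + 1) → EuclideanSpace ℝ (Fin d)}
    (hy : orient y ≠ 0) (hw : ∀ k, orient (Function.update y j (w k)) = 0) : orient w = 0 := by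
  have h := orient_mul_orient_update y j w (y j)
  rw [Function.update_eq_self, Finset.sum_eq_zero fun k _ => by rw [hw k, mul_zero]] at h
  exact (mul_eq_zero.mp h).resolve_right hy

lemma orient_update_eq_zero_of_mem_affineSpan {q : EuclideanSpace ℝ (Fin d)}
    (hq : q ∈ affineSpan ℝ (y '' {j}ᶜ)) : orient (Function.update y j q) = 0 := by
  classical
  rw [Set.image_eq_range] at hq
  obtain ⟨w, hw, rfl⟩ := eq_affineCombination_of_mem_affineSpan_of_fintype hq
  rw [Finset.affineCombination_eq_linear_combination _ _ _ hw, orient_update_sum_smul _ _ _ hw]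
  exact Finset.sum_eq_zero fun k _ => by rw [orient_update_vertex_of_ne k.2, mul_zero]

lemma affineIndependent_iff_orient_ne_zero : AffineIndependent ℝ y ↔ orient y ≠ 0 := by
  rw [affineIndependent_iff_of_fintype, ← not_iff_not, ne_eq, not_not, orient,
    ← Matrix.exists_vecMul_eq_zero_iff]
  push Not
  refine exists_congr fun w => ?_
  rw [vecMul_homMatrix_eq_zero_iff, ne_eq, funext_iff, not_forall]
  constructor
  · rintro ⟨hsum, hw, i, hi⟩
    rw [Finset.weightedVSub_eq_linear_combination _ hsum] at hw
    exact ⟨⟨i, hi⟩, hsum, hw⟩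
  · rintro ⟨⟨i, hi⟩, hsum, hw⟩
    exact ⟨hsum, by rw [Finset.weightedVSub_eq_linear_combination _ hsum, hw], i, hi⟩

/-- The points `q` for which replacing the vertex `j` by `q` gives a degenerate simplex form a
proper affine subspace. -/
lemma ae_orient_update_ne_zero (hy : orient y ≠ 0) (j : Fin (d + 1)) :
    ∀ᵐ q : EuclideanSpace ℝ (Fin d), orient (Function.update y j q) ≠ 0 := by
  let A : AffineSubspace ℝ (EuclideanSpace ℝ (Fin d)) :=
    { carrier := {q | orient (Function.update y j q) = 0}
      smul_vsub_vadd_mem' := by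
        intro c p₁ p₂ p₃ h₁ h₂ h₃
        have h := orient_update_sum_smul y j (s := Finset.univ) (w := ![c, -c, 1]) ![p₁, p₂, p₃]
          (by simp [Fin.sum_univ_three])
        simp_all [Fin.sum_univ_three, sub_eq_add_neg] }
  have hA : A ≠ ⊤ := fun h => hy <| by
    have hj : y j ∈ A := h ▸ AffineSubspace.mem_top _ _ _
    simpa using (show orient (Function.update y j (y j)) = 0 from hj)
  filter_upwards [measure_eq_zero_iff_ae_notMem.1 (Measure.addHaar_affineSubspace volume A hA)]
    with q hq using hq

end Orientation

section Barycentric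

variable {d : ℕ} {y : Fin (d + 1) → EuclideanSpace ℝ (Fin d)} {j : Fin (d + 1)}
  {q : EuclideanSpace ℝ (Fin d)}

lemma simplex_eq_image_stdSimplex (y : Fin (d + 1) → EuclideanSpace ℝ (Fin d)) :
    simplex y = Fintype.linearCombination ℝ y '' stdSimplex ℝ (Fin (d + 1)) := by
  rw [← convexHull_rangle_single_eq_stdSimplex, LinearMap.image_convexHull, ← Set.range_comp,
    simplex]
  congr 2
  ext1 j
  simp

lemma convex_simplex (y : Fin (d + 1) → EuclideanSpace ℝ (Fin d)) : Convex ℝ (simplex y) :=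
  convex_convexHull ℝ _

lemma isCompact_simplex (y : Fin (d + 1) → EuclideanSpace ℝ (Fin d)) : IsCompact (simplex y) :=
  (Set.finite_range y).isCompact_convexHull ℝ

lemma ae_notMem_frontier_simplex (y : Fin (d + 1) → EuclideanSpace ℝ (Fin d)) :
    ∀ᵐ q, q ∉ frontier (simplex y) :=
  measure_eq_zero_iff_ae_notMem.1 ((convex_simplex y).addHaar_frontier volume)

lemma simplex_comp_perm (y : Fin (d + 1) → EuclideanSpace ℝ (Fin d))
    (π : Equiv.Perm (Fin (d + 1))) : simplex (y ∘ π) = simplex y := by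
  rw [simplex, simplex, π.surjective.range_comp]

lemma vertex_mem_simplex (y : Fin (d + 1) → EuclideanSpace ℝ (Fin d)) (j : Fin (d + 1)) :
    y j ∈ simplex y :=
  subset_convexHull ℝ _ ⟨j, rfl⟩

lemma facet_subset_simplex (y : Fin (d + 1) → EuclideanSpace ℝ (Fin d)) (j : Fin (d + 1)) :
    facet y j ⊆ simplex y :=
  convexHull_mono (Set.image_subset_range _ _)

/-- The barycentric coordinate of `q` with respect to the vertex `y j`, by Cramer's rule. It is
meaningful only for nondegenerate `y`. -/
def bary (y : Fin (d + 1) → EuclideanSpace ℝ (Fin d)) (j : Fin (d + 1))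
    (q : EuclideanSpace ℝ (Fin d)) : ℝ :=
  orient (Function.update y j q) / orient y

lemma continuous_bary (y : Fin (d + 1) → EuclideanSpace ℝ (Fin d)) (j : Fin (d + 1)) :
    Continuous (bary y j) :=
  (continuous_orient.comp (continuous_const.update j continuous_id)).div_const _

lemma bary_vertex_self (hy : orient y ≠ 0) (j : Fin (d + 1)) : bary y j (y j) = 1 := by
  rw [bary, Function.update_eq_self, div_self hy]

lemma sum_bary (hy : orient y ≠ 0) (q : EuclideanSpace ℝ (Fin d)) : ∑ j, bary y j q = 1 := by
  simp only [bary, ← Finset.sum_div, sum_orient_update, div_self hy]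

lemma sum_bary_smul (hy : orient y ≠ 0) (q : EuclideanSpace ℝ (Fin d)) :
    ∑ j, bary y j q • y j = q := by
  simp only [bary, div_eq_inv_mul, mul_smul, ← Finset.smul_sum, sum_orient_update_smul]
  rw [inv_smul_smul₀ hy]

lemma bary_affineCombination (y : Fin (d + 1) → EuclideanSpace ℝ (Fin d)) (j : Fin (d + 1))
    {ι : Type*} {s : Finset ι} {w : ι → ℝ} (f : ι → EuclideanSpace ℝ (Fin d))
    (hw : ∑ i ∈ s, w i = 1) :
    bary y j (∑ i ∈ s, w i • f i) = ∑ i ∈ s, w i * bary y j (f i) := by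
  simp only [bary, orient_update_sum_smul _ _ _ hw, Finset.sum_div, mul_div_assoc]

lemma bary_lineMap (y : Fin (d + 1) → EuclideanSpace ℝ (Fin d)) (j : Fin (d + 1))
    (q r : EuclideanSpace ℝ (Fin d)) (t : ℝ) :
    bary y j (AffineMap.lineMap q r t) = (1 - t) * bary y j q + t * bary y j r := by
  have h := bary_affineCombination y j (s := Finset.univ) (w := ![1 - t, t]) ![q, r] (by simp)
  simpa [AffineMap.lineMap_apply_module] using h

lemma bary_sum_smul_vertex (hy : orient y ≠ 0) {w : Fin (d + 1) → ℝ} (hw : ∑ j, w j = 1)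
    (j : Fin (d + 1)) : bary y j (∑ k, w k • y k) = w j := by
  rw [bary_affineCombination y j y hw, Finset.sum_eq_single j, bary_vertex_self hy, mul_one]
  · intro k _ hk
    rw [bary, orient_update_vertex_of_ne hk, zero_div, mul_zero]
  · simp

lemma bary_eq_zero_of_mem_facet (hq : q ∈ facet y j) : bary y j q = 0 := by
  rw [bary, orient_update_eq_zero_of_mem_affineSpan (convexHull_subset_affineSpan _ hq), zero_div]

lemma mem_simplex_iff (hy : orient y ≠ 0) : q ∈ simplex y ↔ ∀ j, 0 ≤ bary y j q := by
  rw [simplex_eq_image_stdSimplex]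
  constructor
  · rintro ⟨w, ⟨hw₀, hw₁⟩, rfl⟩ j
    rw [Fintype.linearCombination_apply, bary_sum_smul_vertex hy hw₁]
    exact hw₀ j
  · exact fun h => ⟨fun j => bary y j q, ⟨h, sum_bary hy q⟩, sum_bary_smul hy q⟩

lemma mem_interior_simplex (hy : orient y ≠ 0) (hq : ∀ j, 0 < bary y j q) :
    q ∈ interior (simplex y) := by
  refine mem_interior.2 ⟨⋂ j, {q | 0 < bary y j q}, fun r hr => ?_, ?_, Set.mem_iInter.2 hq⟩
  · exact (mem_simplex_iff hy).2 fun j => (Set.mem_iInter.1 hr j).le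
  · exact isOpen_iInter_of_finite fun j => isOpen_lt continuous_const (continuous_bary y j)

lemma interior_simplex_nonempty (hy : orient y ≠ 0) : (interior (simplex y)).Nonempty := by
  refine ⟨∑ k, (Fintype.card (Fin (d + 1)) : ℝ)⁻¹ • y k, mem_interior_simplex hy fun j => ?_⟩
  rw [bary_sum_smul_vertex hy (by simp; field)]
  positivity

/-- If the vertex `j` is replaced by `z`, the point `q` keeps the remaining barycentric coordinates
up to a multiple of those of `z`. -/
lemma bary_update (hy : orient y ≠ 0) {z : EuclideanSpace ℝ (Fin d)}
    (hz : orient (Function.update y j z) ≠ 0) (q : EuclideanSpace ℝ (Fin d)) (k : Fin (d + 1)) :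
    bary (Function.update y j z) k q =
      Function.update (fun k => bary y k q - bary y j q / bary y j z * bary y k z) j
        (bary y j q / bary y j z) k := by
  have hzj : bary y j z ≠ 0 := div_ne_zero hz hy
  set s := bary y j q / bary y j z
  set v : Fin (d + 1) → ℝ := fun k => bary y k q - s * bary y k z with hv
  have hvj : v j = 0 := by simp only [hv, s]; field_simp; ring
  have hupdate : ∀ k, Function.update v j s k = v k + s * Pi.single (M := fun _ => ℝ) j 1 k := by
    intro k
    rcases eq_or_ne k j with rfl | hk
    · simp [hvj]
    · simp [hk]
  have hsum : ∑ k, Function.update v j s k = 1 := by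
    rw [Finset.sum_congr rfl fun k _ => hupdate k]
    simp [hv, Finset.sum_add_distrib, Finset.sum_sub_distrib, ← Finset.mul_sum, sum_bary hy]
  have hcomb : ∑ k, Function.update v j s k • Function.update y j z k = q := by
    have hterm : ∀ k, Function.update v j s k • Function.update y j z k =
        v k • y k + Pi.single (M := fun _ => EuclideanSpace ℝ (Fin d)) j (s • z) k := by
      intro k
      rcases eq_or_ne k j with rfl | hk
      · simp [hvj]
      · simp [hk]
    rw [Finset.sum_congr rfl fun k _ => hterm k]
    simp [hv, sub_smul, mul_smul, Finset.sum_add_distrib, Finset.sum_sub_distrib,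
      ← Finset.smul_sum, sum_bary_smul hy]
  rw [← bary_sum_smul_vertex hz hsum k, hcomb]

end Barycentric

/-! ### The cocycle identity for signed indicators -/

section RayCount

variable {ι : Type*} {β ζ : ι → ℝ}

/-- The parameters `s ≥ 0` at which the ray `s ↦ β - s • ζ` lies in the nonnegative orthant. The
ray crosses the `j`-th coordinate hyperplane at `s = β j / ζ j`, outwards if `0 < ζ j` and inwards
if `ζ j < 0`. -/
def orthantTimes (β ζ : ι → ℝ) : Set ℝ := {s | 0 ≤ s ∧ ∀ k, s * ζ k ≤ β k}

lemma existsUnique_exit [Finite ι] (hpos : ∃ j, 0 < ζ j)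
    (hgen : ∀ j k, j ≠ k → ζ j ≠ 0 → β j / ζ j * ζ k ≠ β k) (hne : (orthantTimes β ζ).Nonempty) :
    ∃! j, 0 < ζ j ∧ β j / ζ j ∈ orthantTimes β ζ := by
  obtain ⟨s, hs, hsβ⟩ := hne
  obtain ⟨i, hi : 0 < ζ i, hmin⟩ :=
    Set.exists_min_image {j | 0 < ζ j} (fun j => β j / ζ j) (Set.toFinite _) hpos
  have hsi : s ≤ β i / ζ i := (le_div_iff₀ hi).2 (hsβ i)
  refine ⟨i, ⟨hi, hs.trans hsi, fun k => ?_⟩, fun j ⟨hj, _, hall⟩ => ?_⟩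
  · rcases lt_or_ge 0 (ζ k) with hk | hk
    · exact (le_div_iff₀ hk).1 (hmin k hk)
    · exact (mul_le_mul_of_nonpos_right hsi hk).trans (hsβ k)
  · by_contra hji
    exact hgen j i hji hj.ne' ((hall i).antisymm ((div_le_iff₀ hi).1 (hmin j hj)))

lemma existsUnique_entry [Finite ι] (hβ : ¬ ∀ k, 0 ≤ β k)
    (hgen : ∀ j k, j ≠ k → ζ j ≠ 0 → β j / ζ j * ζ k ≠ β k) (hne : (orthantTimes β ζ).Nonempty) :
    ∃! j, ζ j < 0 ∧ β j / ζ j ∈ orthantTimes β ζ := by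
  obtain ⟨s, hs, hsβ⟩ := hne
  obtain ⟨k₀, hk₀⟩ := not_forall.1 hβ
  rw [not_le] at hk₀
  have hζ₀ : ζ k₀ < 0 := neg_of_mul_neg_right ((hsβ k₀).trans_lt hk₀) hs
  obtain ⟨i, hi : ζ i < 0, hmax⟩ :=
    Set.exists_max_image {j | ζ j < 0} (fun j => β j / ζ j) (Set.toFinite _) ⟨k₀, hζ₀⟩
  have hsi : β i / ζ i ≤ s := (div_le_iff_of_neg hi).2 (hsβ i)
  refine ⟨i, ⟨hi, (div_nonneg_of_nonpos hk₀.le hζ₀.le).trans (hmax k₀ hζ₀), fun k => ?_⟩,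
    fun j ⟨hj, _, hall⟩ => ?_⟩
  · rcases lt_or_ge (ζ k) 0 with hk | hk
    · exact (div_le_iff_of_neg hk).1 (hmax k hk)
    · exact (mul_le_mul_of_nonneg_right hsi hk).trans (hsβ k)
  · by_contra hji
    exact hgen j i hji hj.ne ((hall i).antisymm ((le_div_iff_of_neg hi).1 (hmax j hj)))

open Classical in
/-- A generic ray leaves the nonnegative orthant exactly as often as it enters it, plus one if it
starts inside. -/
lemma sum_sign_mul_indicator_orthantTimes [Fintype ι] (hpos : ∃ j, 0 < ζ j) (hβ : ∀ j, β j ≠ 0)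
    (hgen : ∀ j k, j ≠ k → ζ j ≠ 0 → β j / ζ j * ζ k ≠ β k) :
    ∑ j, (SignType.sign (ζ j) : ℝ) * (orthantTimes β ζ).indicator 1 (β j / ζ j) =
      if ∀ k, 0 ≤ β k then 1 else 0 := by
  rcases (orthantTimes β ζ).eq_empty_or_nonempty with hempty | hne
  · have hstart : ¬ ∀ k, 0 ≤ β k := fun h =>
      Set.eq_empty_iff_forall_notMem.1 hempty 0 ⟨le_rfl, by simpa using h⟩
    simp [hempty, hstart]
  obtain ⟨i, ⟨hi, hiF⟩, huniq⟩ := existsUnique_exit hpos hgen hne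
  split_ifs with hstart
  · rw [Finset.sum_eq_single i (fun j _ hji => ?_) (by simp)]
    · simp [hi, hiF]
    · rcases lt_trichotomy (ζ j) 0 with hj | hj | hj
      · have hout : β j / ζ j < 0 := div_neg_of_pos_of_neg ((hstart j).lt_of_ne' (hβ j)) hj
        rw [Set.indicator_of_notMem fun h => hout.not_ge h.1, mul_zero]
      · simp [hj]
      · rw [Set.indicator_of_notMem fun h => hji (huniq j ⟨hj, h⟩), mul_zero]
  · obtain ⟨l, ⟨hl, hlF⟩, huniq'⟩ := existsUnique_entry hstart hgen hne
    have hil : i ≠ l := fun h => (h ▸ hi).not_gt hl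
    rw [Finset.sum_eq_add i l hil (fun j _ hj => ?_) (by simp) (by simp)]
    · simp [hi, hl, hiF, hlF]
    · rcases lt_trichotomy (ζ j) 0 with hj' | hj' | hj'
      · rw [Set.indicator_of_notMem fun h => hj.2 (huniq' j ⟨hj', h⟩), mul_zero]
      · simp [hj']
      · rw [Set.indicator_of_notMem fun h => hj.1 (huniq j ⟨hj', h⟩), mul_zero]

end RayCount

section Cocycle

variable {d : ℕ} {y : Fin (d + 1) → EuclideanSpace ℝ (Fin d)}

/-- The indicator function of a simplex with the sign of its orientation. -/
def signedIndicator (y : Fin (d + 1) → EuclideanSpace ℝ (Fin d)) (q : EuclideanSpace ℝ (Fin d)) :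
    ℝ :=
  (SignType.sign (orient y) : ℝ) * (simplex y).indicator 1 q

lemma signedIndicator_of_orient_eq_zero (hy : orient y = 0) (q : EuclideanSpace ℝ (Fin d)) :
    signedIndicator y q = 0 := by
  simp [signedIndicator, hy]

lemma sign_permSign {α : Type*} [Fintype α] [DecidableEq α] (π : Equiv.Perm α) :
    (SignType.sign ((Equiv.Perm.sign π : ℤ) : ℝ) : ℝ) = (Equiv.Perm.sign π : ℤ) := by
  rcases Int.units_eq_one_or (Equiv.Perm.sign π) with h | h <;> simp [h]

lemma signedIndicator_comp_perm (y : Fin (d + 1) → EuclideanSpace ℝ (Fin d))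
    (π : Equiv.Perm (Fin (d + 1))) (q : EuclideanSpace ℝ (Fin d)) :
    signedIndicator (y ∘ π) q = ((Equiv.Perm.sign π : ℤ) : ℝ) * signedIndicator y q := by
  rw [signedIndicator, simplex_comp_perm, orient_comp_perm, sign_mul, SignType.coe_mul,
    sign_permSign, mul_assoc, signedIndicator]

/-- The ray from `q` in the direction from `z` to `q` meets the simplex opposite to `z`. In
barycentric coordinates it is `bary q - s • bary z` up to scale. -/
lemma mem_simplex_update_iff (hy : orient y ≠ 0) {j : Fin (d + 1)}
    {z : EuclideanSpace ℝ (Fin d)} (hz : orient (Function.update y j z) ≠ 0)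
    (q : EuclideanSpace ℝ (Fin d)) :
    q ∈ simplex (Function.update y j z) ↔
      bary y j q / bary y j z ∈ orthantTimes (bary y · q) (bary y · z) := by
  have hzj : bary y j z ≠ 0 := div_ne_zero hz hy
  rw [mem_simplex_iff hz]
  constructor
  · refine fun h => ⟨by simpa [bary_update hy hz] using h j, fun k => ?_⟩
    rcases eq_or_ne k j with rfl | hk
    · rw [div_mul_cancel₀ _ hzj]
    · simpa [bary_update hy hz, hk] using h k
  · rintro ⟨hj, hall⟩ k
    rcases eq_or_ne k j with rfl | hk
    · simpa [bary_update hy hz] using hj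
    · simpa [bary_update hy hz, hk] using hall k

lemma signedIndicator_update (hy : orient y ≠ 0) (j : Fin (d + 1))
    (z q : EuclideanSpace ℝ (Fin d)) :
    signedIndicator (Function.update y j z) q =
      (SignType.sign (orient y) : ℝ) * ((SignType.sign (bary y j z) : ℝ) *
        (orthantTimes (bary y · q) (bary y · z)).indicator 1 (bary y j q / bary y j z)) := by
  by_cases hz : orient (Function.update y j z) = 0
  · rw [signedIndicator_of_orient_eq_zero hz, bary, hz]
    simp
  have hsign : SignType.sign (orient (Function.update y j z)) =
      SignType.sign (orient y) * SignType.sign (bary y j z) := by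
    rw [← sign_mul, bary, mul_div_cancel₀ _ hy]
  classical
  rw [signedIndicator, hsign, SignType.coe_mul, mul_assoc, Set.indicator_apply,
    Set.indicator_apply, mem_simplex_update_iff hy hz]
  rfl

lemma ae_bary_generic (hy : orient y ≠ 0) (z : EuclideanSpace ℝ (Fin d)) :
    ∀ᵐ q, (∀ j, bary y j q ≠ 0) ∧
      ∀ j k, j ≠ k → bary y j z ≠ 0 → bary y j q / bary y j z * bary y k z ≠ bary y k q := by
  have hq_update : ∀ᵐ q : EuclideanSpace ℝ (Fin d), ∀ j k, orient (Function.update y j z) ≠ 0 →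
      orient (Function.update (Function.update y j z) k q) ≠ 0 := by
    simp only [ae_all_iff]
    exact fun j k hz => ae_orient_update_ne_zero hz k
  filter_upwards [hq_update, ae_all_iff.2 fun j => ae_orient_update_ne_zero hy j] with q hqz hq
  refine ⟨fun j => div_ne_zero (hq j) hy, fun j k hjk hzj heq => ?_⟩
  have hz : orient (Function.update y j z) ≠ 0 := (div_ne_zero_iff.1 hzj).1
  have hne : bary (Function.update y j z) k q ≠ 0 := div_ne_zero (hqz j k hz) hz
  rw [bary_update hy hz, Function.update_of_ne hjk.symm] at hne
  exact hne (sub_eq_zero.2 heq.symm)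

lemma ae_signedIndicator_eq_sum_of_orient_ne_zero (hy : orient y ≠ 0)
    (z : EuclideanSpace ℝ (Fin d)) :
    ∀ᵐ q, signedIndicator y q = ∑ j, signedIndicator (Function.update y j z) q := by
  have hpos : ∃ j, 0 < bary y j z := by
    by_contra! h
    linarith [sum_bary hy z, Finset.sum_nonpos fun j (_ : j ∈ Finset.univ) => h j]
  filter_upwards [ae_bary_generic hy z] with q ⟨hq, hgen⟩
  classical
  simp only [signedIndicator_update hy, ← Finset.mul_sum,
    sum_sign_mul_indicator_orthantTimes hpos hq hgen]
  simp [signedIndicator, Set.indicator_apply, mem_simplex_iff hy]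

lemma update_update_vertex_eq_comp_swap (y : Fin (d + 1) → EuclideanSpace ℝ (Fin d))
    {j k : Fin (d + 1)} (hkj : k ≠ j) (z : EuclideanSpace ℝ (Fin d)) :
    Function.update (Function.update y j z) k (y j) =
      Function.update y k z ∘ Equiv.swap j k := by
  ext1 i
  rcases eq_or_ne i j with rfl | hij
  · simp [hkj.symm]
  rcases eq_or_ne i k with rfl | hik
  · simp [hij.symm]
  · simp [hij, hik, Equiv.swap_apply_of_ne_of_ne hij hik]

lemma signedIndicator_update_update_vertex (y : Fin (d + 1) → EuclideanSpace ℝ (Fin d))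
    {j k : Fin (d + 1)} (hkj : k ≠ j) (z q : EuclideanSpace ℝ (Fin d)) :
    signedIndicator (Function.update (Function.update y j z) k (y j)) q =
      -signedIndicator (Function.update y k z) q := by
  rw [update_update_vertex_eq_comp_swap y hkj, signedIndicator_comp_perm,
    Equiv.Perm.sign_swap hkj.symm]
  simp

/-- The signed indicators of the facets of a `(d + 1)`-simplex with vertices `z, y 0, …, y d`
cancel. -/
lemma ae_signedIndicator_eq_sum (y : Fin (d + 1) → EuclideanSpace ℝ (Fin d))
    (z : EuclideanSpace ℝ (Fin d)) :
    ∀ᵐ q, signedIndicator y q = ∑ j, signedIndicator (Function.update y j z) q := by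
  by_cases hy : orient y ≠ 0
  · exact ae_signedIndicator_eq_sum_of_orient_ne_zero hy z
  rw [not_not] at hy
  by_cases hall : ∀ j, orient (Function.update y j z) = 0
  · exact .of_forall fun q => by simp [signedIndicator_of_orient_eq_zero, hy, hall]
  obtain ⟨j, hj⟩ := not_forall.1 hall
  filter_upwards [ae_signedIndicator_eq_sum_of_orient_ne_zero hj (y j)] with q hq
  have hswap : ∀ k ∈ Finset.univ.erase j,
      signedIndicator (Function.update (Function.update y j z) k (y j)) q =
        -signedIndicator (Function.update y k z) q := fun k hk =>
    signedIndicator_update_update_vertex y (Finset.ne_of_mem_erase hk) z q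
  rw [← Finset.add_sum_erase _ _ (Finset.mem_univ j), Function.update_idem,
    Function.update_eq_self, signedIndicator_of_orient_eq_zero hy, zero_add,
    Finset.sum_congr rfl hswap, Finset.sum_neg_distrib] at hq
  rw [signedIndicator_of_orient_eq_zero hy, ← Finset.add_sum_erase _ _ (Finset.mem_univ j), hq,
    neg_add_cancel]

end Cocycle

/-! ### Neighbouring elements -/

section Facets

variable {d : ℕ} {y : Fin (d + 1) → EuclideanSpace ℝ (Fin d)} {j : Fin (d + 1)}

lemma exists_bary_eq_zero_and_pos (hd : 1 ≤ d) (hy : orient y ≠ 0) (j : Fin (d + 1)) :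
    ∃ r, bary y j r = 0 ∧ ∀ k, k ≠ j → 0 < bary y k r := by
  have hsum : ∑ k, Function.update (fun _ => (d : ℝ)⁻¹) j 0 k = 1 := by
    rw [Finset.sum_update_of_mem (Finset.mem_univ j), Finset.sum_const,
      Finset.card_sdiff_of_subset (Finset.subset_univ _)]
    simp [Nat.one_le_iff_ne_zero.1 hd]
  refine ⟨∑ k, Function.update (fun _ => (d : ℝ)⁻¹) j 0 k • y k, ?_, fun k hk => ?_⟩ <;>
    rw [bary_sum_smul_vertex hy hsum]
  · simp
  · rw [Function.update_of_ne hk]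
    positivity

lemma eventually_lineMap_mem_interior_simplex (hy : orient y ≠ 0)
    {r v : EuclideanSpace ℝ (Fin d)} (hr : bary y j r = 0) (hr' : ∀ k, k ≠ j → 0 < bary y k r)
    (hv : 0 < bary y j v) :
    ∀ᶠ t : ℝ in 𝓝[>] 0, AffineMap.lineMap r v t ∈ interior (simplex y) := by
  have hpos : ∀ᶠ t : ℝ in 𝓝[>] 0, ∀ k, k ≠ j → 0 < bary y k (AffineMap.lineMap r v t) := by
    simp only [eventually_all]
    intro k hk
    have hcont : Continuous fun t : ℝ => bary y k (AffineMap.lineMap r v t) :=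
      (continuous_bary y k).comp AffineMap.lineMap_continuous
    exact nhdsWithin_le_nhds
      (hcont.continuousAt.eventually_const_lt (by simpa using hr' k hk))
  filter_upwards [hpos, self_mem_nhdsWithin] with t ht (ht₀ : 0 < t)
  refine mem_interior_simplex hy fun k => ?_
  rcases eq_or_ne k j with rfl | hk
  · rw [bary_lineMap, hr, mul_zero, zero_add]
    positivity
  · exact ht k hk

lemma interior_simplex_inter_nonempty_of_same_side (hd : 1 ≤ d) {w : EuclideanSpace ℝ (Fin d)}
    (h : 0 < orient (Function.update y j w) * orient y) :
    (interior (simplex y) ∩ interior (simplex (Function.update y j w))).Nonempty := by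
  have hy : orient y ≠ 0 := right_ne_zero_of_mul h.ne'
  have hw : orient (Function.update y j w) ≠ 0 := left_ne_zero_of_mul h.ne'
  obtain ⟨r, hr, hr'⟩ := exists_bary_eq_zero_and_pos hd hy j
  have hyj : 0 < bary y j (y j) := by simp [bary_vertex_self hy]
  have hyj' : 0 < bary (Function.update y j w) j (y j) := by
    rw [bary, Function.update_idem, Function.update_eq_self]
    exact div_pos_iff.2 (pos_and_pos_or_neg_and_neg_of_mul_pos (mul_comm (orient y) _ ▸ h))
  have hev := eventually_lineMap_mem_interior_simplex hy hr hr' hyj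
  have hev' := eventually_lineMap_mem_interior_simplex (y := Function.update y j w) (r := r) hw
    (by simp [bary_update hy hw, hr])
    (fun k hk => by simpa [bary_update hy hw, hr, hk] using hr' k hk) hyj'
  obtain ⟨t, ht⟩ := (hev.and hev').exists
  exact ⟨_, ht⟩

end Facets

section Neighbors

variable {d N Nv : ℕ}

/-- The elements `K` and `L` share the facet of `K` opposite to its vertex `j`; the permutation `π`
matches the local numbering of the shared vertices. -/
def IsNeighbor (conn : Fin N → Fin (d + 1) → Fin Nv) (K : Fin N) (j : Fin (d + 1)) (L : Fin N)
    (π : Equiv.Perm (Fin (d + 1))) : Prop :=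
  K ≠ L ∧ ∀ k, k ≠ j → conn L (π k) = conn K k

variable {Ω : Set (EuclideanSpace ℝ (Fin d))} {conn : Fin N → Fin (d + 1) → Fin Nv}
  {x : Fin Nv → EuclideanSpace ℝ (Fin d)} {K L : Fin N} {j : Fin (d + 1)}
  {π : Equiv.Perm (Fin (d + 1))}

namespace IsNonsingularMesh

lemma orient_ne_zero (hx : IsNonsingularMesh Ω conn x) (K : Fin N) :
    orient (elementVertices conn x K) ≠ 0 :=
  affineIndependent_iff_orient_ne_zero.1 (hx.nondegenerate K)

lemma conn_injective (hx : IsNonsingularMesh Ω conn x) (K : Fin N) :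
    Function.Injective (conn K) := fun a b h =>
  (hx.nondegenerate K).injective (by simp only [elementVertices, h])

lemma simplex_subset (hx : IsNonsingularMesh Ω conn x) (K : Fin N) :
    simplex (elementVertices conn x K) ⊆ closure Ω :=
  hx.covers ▸ Set.subset_iUnion (fun K => simplex (elementVertices conn x K)) K

lemma exists_mem_simplex (hx : IsNonsingularMesh Ω conn x) {q : EuclideanSpace ℝ (Fin d)}
    (hq : q ∈ closure Ω) : ∃ K, q ∈ simplex (elementVertices conn x K) :=
  Set.mem_iUnion.1 (hx.covers ▸ hq)

end IsNonsingularMesh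

namespace IsNeighbor

lemma symm (h : IsNeighbor conn K j L π) : IsNeighbor conn L (π j) K π⁻¹ := by
  refine ⟨h.1.symm, fun k hk => ?_⟩
  have hkj : π⁻¹ k ≠ j := fun e => hk (by simp [← e])
  simpa using (h.2 _ hkj).symm

lemma update_comp (h : IsNeighbor conn K j L π) (x : Fin Nv → EuclideanSpace ℝ (Fin d))
    (b : EuclideanSpace ℝ (Fin d)) :
    Function.update (elementVertices conn x L) (π j) b ∘ π =
      Function.update (elementVertices conn x K) j b := by
  ext1 k
  rcases eq_or_ne k j with rfl | hk
  · simp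
  · simp [elementVertices, hk, h.2 k hk]

lemma elementVertices_comp (h : IsNeighbor conn K j L π)
    (x : Fin Nv → EuclideanSpace ℝ (Fin d)) :
    elementVertices conn x L ∘ π =
      Function.update (elementVertices conn x K) j (x (conn L (π j))) := by
  rw [← h.update_comp]
  exact congrArg (· ∘ π) (Function.update_eq_self (π j) (elementVertices conn x L)).symm

lemma facet_subset_facet (h : IsNeighbor conn K j L π)
    (x : Fin Nv → EuclideanSpace ℝ (Fin d)) :
    facet (elementVertices conn x K) j ⊆ facet (elementVertices conn x L) (π j) := by
  refine convexHull_mono ?_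
  rintro _ ⟨k, hk, rfl⟩
  exact ⟨π k, fun h' => hk (π.injective h'), by simp [elementVertices, h.2 k hk]⟩

lemma facet_eq (h : IsNeighbor conn K j L π) (x : Fin Nv → EuclideanSpace ℝ (Fin d)) :
    facet (elementVertices conn x L) (π j) = facet (elementVertices conn x K) j :=
  Set.Subset.antisymm (by simpa using h.symm.facet_subset_facet x) (h.facet_subset_facet x)

lemma orient_mul_orient_neg (hd : 1 ≤ d) (hx : IsNonsingularMesh Ω conn x)
    (h : IsNeighbor conn K j L π) :
    orient (elementVertices conn x L ∘ π) * orient (elementVertices conn x K) < 0 := by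
  have hL : orient (elementVertices conn x L ∘ π) ≠ 0 := by
    rw [orient_comp_perm]
    exact mul_ne_zero (by simp) (hx.orient_ne_zero L)
  refine lt_of_le_of_ne (not_lt.1 fun hpos => ?_) (mul_ne_zero hL (hx.orient_ne_zero K))
  rw [h.elementVertices_comp] at hpos
  obtain ⟨q, hqK, hqL⟩ := interior_simplex_inter_nonempty_of_same_side hd hpos
  rw [← h.elementVertices_comp, simplex_comp_perm] at hqL
  exact Set.disjoint_left.1 (hx.nonoverlapping K L h.1) hqK hqL

/-- Two neighbours across the same facet lie on the same side of it, so they overlap unless they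
are equal. -/
lemma element_unique (hd : 1 ≤ d) (hx : IsNonsingularMesh Ω conn x) {L' : Fin N}
    {π' : Equiv.Perm (Fin (d + 1))} (h : IsNeighbor conn K j L π)
    (h' : IsNeighbor conn K j L' π') : L = L' := by
  by_contra hne
  have hpos : 0 < orient (elementVertices conn x L' ∘ π') *
      orient (elementVertices conn x L ∘ π) := by
    refine pos_of_mul_pos_left (b := orient (elementVertices conn x K) ^ 2) ?_ (sq_nonneg _)
    calc 0 < _ := mul_pos_of_neg_of_neg (h'.orient_mul_orient_neg hd hx)
            (h.orient_mul_orient_neg hd hx)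
      _ = _ := by ring
  have hupdate : elementVertices conn x L' ∘ π' =
      Function.update (elementVertices conn x L ∘ π) j (x (conn L' (π' j))) := by
    rw [h.elementVertices_comp, Function.update_idem, h'.elementVertices_comp]
  rw [hupdate] at hpos
  obtain ⟨q, hqL, hqL'⟩ := interior_simplex_inter_nonempty_of_same_side hd hpos
  rw [← hupdate, simplex_comp_perm] at hqL'
  rw [simplex_comp_perm] at hqL
  exact Set.disjoint_left.1 (hx.nonoverlapping L L' hne) hqL hqL'

lemma vertex_unique (hx : IsNonsingularMesh Ω conn x) {π' : Equiv.Perm (Fin (d + 1))}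
    (h : IsNeighbor conn K j L π) (h' : IsNeighbor conn K j L π') : π j = π' j := by
  by_contra hne
  obtain ⟨k, hk⟩ := π.surjective (π' j)
  have hkj : k ≠ j := fun e => hne (by rw [← hk, e])
  have hππ' : π k = π' k := hx.conn_injective L ((h.2 k hkj).trans (h'.2 k hkj).symm)
  exact hkj (π'.injective (hππ' ▸ hk))

end IsNeighbor

lemma exists_mem_bary_eq_zero_and_pos (hd : 1 ≤ d) (hΩ : IsOpen Ω)
    {y : Fin (d + 1) → EuclideanSpace ℝ (Fin d)} (hy : orient y ≠ 0)
    (hyΩ : simplex y ⊆ closure Ω) (hf : ¬ facet y j ⊆ frontier Ω) :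
    ∃ r ∈ Ω, bary y j r = 0 ∧ ∀ k, k ≠ j → 0 < bary y k r := by
  obtain ⟨r, hr, hrf⟩ := Set.not_subset.1 hf
  have hr_simplex := facet_subset_simplex y j hr
  have hrΩ : r ∈ Ω := by
    by_contra h
    exact hrf (hΩ.frontier_eq ▸ ⟨hyΩ hr_simplex, h⟩)
  obtain ⟨c, hc, hc'⟩ := exists_bary_eq_zero_and_pos hd hy j
  have hnear : ∀ᶠ t : ℝ in 𝓝[>] 0, AffineMap.lineMap r c t ∈ Ω :=
    nhdsWithin_le_nhds (AffineMap.lineMap_continuous.continuousAt.eventually_mem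
      (hΩ.mem_nhds (by simpa using hrΩ)))
  obtain ⟨t, htΩ, ht₀, ht₁⟩ := (hnear.and (Ioo_mem_nhdsGT (one_pos : (0 : ℝ) < 1))).exists
  refine ⟨_, htΩ, by simp [bary_lineMap, hc, bary_eq_zero_of_mem_facet hr], fun k hk => ?_⟩
  rw [bary_lineMap]
  exact add_pos_of_nonneg_of_pos
    (mul_nonneg (sub_nonneg.2 ht₁.le) ((mem_simplex_iff hy).1 hr_simplex k))
    (mul_pos ht₀ (hc' k hk))

/-- Otherwise `r` would be interior to `K`, which contains no points beyond its facet. -/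
lemma IsNonsingularMesh.exists_ne_mem_simplex (hx : IsNonsingularMesh Ω conn x) (hΩ : IsOpen Ω)
    {r : EuclideanSpace ℝ (Fin d)} (hr : r ∈ Ω) (hrj : bary (elementVertices conn x K) j r = 0) :
    ∃ L, L ≠ K ∧ r ∈ simplex (elementVertices conn x L) := by
  by_contra! hout
  have hy := hx.orient_ne_zero K
  have hfar : ∀ᶠ q in 𝓝 r, ∀ L, L ≠ K → q ∉ simplex (elementVertices conn x L) := by
    simp only [eventually_all]
    exact fun L hL => (isCompact_simplex _).isClosed.isOpen_compl.mem_nhds (hout L hL)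
  have hK : ∀ᶠ q in 𝓝 r, 0 ≤ bary (elementVertices conn x K) j q := by
    filter_upwards [hfar, hΩ.mem_nhds hr] with q hq hqΩ
    obtain ⟨L, hL⟩ := hx.exists_mem_simplex (subset_closure hqΩ)
    obtain rfl : L = K := by_contra fun h => hq L h hL
    exact (mem_simplex_iff hy).1 hL j
  have hline : Tendsto (AffineMap.lineMap r (elementVertices conn x K j)) (𝓝[<] (0 : ℝ)) (𝓝 r) := by
    have h := (AffineMap.lineMap_continuous (p := r) (q := elementVertices conn x K j)).tendsto
      (0 : ℝ)
    rw [AffineMap.lineMap_apply_zero] at h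
    exact h.mono_left nhdsWithin_le_nhds
  obtain ⟨t, ht, ht₀ : t < 0⟩ := ((hline.eventually hK).and self_mem_nhdsWithin).exists
  rw [bary_lineMap, hrj, bary_vertex_self hy] at ht
  linarith

/-- The common face of `K` and `L` contains a relatively interior point of the facet, hence all
vertices of the facet. -/
lemma exists_isNeighbor_of_mem_simplex (hx : IsNonsingularMesh Ω conn x) (hc : IsConforming conn x)
    (hKL : K ≠ L) {r : EuclideanSpace ℝ (Fin d)} (hrK : r ∈ simplex (elementVertices conn x K))
    (hrL : r ∈ simplex (elementVertices conn x L))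
    (hr : ∀ k, k ≠ j → 0 < bary (elementVertices conn x K) k r) :
    ∃ π, IsNeighbor conn K j L π := by
  have hshared : ∀ k, k ≠ j → ∃ l, conn L l = conn K k := by
    by_contra! ⟨k, hk, hnot⟩
    have hsub : x '' (Set.range (conn K) ∩ Set.range (conn L)) ⊆
        elementVertices conn x K '' {k}ᶜ := by
      rintro _ ⟨i, ⟨⟨a, rfl⟩, b, hb⟩, rfl⟩
      exact ⟨a, fun hak => hnot b (Set.mem_singleton_iff.1 hak ▸ hb), rfl⟩
    have hrk : r ∈ facet (elementVertices conn x K) k :=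
      convexHull_mono hsub (hc.inter_eq K L ▸ ⟨hrK, hrL⟩)
    exact (hr k hk).ne' (bary_eq_zero_of_mem_facet hrk)
  choose! f hf using hshared
  have hinj : Set.InjOn f (Finset.univ.erase j : Finset (Fin (d + 1))) := fun a ha b hb hab =>
    hx.conn_injective K (by rw [← hf a (by simpa using ha), ← hf b (by simpa using hb), hab])
  obtain ⟨π, hπ⟩ := Finset.exists_equiv_extend_of_card_eq
    (t := (Finset.univ : Finset (Fin (d + 1)))) (by simp) (Finset.subset_univ _) hinj
  refine ⟨π.trans (Equiv.subtypeUnivEquiv (by simp)), hKL, fun k hk => ?_⟩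
  simp [hπ k (by simpa using hk), hf k hk]

lemma exists_isNeighbor (hd : 1 ≤ d) (hΩ : IsOpen Ω) (hx : IsNonsingularMesh Ω conn x)
    (hc : IsConforming conn x) (hf : ¬ facet (elementVertices conn x K) j ⊆ frontier Ω) :
    ∃ L π, IsNeighbor conn K j L π := by
  have hy := hx.orient_ne_zero K
  obtain ⟨r, hrΩ, hrj, hr⟩ := exists_mem_bary_eq_zero_and_pos hd hΩ hy (hx.simplex_subset K) hf
  obtain ⟨L, hLK, hrL⟩ := hx.exists_ne_mem_simplex hΩ hrΩ hrj
  have hrK : r ∈ simplex (elementVertices conn x K) := by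
    refine (mem_simplex_iff hy).2 fun k => ?_
    rcases eq_or_ne k j with rfl | hk
    · exact hrj.ge
    · exact (hr k hk).le
  exact ⟨L, exists_isNeighbor_of_mem_simplex hx hc hLK.symm hrK hrL hr⟩

end Neighbors

/-! ### Invariance of the covering multiplicity -/

section Invariance

variable {d N Nv : ℕ} {Ω : Set (EuclideanSpace ℝ (Fin d))} {conn : Fin N → Fin (d + 1) → Fin Nv}
  {x₀ x₁ z : Fin Nv → EuclideanSpace ℝ (Fin d)} {i : Fin Nv} {b q : EuclideanSpace ℝ (Fin d)}

/-- Every vertex of a boundary facet of the mesh `x₀` stays in the hyperplane of that facet when the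
vertices are moved to `x₁`. -/
def SlidesAlongBoundary (Ω : Set (EuclideanSpace ℝ (Fin d))) (conn : Fin N → Fin (d + 1) → Fin Nv)
    (x₀ x₁ : Fin Nv → EuclideanSpace ℝ (Fin d)) : Prop :=
  ∀ K j, facet (elementVertices conn x₀ K) j ⊆ frontier Ω →
    ∀ k, k ≠ j → x₁ (conn K k) ∈ affineSpan ℝ (facet (elementVertices conn x₀ K) j)

lemma SlidesAlongBoundary.refl (Ω : Set (EuclideanSpace ℝ (Fin d)))
    (conn : Fin N → Fin (d + 1) → Fin Nv) (x₀ : Fin Nv → EuclideanSpace ℝ (Fin d)) :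
    SlidesAlongBoundary Ω conn x₀ x₀ := fun _ _ _ k hk =>
  subset_affineSpan ℝ _ (subset_convexHull ℝ _ ⟨k, hk, rfl⟩)

lemma SlidesAlongBoundary.piecewise (h₀ : SlidesAlongBoundary Ω conn x₀ z)
    (h₁ : SlidesAlongBoundary Ω conn x₀ x₁) (F : Finset (Fin Nv)) :
    SlidesAlongBoundary Ω conn x₀ (F.piecewise x₁ z) := fun K j hf k hk => by
  rw [Finset.piecewise]
  split_ifs
  exacts [h₁ K j hf k hk, h₀ K j hf k hk]

lemma SlidesAlongBoundary.orient_update_eq_zero (hx : IsNonsingularMesh Ω conn x₀)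
    (hz : SlidesAlongBoundary Ω conn x₀ z) {K : Fin N} {j : Fin (d + 1)}
    (hf : facet (elementVertices conn x₀ K) j ⊆ frontier Ω)
    (hb : b ∈ affineSpan ℝ (facet (elementVertices conn x₀ K) j)) :
    orient (Function.update (elementVertices conn z K) j b) = 0 := by
  refine orient_eq_zero_of_vertices_in_hyperplane (j := j) (hx.orient_ne_zero K) fun k => ?_
  refine orient_update_eq_zero_of_mem_affineSpan ?_
  rw [← affineSpan_convexHull]
  change _ ∈ affineSpan ℝ (facet (elementVertices conn x₀ K) j)
  rcases eq_or_ne k j with rfl | hk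
  · rwa [Function.update_self]
  · rw [Function.update_of_ne hk]
    exact hz K j hf k hk

/-- The number of elements of the mesh `x` that contain the point `q`. -/
def coveringNumber (conn : Fin N → Fin (d + 1) → Fin Nv) (x : Fin Nv → EuclideanSpace ℝ (Fin d))
    (q : EuclideanSpace ℝ (Fin d)) : ℝ :=
  ∑ K, (simplex (elementVertices conn x K)).indicator 1 q

/-- The covering number of the mesh `z` at `q` where elements whose orientation differs from that
in the mesh `x₀` count negatively. -/
def multiplicity (conn : Fin N → Fin (d + 1) → Fin Nv) (x₀ z : Fin Nv → EuclideanSpace ℝ (Fin d))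
    (q : EuclideanSpace ℝ (Fin d)) : ℝ :=
  ∑ K, (SignType.sign (orient (elementVertices conn x₀ K)) : ℝ) *
    signedIndicator (elementVertices conn z K) q

lemma multiplicity_eq_coveringNumber
    (hs : ∀ K, 0 < orient (elementVertices conn x₀ K) * orient (elementVertices conn x₁ K))
    (q : EuclideanSpace ℝ (Fin d)) : multiplicity conn x₀ x₁ q = coveringNumber conn x₁ q := by
  refine Finset.sum_congr rfl fun K _ => ?_
  rw [signedIndicator, ← mul_assoc, ← SignType.coe_mul, ← sign_mul, sign_pos (hs K)]
  simp

lemma IsNeighbor.sign_mul_sign_add_sign (hd : 1 ≤ d) (hx : IsNonsingularMesh Ω conn x₀)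
    {K L : Fin N} {j : Fin (d + 1)} {π : Equiv.Perm (Fin (d + 1))} (h : IsNeighbor conn K j L π) :
    (SignType.sign (orient (elementVertices conn x₀ K)) : ℝ) * ((Equiv.Perm.sign π : ℤ) : ℝ) +
      (SignType.sign (orient (elementVertices conn x₀ L)) : ℝ) = 0 := by
  have hprod : ((Equiv.Perm.sign π : ℤ) : ℝ) *
      (SignType.sign (orient (elementVertices conn x₀ L)) : ℝ) *
      (SignType.sign (orient (elementVertices conn x₀ K)) : ℝ) = -1 := by
    have hsign := sign_neg (h.orient_mul_orient_neg hd hx)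
    rw [orient_comp_perm, sign_mul, sign_mul] at hsign
    rw [← sign_permSign]
    simpa using congrArg (fun s : SignType => (s : ℝ)) hsign
  have hsq : (SignType.sign (orient (elementVertices conn x₀ L)) : ℝ) *
      (SignType.sign (orient (elementVertices conn x₀ L)) : ℝ) = 1 := by
    rw [← SignType.coe_mul, ← sign_mul, sign_pos (mul_self_pos.2 (hx.orient_ne_zero L)),
      SignType.coe_one]
  linear_combination (SignType.sign (orient (elementVertices conn x₀ L)) : ℝ) * hprod -
    (SignType.sign (orient (elementVertices conn x₀ K)) : ℝ) * ((Equiv.Perm.sign π : ℤ) : ℝ) * hsq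

open Classical in
/-- The change of the multiplicity that the facet of `K` opposite to its vertex `j` causes when the
vertex `i` moves from `z i` to `b`: the signed indicator of the join of `b` and the facet, if the
facet contains `i`. -/
def facetTerm (conn : Fin N → Fin (d + 1) → Fin Nv) (x₀ z : Fin Nv → EuclideanSpace ℝ (Fin d))
    (i : Fin Nv) (b q : EuclideanSpace ℝ (Fin d)) (K : Fin N) (j : Fin (d + 1)) : ℝ :=
  if ∃ k, k ≠ j ∧ conn K k = i then
    (SignType.sign (orient (elementVertices conn x₀ K)) : ℝ) *
      signedIndicator (Function.update (elementVertices conn z K) j b) q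
  else 0

lemma IsNeighbor.facetTerm_add_facetTerm (hd : 1 ≤ d) (hx : IsNonsingularMesh Ω conn x₀)
    {K L : Fin N} {j : Fin (d + 1)} {π : Equiv.Perm (Fin (d + 1))} (h : IsNeighbor conn K j L π) :
    facetTerm conn x₀ z i b q K j + facetTerm conn x₀ z i b q L (π j) = 0 := by
  have hiff : (∃ k, k ≠ j ∧ conn K k = i) ↔ ∃ k, k ≠ π j ∧ conn L k = i := by
    constructor
    · rintro ⟨k, hk, rfl⟩
      exact ⟨π k, fun e => hk (π.injective e), h.2 k hk⟩
    · rintro ⟨k, hk, rfl⟩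
      exact ⟨π⁻¹ k, fun e => hk (by simp [← e]), h.symm.2 k hk⟩
  simp only [facetTerm, hiff]
  split_ifs
  · rw [← h.update_comp, signedIndicator_comp_perm, ← mul_assoc, ← add_mul,
      h.sign_mul_sign_add_sign hd hx, zero_mul]
  · exact add_zero 0

lemma SlidesAlongBoundary.facetTerm_eq_zero (hx : IsNonsingularMesh Ω conn x₀)
    (hz : SlidesAlongBoundary Ω conn x₀ z)
    (hz' : SlidesAlongBoundary Ω conn x₀ (Function.update z i b)) {K : Fin N} {j : Fin (d + 1)}
    (hf : facet (elementVertices conn x₀ K) j ⊆ frontier Ω) :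
    facetTerm conn x₀ z i b q K j = 0 := by
  rw [facetTerm]
  split_ifs with h
  · obtain ⟨k, hk, rfl⟩ := h
    have hb : b ∈ affineSpan ℝ (facet (elementVertices conn x₀ K) j) := by
      simpa using hz' K j hf k hk
    rw [signedIndicator_of_orient_eq_zero (hz.orient_update_eq_zero hx hf hb), mul_zero]
  · rfl

/-- The terms of the interior facets cancel in pairs of neighbours. -/
lemma sum_facetTerm (hd : 1 ≤ d) (hΩ : IsOpen Ω) (hx : IsNonsingularMesh Ω conn x₀)
    (hc : IsConforming conn x₀) (hz : SlidesAlongBoundary Ω conn x₀ z)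
    (hz' : SlidesAlongBoundary Ω conn x₀ (Function.update z i b)) :
    ∑ K, ∑ j, facetTerm conn x₀ z i b q K j = 0 := by
  classical
  rw [← Fintype.sum_prod_type']
  set s := Finset.univ.filter fun a : Fin N × Fin (d + 1) =>
    ¬ facet (elementVertices conn x₀ a.1) a.2 ⊆ frontier Ω
  have hs : ∀ {a}, a ∈ s ↔ ¬ facet (elementVertices conn x₀ a.1) a.2 ⊆ frontier Ω := by simp [s]
  rw [← Finset.sum_subset (Finset.subset_univ s) fun a _ ha =>
    hz.facetTerm_eq_zero hx hz' (not_not.1 (hs.not.1 ha))]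
  choose L π hπ using fun a (ha : a ∈ s) => exists_isNeighbor hd hΩ hx hc (hs.1 ha)
  have hmem : ∀ a ha, (L a ha, π a ha a.2) ∈ s := fun a ha => by
    rw [hs, (hπ a ha).facet_eq]
    exact hs.1 ha
  refine Finset.sum_involution (fun a ha => (L a ha, π a ha a.2))
    (fun a ha => (hπ a ha).facetTerm_add_facetTerm hd hx)
    (fun a ha _ he => (hπ a ha).1 (congrArg Prod.fst he).symm) hmem fun a ha => ?_
  have hback := (hπ a ha).symm
  have hnext := hπ _ (hmem a ha)
  have hL : L _ (hmem a ha) = a.1 := hnext.element_unique hd hx hback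
  refine Prod.ext hL (((hL ▸ hnext).vertex_unique hx hback).trans ?_)
  simp

lemma ae_signedIndicator_update_vertex (hx : IsNonsingularMesh Ω conn x₀) (K : Fin N)
    (z : Fin Nv → EuclideanSpace ℝ (Fin d)) (i : Fin Nv) (b : EuclideanSpace ℝ (Fin d)) :
    ∀ᵐ q, (SignType.sign (orient (elementVertices conn x₀ K)) : ℝ) *
        signedIndicator (elementVertices conn z K) q =
      (SignType.sign (orient (elementVertices conn x₀ K)) : ℝ) *
        signedIndicator (elementVertices conn (Function.update z i b) K) q +
          ∑ j, facetTerm conn x₀ z i b q K j := by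
  by_cases hi : ∃ k, conn K k = i
  · obtain ⟨k, rfl⟩ := hi
    have hupdate : elementVertices conn (Function.update z (conn K k) b) K =
        Function.update (elementVertices conn z K) k b :=
      Function.update_comp_eq_of_injective z (hx.conn_injective K) k b
    filter_upwards [ae_signedIndicator_eq_sum (elementVertices conn z K) b] with q hq
    have hk : facetTerm conn x₀ z (conn K k) b q K k = 0 :=
      if_neg fun ⟨l, hl, hlk⟩ => hl (hx.conn_injective K hlk)
    rw [hq, Finset.mul_sum, ← Finset.add_sum_erase _ _ (Finset.mem_univ k), hupdate,
      ← Finset.add_sum_erase _ _ (Finset.mem_univ k), hk, zero_add]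
    congr 1
    exact Finset.sum_congr rfl fun j hj =>
      (if_pos ⟨k, (Finset.ne_of_mem_erase hj).symm, rfl⟩).symm
  · have hupdate : elementVertices conn (Function.update z i b) K = elementVertices conn z K :=
      Function.update_comp_eq_of_notMem_range z b fun ⟨l, hl⟩ => hi ⟨l, hl⟩
    refine .of_forall fun q => ?_
    have hzero : ∀ j, facetTerm conn x₀ z i b q K j = 0 := fun j =>
      if_neg fun ⟨k, _, hk⟩ => hi ⟨k, hk⟩
    simp only [hupdate, hzero, Finset.sum_const_zero, add_zero]

lemma ae_multiplicity_update (hd : 1 ≤ d) (hΩ : IsOpen Ω) (hx : IsNonsingularMesh Ω conn x₀)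
    (hc : IsConforming conn x₀) (hz : SlidesAlongBoundary Ω conn x₀ z)
    (hz' : SlidesAlongBoundary Ω conn x₀ (Function.update z i b)) :
    ∀ᵐ q, multiplicity conn x₀ (Function.update z i b) q = multiplicity conn x₀ z q := by
  filter_upwards [ae_all_iff.2 fun K => ae_signedIndicator_update_vertex hx K z i b] with q hq
  rw [multiplicity, multiplicity, Finset.sum_congr rfl fun K _ => hq K, Finset.sum_add_distrib,
    sum_facetTerm hd hΩ hx hc hz hz', add_zero]

lemma ae_multiplicity_eq (hd : 1 ≤ d) (hΩ : IsOpen Ω) (hx : IsNonsingularMesh Ω conn x₀)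
    (hc : IsConforming conn x₀) (h₁ : SlidesAlongBoundary Ω conn x₀ x₁) :
    ∀ᵐ q, multiplicity conn x₀ x₁ q = multiplicity conn x₀ x₀ q := by
  have hpiece (F : Finset (Fin Nv)) := (SlidesAlongBoundary.refl Ω conn x₀).piecewise h₁ F
  suffices ∀ F : Finset (Fin Nv),
      ∀ᵐ q, multiplicity conn x₀ (F.piecewise x₁ x₀) q = multiplicity conn x₀ x₀ q by
    simpa using this Finset.univ
  intro F
  induction F using Finset.induction_on with
  | empty => simp
  | insert i F _ ih =>
    have hinsert := hpiece (insert i F)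
    rw [Finset.piecewise_insert] at hinsert ⊢
    filter_upwards [ih, ae_multiplicity_update hd hΩ hx hc (hpiece F) hinsert] with q hF hi
    rw [hi, hF]

lemma coveringNumber_eq_zero_iff :
    coveringNumber conn x₁ q = 0 ↔ ∀ K, q ∉ simplex (elementVertices conn x₁ K) := by
  rw [coveringNumber, Finset.sum_eq_zero_iff_of_nonneg
    (f := fun K => (simplex (elementVertices conn x₁ K)).indicator 1 q) fun K _ =>
      Set.indicator_nonneg (fun _ _ => zero_le_one) q]
  simp

lemma two_le_coveringNumber {K L : Fin N} (hKL : K ≠ L)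
    (hK : q ∈ simplex (elementVertices conn x₁ K)) (hL : q ∈ simplex (elementVertices conn x₁ L)) :
    2 ≤ coveringNumber conn x₁ q := by
  calc (2 : ℝ) = ∑ J ∈ {K, L}, (simplex (elementVertices conn x₁ J)).indicator 1 q := by
        rw [Finset.sum_pair hKL, Set.indicator_of_mem hK, Set.indicator_of_mem hL]
        norm_num
    _ ≤ coveringNumber conn x₁ q :=
        Finset.sum_le_sum_of_subset_of_nonneg (Finset.subset_univ _) fun J _ _ =>
          Set.indicator_nonneg (fun _ _ => zero_le_one) q

lemma IsNonsingularMesh.ae_coveringNumber (hx : IsNonsingularMesh Ω conn x₀) :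
    ∀ᵐ q, coveringNumber conn x₀ q = (closure Ω).indicator 1 q := by
  filter_upwards [ae_all_iff.2 fun K => ae_notMem_frontier_simplex (elementVertices conn x₀ K)]
    with q hq
  by_cases h : q ∈ closure Ω
  · have hint : ∀ L, q ∈ simplex (elementVertices conn x₀ L) →
        q ∈ interior (simplex (elementVertices conn x₀ L)) := fun L hL =>
      not_not.1 fun hc => hq L ⟨subset_closure hL, hc⟩
    obtain ⟨K, hK⟩ := hx.exists_mem_simplex h
    rw [Set.indicator_of_mem h, coveringNumber,
      Finset.sum_eq_single K (fun L _ hL => ?_) (by simp), Set.indicator_of_mem hK]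
    exact Set.indicator_of_notMem (fun hqL =>
      Set.disjoint_left.1 (hx.nonoverlapping L K hL) (hint L hqL) (hint K hK)) _
  · rw [Set.indicator_of_notMem h, coveringNumber_eq_zero_iff]
    exact fun K hK => h (hx.simplex_subset K hK)

lemma disjoint_interior_of_ae_coveringNumber_lt_two (h : ∀ᵐ q, coveringNumber conn x₁ q < 2)
    {K L : Fin N} (hKL : K ≠ L) :
    Disjoint (interior (simplex (elementVertices conn x₁ K)))
      (interior (simplex (elementVertices conn x₁ L))) := by
  rw [Set.disjoint_iff_inter_eq_empty, ← Set.not_nonempty_iff_eq_empty]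
  intro hne
  obtain ⟨q, ⟨hqK, hqL⟩, hq : coveringNumber conn x₁ q < 2⟩ :=
    (Measure.dense_of_ae h).inter_open_nonempty _ (isOpen_interior.inter isOpen_interior) hne
  exact hq.not_ge (two_le_coveringNumber hKL (interior_subset hqK) (interior_subset hqL))

lemma simplex_subset_closure_of_ae_coveringNumber
    (h : ∀ᵐ q, q ∉ closure Ω → coveringNumber conn x₁ q = 0) {K : Fin N}
    (hK : orient (elementVertices conn x₁ K) ≠ 0) :
    simplex (elementVertices conn x₁ K) ⊆ closure Ω := by
  calc simplex (elementVertices conn x₁ K)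
      ⊆ closure (interior (simplex (elementVertices conn x₁ K))) := by
        rw [(convex_simplex _).closure_interior_eq_closure_of_nonempty_interior
          (interior_simplex_nonempty hK)]
        exact subset_closure
    _ ⊆ closure Ω := closure_minimal (fun q hq => ?_) isClosed_closure
  refine closure_minimal ?_ isClosed_closure
    ((Measure.dense_of_ae h).open_subset_closure_inter isOpen_interior hq)
  rintro r ⟨hrK, hr⟩
  by_contra hout
  exact coveringNumber_eq_zero_iff.1 (hr hout) K (interior_subset hrK)

lemma closure_subset_iUnion_simplex_of_ae_coveringNumber (hΩ : IsOpen Ω)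
    (h : ∀ᵐ q, q ∈ Ω → coveringNumber conn x₁ q ≠ 0) :
    closure Ω ⊆ ⋃ K, simplex (elementVertices conn x₁ K) := by
  have hclosed : IsClosed (⋃ K, simplex (elementVertices conn x₁ K)) :=
    isClosed_iUnion_of_finite fun K => (isCompact_simplex _).isClosed
  refine closure_minimal (fun q hq => closure_minimal ?_ hclosed
    ((Measure.dense_of_ae h).open_subset_closure_inter hΩ hq)) hclosed
  rintro r ⟨hrΩ, hr⟩
  by_contra hout
  exact hr hrΩ (coveringNumber_eq_zero_iff.2 fun K hK => hout (Set.mem_iUnion.2 ⟨K, hK⟩))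

/-- Since all orientations are kept, the invariant multiplicity is the covering number. -/
lemma isNonsingularMesh_of_orient_mul_pos (hd : 1 ≤ d) (hΩ : IsOpen Ω)
    (hx : IsNonsingularMesh Ω conn x₀) (hc : IsConforming conn x₀)
    (h₁ : SlidesAlongBoundary Ω conn x₀ x₁)
    (hs : ∀ K, 0 < orient (elementVertices conn x₀ K) * orient (elementVertices conn x₁ K)) :
    IsNonsingularMesh Ω conn x₁ := by
  have hne : ∀ K, orient (elementVertices conn x₁ K) ≠ 0 := fun K =>
    right_ne_zero_of_mul (hs K).ne'
  have hcover : ∀ᵐ q, coveringNumber conn x₁ q = (closure Ω).indicator 1 q := by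
    filter_upwards [ae_multiplicity_eq hd hΩ hx hc h₁, hx.ae_coveringNumber] with q hq hq₀
    rw [← multiplicity_eq_coveringNumber hs, hq,
      multiplicity_eq_coveringNumber fun K => mul_self_pos.2 (hx.orient_ne_zero K), hq₀]
  refine ⟨fun K => affineIndependent_iff_orient_ne_zero.2 (hne K), fun K L =>
    disjoint_interior_of_ae_coveringNumber_lt_two ?_,
    (Set.iUnion_subset fun K => simplex_subset_closure_of_ae_coveringNumber ?_ (hne K)).antisymm
      (closure_subset_iUnion_simplex_of_ae_coveringNumber hΩ ?_)⟩
  · filter_upwards [hcover] with q hq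
    rw [hq]
    exact (Set.indicator_le' (fun _ _ => le_rfl) (fun _ _ => zero_le_one) q).trans_lt one_lt_two
  · filter_upwards [hcover] with q hq hout
    rw [hq, Set.indicator_of_notMem hout]
  · filter_upwards [hcover] with q hq hqΩ
    rw [hq, Set.indicator_of_mem (subset_closure hqΩ)]
    exact one_ne_zero

end Invariance

/-! ### Averages of the metric tensor -/

section CornerSimplex

/-- The corner of size `r` of the positive orthant: the points with nonnegative coordinates whose
sum is at most `r`. -/
def cornerSimplex (n : ℕ) (r : ℝ) : Set (Fin n → ℝ) := {s | (∀ k, 0 ≤ s k) ∧ ∑ k, s k ≤ r}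

lemma isClosed_cornerSimplex (n : ℕ) (r : ℝ) : IsClosed (cornerSimplex n r) :=
  (isClosed_Ici (a := (0 : Fin n → ℝ))).inter
    (isClosed_le (continuous_finsetSum _ fun k _ => continuous_apply k) continuous_const)

lemma cons_mem_cornerSimplex {n : ℕ} {r t : ℝ} {s : Fin n → ℝ} :
    (Fin.cons t s : Fin (n + 1) → ℝ) ∈ cornerSimplex (n + 1) r ↔
      t ∈ Set.Icc 0 r ∧ s ∈ cornerSimplex n (r - t) := by
  simp only [cornerSimplex, Set.mem_ofPred_eq, Fin.forall_fin_succ, Fin.cons_zero, Fin.cons_succ,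
    Fin.sum_univ_succ, Set.mem_Icc, le_sub_iff_add_le']
  refine ⟨fun ⟨⟨ht, hs⟩, hr⟩ => ⟨⟨ht, ?_⟩, hs, hr⟩, fun ⟨⟨ht, _⟩, hs, hr⟩ => ⟨⟨ht, hs⟩, hr⟩⟩
  linarith [Finset.sum_nonneg fun k (_ : k ∈ Finset.univ) => hs k]

lemma volume_cornerSimplex_succ (n : ℕ) (r : ℝ) :
    volume (cornerSimplex (n + 1) r) = ∫⁻ t in Set.Icc 0 r, volume (cornerSimplex n (r - t)) := by
  have hmp := (volume_preserving_piFinSuccAbove (fun _ : Fin (n + 1) => ℝ) 0).symm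
  have hmeas := (isClosed_cornerSimplex (n + 1) r).measurableSet
  rw [← hmp.measure_preimage hmeas.nullMeasurableSet, Measure.volume_eq_prod,
    Measure.prod_apply (hmp.measurable hmeas), ← lintegral_indicator measurableSet_Icc]
  refine lintegral_congr fun t => ?_
  have hslice : Prod.mk t ⁻¹' ((MeasurableEquiv.piFinSuccAbove (fun _ : Fin (n + 1) => ℝ) 0).symm
      ⁻¹' cornerSimplex (n + 1) r) = {s | t ∈ Set.Icc 0 r ∧ s ∈ cornerSimplex n (r - t)} := by
    ext s
    rw [Set.mem_ofPred_eq, ← cons_mem_cornerSimplex, ← Fin.insertNth_zero']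
    rfl
  rw [hslice]
  by_cases ht : t ∈ Set.Icc 0 r <;> simp [ht]

lemma volume_cornerSimplex (n : ℕ) {r : ℝ} (hr : 0 ≤ r) :
    volume (cornerSimplex n r) = ENNReal.ofReal (r ^ n / n !) := by
  induction n generalizing r with
  | zero => simp [cornerSimplex, hr, volume_pi]
  | succ n ih =>
    have hnonneg : ∀ t ∈ Set.Icc 0 r, 0 ≤ (r - t) ^ n / n ! := fun t ht => by
      have := sub_nonneg.2 ht.2
      positivity
    rw [volume_cornerSimplex_succ, setLIntegral_congr_fun measurableSet_Icc fun t ht =>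
        ih (sub_nonneg.2 ht.2),
      ← ofReal_integral_eq_lintegral_ofReal (Continuous.integrableOn_Icc (by fun_prop))
        ((ae_restrict_iff' measurableSet_Icc).2 (.of_forall hnonneg)),
      integral_Icc_eq_integral_Ioc, ← intervalIntegral.integral_of_le hr,
      intervalIntegral.integral_div, intervalIntegral.integral_comp_sub_left (fun t => t ^ n) r,
      integral_pow, sub_self, sub_zero, zero_pow n.succ_ne_zero, sub_zero, div_div,
      Nat.factorial_succ]
    push_cast
    rfl

end CornerSimplex

section ChangeOfVariables

variable {d : ℕ} {y : Fin (d + 1) → EuclideanSpace ℝ (Fin d)}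

/-- The barycentric coordinates of a point with respect to the simplex with the vertices `0` and
the unit vectors. -/
def stdBary (s : EuclideanSpace ℝ (Fin d)) : Fin (d + 1) → ℝ :=
  Fin.cons (1 - ∑ k, s k) fun k => s k

/-- The simplex with the vertices `0` and the unit vectors, used as domain of parametrization of
all simplices. -/
def stdElement (d : ℕ) : Set (EuclideanSpace ℝ (Fin d)) := {s | ∀ k, 0 ≤ stdBary s k}

/-- The point with standard barycentric coordinates `stdBary s` in the simplex with vertices `y`,
as a linear function of `y`. -/
def elementMap (s : EuclideanSpace ℝ (Fin d)) :
    (Fin (d + 1) → EuclideanSpace ℝ (Fin d)) →L[ℝ] EuclideanSpace ℝ (Fin d) :=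
  ∑ k, stdBary s k • ContinuousLinearMap.proj k

lemma elementMap_apply (s : EuclideanSpace ℝ (Fin d))
    (y : Fin (d + 1) → EuclideanSpace ℝ (Fin d)) :
    elementMap s y = ∑ k, stdBary s k • y k := by
  simp [elementMap]

lemma sum_stdBary (s : EuclideanSpace ℝ (Fin d)) : ∑ k, stdBary s k = 1 := by
  simp [stdBary, Fin.sum_univ_succ]

lemma stdBary_toLp_succ {w : Fin (d + 1) → ℝ} (hw : ∑ k, w k = 1) :
    stdBary (WithLp.toLp 2 fun k : Fin d => w k.succ) = w := by
  ext k
  refine Fin.cases ?_ (fun a => rfl) k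
  rw [Fin.sum_univ_succ] at hw
  exact sub_eq_of_eq_add hw.symm

lemma continuous_stdBary (k : Fin (d + 1)) :
    Continuous fun s : EuclideanSpace ℝ (Fin d) => stdBary s k := by
  refine Fin.cases ?_ (fun a => ?_) k
  · simp only [stdBary, Fin.cons_zero]
    fun_prop
  · simp only [stdBary, Fin.cons_succ]
    fun_prop

lemma continuous_elementMap : Continuous (elementMap (d := d)) := by
  unfold elementMap
  exact continuous_finsetSum _ fun k _ => (continuous_stdBary k).smul continuous_const

lemma stdElement_eq (d : ℕ) : stdElement d = WithLp.ofLp ⁻¹' cornerSimplex d 1 := by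
  ext s
  simp [stdElement, cornerSimplex, stdBary, Fin.forall_fin_succ, and_comm]

lemma isClosed_stdElement (d : ℕ) : IsClosed (stdElement d) := by
  rw [stdElement_eq]
  exact (isClosed_cornerSimplex d 1).preimage (PiLp.continuous_ofLp 2 _)

lemma volume_stdElement (d : ℕ) : volume.real (stdElement d) = 1 / d ! := by
  rw [stdElement_eq, measureReal_def, (PiLp.volume_preserving_ofLp (Fin d)).measure_preimage
    (isClosed_cornerSimplex _ _).measurableSet.nullMeasurableSet,
    volume_cornerSimplex d zero_le_one, one_pow, ENNReal.toReal_ofReal (by positivity)]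

lemma elementMap_image (y : Fin (d + 1) → EuclideanSpace ℝ (Fin d)) :
    (fun s => elementMap s y) '' stdElement d = simplex y := by
  have himage : stdBary '' stdElement d = stdSimplex ℝ (Fin (d + 1)) := by
    refine Set.Subset.antisymm (Set.image_subset_iff.2 fun s hs => ⟨hs, sum_stdBary s⟩)
      fun w hw => ⟨WithLp.toLp 2 fun k => w k.succ, fun k => ?_, stdBary_toLp_succ hw.2⟩
    rw [stdBary_toLp_succ hw.2]
    exact hw.1 k
  rw [simplex_eq_image_stdSimplex, ← himage, Set.image_image]
  exact Set.image_congr fun s _ => elementMap_apply s y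

lemma elementMap_mem_simplex {s : EuclideanSpace ℝ (Fin d)} (hs : s ∈ stdElement d)
    (y : Fin (d + 1) → EuclideanSpace ℝ (Fin d)) : elementMap s y ∈ simplex y :=
  elementMap_image y ▸ ⟨s, hs, rfl⟩

lemma isCompact_stdElement (d : ℕ) : IsCompact (stdElement d) := by
  have hid (s : EuclideanSpace ℝ (Fin d)) :
      elementMap s (Fin.cons 0 fun k => EuclideanSpace.single k 1) = s := by
    ext a
    simp [elementMap_apply, Fin.sum_univ_succ, stdBary, Pi.single_apply]
  have himage := elementMap_image (d := d) (Fin.cons 0 fun k => EuclideanSpace.single k 1)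
  simp only [hid, Set.image_id'] at himage
  exact himage ▸ isCompact_simplex _

lemma elementMap_eq (y : Fin (d + 1) → EuclideanSpace ℝ (Fin d)) (s : EuclideanSpace ℝ (Fin d)) :
    elementMap s y = y 0 + Matrix.toEuclideanCLM (n := Fin d) (𝕜 := ℝ) (edgeMatrix y) s := by
  have hedges : Matrix.toEuclideanCLM (n := Fin d) (𝕜 := ℝ) (edgeMatrix y) s =
      ∑ k, s k • (y k.succ - y 0) := by
    ext a
    simp [Matrix.mulVec, dotProduct, edgeMatrix, mul_comm]
  simp only [elementMap_apply, hedges, Fin.sum_univ_succ, stdBary, Fin.cons_zero, Fin.cons_succ,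
    smul_sub, Finset.sum_sub_distrib, sub_smul, one_smul, Finset.sum_smul]
  abel

lemma injective_elementMap (hy : orient y ≠ 0) : Function.Injective fun s => elementMap s y := by
  intro s t hst
  simp only [elementMap_apply] at hst
  ext k
  have hbary := bary_sum_smul_vertex hy (sum_stdBary s) k.succ
  rw [hst, bary_sum_smul_vertex hy (sum_stdBary t)] at hbary
  exact hbary.symm

lemma det_toEuclideanCLM_edgeMatrix (y : Fin (d + 1) → EuclideanSpace ℝ (Fin d)) :
    (Matrix.toEuclideanCLM (n := Fin d) (𝕜 := ℝ) (edgeMatrix y)).det = orient y := by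
  rw [orient_eq_det_edgeMatrix, ContinuousLinearMap.det,
    Matrix.coe_toEuclideanCLM_eq_toEuclideanLin]
  exact LinearMap.det_toLpLin _ _

lemma setIntegral_simplex {E : Type*} [NormedAddCommGroup E] [NormedSpace ℝ E] (hy : orient y ≠ 0)
    (g : EuclideanSpace ℝ (Fin d) → E) :
    ∫ z in simplex y, g z = |orient y| • ∫ s in stdElement d, g (elementMap s y) := by
  have hderiv (s : EuclideanSpace ℝ (Fin d)) : HasFDerivWithinAt (fun s => elementMap s y)
      (Matrix.toEuclideanCLM (n := Fin d) (𝕜 := ℝ) (edgeMatrix y)) (stdElement d) s := by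
    rw [funext (elementMap_eq y)]
    exact ((ContinuousLinearMap.hasFDerivAt _).const_add _).hasFDerivWithinAt
  rw [← elementMap_image y, integral_image_eq_integral_abs_det_fderiv_smul volume
    (isClosed_stdElement d).measurableSet (fun s _ => hderiv s) (injective_elementMap hy).injOn]
  simp only [det_toEuclideanCLM_edgeMatrix, integral_smul]

lemma vol_eq (hy : orient y ≠ 0) : vol y = |orient y| / d ! := by
  have h := setIntegral_simplex hy fun _ => (1 : ℝ)
  simp only [integral_const, smul_eq_mul, mul_one, measureReal_restrict_apply_univ] at h
  rw [vol, h, volume_stdElement, mul_one_div]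

lemma vol_pos (hy : orient y ≠ 0) : 0 < vol y := by
  rw [vol_eq hy]
  positivity

lemma averageMetric_eq (M : EuclideanSpace ℝ (Fin d) → Matrix (Fin d) (Fin d) ℝ)
    (hy : orient y ≠ 0) (a b : Fin d) :
    averageMetric M y a b = d ! * ∫ s in stdElement d, M (elementMap s y) a b := by
  have hv : volume.real (simplex y) = |orient y| / d ! := vol_eq hy
  rw [averageMetric, Matrix.of_apply, setAverage_eq, setIntegral_simplex hy, hv, smul_smul,
    inv_div, div_mul_cancel₀ _ (abs_ne_zero.2 hy), smul_eq_mul]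

end ChangeOfVariables

section MatrixBounds

lemma isClosed_setOf_posSemidef {n : Type*} [Finite n] :
    IsClosed {A : Matrix n n ℝ | A.PosSemidef} := by
  have := Fintype.ofFinite n
  simp only [Matrix.posSemidef_iff_dotProduct_mulVec, Matrix.IsHermitian, Set.ofPred_and,
    Set.ofPred_forall]
  exact (isClosed_eq continuous_id.matrix_conjTranspose continuous_id).inter
    (isClosed_iInter fun v => isClosed_le continuous_const
      (continuous_const.dotProduct (continuous_id.matrix_mulVec continuous_const)))

lemma posDef_of_sub_smul_posSemidef {n : Type*} [DecidableEq n] {A : Matrix n n ℝ} {m : ℝ}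
    (hm : 0 < m) (hA : (A - m • (1 : Matrix n n ℝ)).PosSemidef) : A.PosDef := by
  simpa using Matrix.PosDef.posSemidef_add hA (Matrix.PosDef.one.smul hm)

lemma isHermitian_of_sub_smul_posSemidef {n : Type*} [DecidableEq n] {A : Matrix n n ℝ} {m : ℝ}
    (h : (A - m • (1 : Matrix n n ℝ)).PosSemidef) : A.IsHermitian := by
  simpa using h.isHermitian.add (Matrix.isHermitian_one.smul (k := m) (by simp [IsSelfAdjoint]))

lemma prod_le_sum_div_card_pow {n : Type*} [Fintype n] {w : n → ℝ} (hw : ∀ i, 0 ≤ w i) :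
    ∏ i, w i ≤ ((∑ i, w i) / Fintype.card n) ^ Fintype.card n := by
  rcases isEmpty_or_nonempty n with h | h
  · simp
  have hcard : (0 : ℝ) < Fintype.card n := by exact_mod_cast Fintype.card_pos
  have hprod : 0 ≤ ∏ i, w i := Finset.prod_nonneg fun i _ => hw i
  have hmean := Real.geom_mean_le_arith_mean Finset.univ (fun _ => 1) w (by simp)
    (by simpa using hcard) fun i _ => hw i
  simp only [Real.rpow_one, one_mul, Finset.sum_const, Finset.card_univ, nsmul_eq_mul,
    mul_one] at hmean
  rwa [← Real.rpow_natCast, ← Real.rpow_inv_le_iff_of_pos hprod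
    (div_nonneg (Finset.sum_nonneg fun i _ => hw i) hcard.le) hcard]

open scoped MatrixOrder in
lemma exists_eq_transpose_mul_self {n : Type*} [Fintype n] {A : Matrix n n ℝ}
    (hA : A.PosSemidef) : ∃ Q : Matrix n n ℝ, A = Q.transpose * Q := by
  classical
  obtain ⟨Q, hQ⟩ := CStarAlgebra.nonneg_iff_eq_star_mul_self.mp hA.nonneg
  exact ⟨Q, hQ⟩

variable {n : Type*} [Fintype n] [DecidableEq n] {A : Matrix n n ℝ} {m : ℝ}

lemma dotProduct_eigenvectorBasis_sub_smul (hA : A.IsHermitian) (m : ℝ) (i : n) :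
    hA.eigenvectorBasis i ⬝ᵥ (A - m • (1 : Matrix n n ℝ)).mulVec (hA.eigenvectorBasis i) =
      hA.eigenvalues i - m := by
  rw [Matrix.sub_mulVec, hA.mulVec_eigenvectorBasis, Matrix.smul_mulVec, Matrix.one_mulVec,
    ← sub_smul, dotProduct_smul]
  have hone := real_inner_self_eq_norm_sq (hA.eigenvectorBasis i)
  rw [EuclideanSpace.inner_eq_star_dotProduct, star_trivial, hA.eigenvectorBasis.orthonormal.1 i,
    one_pow] at hone
  rw [hone, smul_eq_mul, mul_one]

lemma le_eigenvalues (hA : A.IsHermitian) (h : (A - m • (1 : Matrix n n ℝ)).PosSemidef) (i : n) :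
    m ≤ hA.eigenvalues i := by
  have hnonneg := h.dotProduct_mulVec_nonneg (hA.eigenvectorBasis i)
  rwa [star_trivial, dotProduct_eigenvectorBasis_sub_smul, sub_nonneg] at hnonneg

lemma eigenvalues_le (hA : A.IsHermitian) (h : (m • (1 : Matrix n n ℝ) - A).PosSemidef) (i : n) :
    hA.eigenvalues i ≤ m := by
  have hnonneg := h.dotProduct_mulVec_nonneg (hA.eigenvectorBasis i)
  rwa [← neg_sub A, star_trivial, Matrix.neg_mulVec, dotProduct_neg,
    dotProduct_eigenvectorBasis_sub_smul, neg_sub, sub_nonneg] at hnonneg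

lemma pow_le_det (hm : 0 ≤ m) (h : (A - m • (1 : Matrix n n ℝ)).PosSemidef) :
    m ^ Fintype.card n ≤ A.det := by
  have hA := isHermitian_of_sub_smul_posSemidef h
  rw [hA.det_eq_prod_eigenvalues, ← Finset.card_univ, ← Finset.prod_const]
  exact Finset.prod_le_prod (fun _ _ => hm) fun i _ => le_eigenvalues hA h i

lemma det_le_pow (hA : A.PosSemidef) (h : (m • (1 : Matrix n n ℝ) - A).PosSemidef) :
    A.det ≤ m ^ Fintype.card n := by
  rw [hA.isHermitian.det_eq_prod_eigenvalues, ← Finset.card_univ, ← Finset.prod_const]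
  exact Finset.prod_le_prod (fun i _ => hA.eigenvalues_nonneg i)
    fun i _ => eigenvalues_le hA.isHermitian h i

lemma det_le_trace_div_pow (hA : A.PosSemidef) :
    A.det ≤ (A.trace / Fintype.card n) ^ Fintype.card n := by
  rw [hA.isHermitian.det_eq_prod_eigenvalues, hA.isHermitian.trace_eq_sum_eigenvalues]
  exact prod_le_sum_div_card_pow hA.eigenvalues_nonneg

end MatrixBounds

section AverageMetric

variable {d : ℕ} {Ω : Set (EuclideanSpace ℝ (Fin d))} {m mbar : ℝ}
  {A B M : EuclideanSpace ℝ (Fin d) → Matrix (Fin d) (Fin d) ℝ}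
  {y : Fin (d + 1) → EuclideanSpace ℝ (Fin d)}

lemma integrableOn_simplex_apply (hA : ContinuousOn A (simplex y)) (a b : Fin d) :
    IntegrableOn (fun z => A z a b) (simplex y) :=
  (continuousOn_pi.1 (continuousOn_pi.1 hA a) b).integrableOn_compact (isCompact_simplex y)

lemma averageMetric_sub (hA : ContinuousOn A (simplex y)) (hB : ContinuousOn B (simplex y)) :
    averageMetric (fun z => A z - B z) y = averageMetric A y - averageMetric B y := by
  ext a b
  simp only [averageMetric, Matrix.of_apply, Matrix.sub_apply, setAverage_eq, smul_eq_mul]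
  rw [integral_sub (integrableOn_simplex_apply hA a b) (integrableOn_simplex_apply hB a b),
    mul_sub]

lemma averageMetric_const (hy : orient y ≠ 0) (C : Matrix (Fin d) (Fin d) ℝ) :
    averageMetric (fun _ => C) y = C := by
  ext a b
  simp only [averageMetric, Matrix.of_apply, setAverage_eq, setIntegral_const, smul_eq_mul]
  exact inv_mul_cancel_left₀ (vol_pos hy).ne' _

lemma dotProduct_averageMetric_mulVec (hA : ContinuousOn A (simplex y)) (v : Fin d → ℝ) :
    v ⬝ᵥ (averageMetric A y).mulVec v = ⨍ z in simplex y, v ⬝ᵥ (A z).mulVec v := by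
  simp only [dotProduct, Matrix.mulVec, averageMetric, Matrix.of_apply, setAverage_eq, smul_eq_mul]
  have hint (a b : Fin d) := (integrableOn_simplex_apply hA a b).mul_const (v b)
  rw [integral_finsetSum _ fun a _ => (integrable_finsetSum _ fun b _ => hint a b).const_mul (v a),
    Finset.mul_sum]
  refine Finset.sum_congr rfl fun a _ => ?_
  rw [integral_const_mul, integral_finsetSum _ fun b _ => hint a b, mul_left_comm, Finset.mul_sum]
  simp only [integral_mul_const, mul_assoc, Finset.mul_sum]

lemma posSemidef_averageMetric (hA : ContinuousOn A (simplex y))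
    (h : ∀ z ∈ simplex y, (A z).PosSemidef) : (averageMetric A y).PosSemidef := by
  have hmeas : MeasurableSet (simplex y) := (isCompact_simplex y).isClosed.measurableSet
  refine .of_dotProduct_mulVec_nonneg ?_ fun v => ?_
  · ext a b
    simp only [averageMetric, Matrix.conjTranspose_apply, Matrix.of_apply, star_trivial,
      setAverage_eq]
    rw [setIntegral_congr_fun hmeas fun z hz => ((h z hz).isHermitian.apply a b).symm]
    simp
  · rw [star_trivial, dotProduct_averageMetric_mulVec hA, setAverage_eq]
    exact smul_nonneg (by positivity)
      (setIntegral_nonneg hmeas fun z hz => (h z hz).dotProduct_mulVec_nonneg v)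

lemma posSemidef_of_mem_closure (hA : ContinuousOn A (closure Ω)) (h : ∀ z ∈ Ω, (A z).PosSemidef)
    {z : EuclideanSpace ℝ (Fin d)} (hz : z ∈ closure Ω) : (A z).PosSemidef := by
  have hmaps : Set.MapsTo A Ω {C | C.PosSemidef} := h
  have hclosure := hmaps.closure_of_continuousOn hA hz
  rwa [isClosed_setOf_posSemidef.closure_eq] at hclosure

lemma IsMetricTensor.continuousOn (hM : IsMetricTensor Ω m mbar M) : ContinuousOn M (closure Ω) :=
  continuousOn_pi.2 fun a => continuousOn_pi.2 fun b z hz =>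
    (hM.smooth z hz a b).continuousAt.continuousWithinAt

lemma averageMetric_lower (hM : IsMetricTensor Ω m mbar M) (hy : orient y ≠ 0)
    (hsub : simplex y ⊆ closure Ω) :
    (averageMetric M y - m • (1 : Matrix (Fin d) (Fin d) ℝ)).PosSemidef := by
  have hc := hM.continuousOn.sub (g := fun _ => m • 1) continuousOn_const
  rw [← averageMetric_const hy (m • 1),
    ← averageMetric_sub (hM.continuousOn.mono hsub) continuousOn_const]
  exact posSemidef_averageMetric (hc.mono hsub) fun z hz =>
    posSemidef_of_mem_closure hc hM.lower (hsub hz)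

lemma averageMetric_upper (hM : IsMetricTensor Ω m mbar M) (hy : orient y ≠ 0)
    (hsub : simplex y ⊆ closure Ω) :
    (mbar • (1 : Matrix (Fin d) (Fin d) ℝ) - averageMetric M y).PosSemidef := by
  have hc := (continuousOn_const (c := mbar • (1 : Matrix (Fin d) (Fin d) ℝ))).sub hM.continuousOn
  rw [← averageMetric_const hy (mbar • 1),
    ← averageMetric_sub continuousOn_const (hM.continuousOn.mono hsub)]
  exact posSemidef_averageMetric (hc.mono hsub) fun z hz =>
    posSemidef_of_mem_closure hc hM.upper (hsub hz)

lemma pow_le_det_averageMetric (hM : IsMetricTensor Ω m mbar M) (hm : 0 ≤ m) (hy : orient y ≠ 0)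
    (hsub : simplex y ⊆ closure Ω) : m ^ d ≤ (averageMetric M y).det := by
  simpa using pow_le_det hm (averageMetric_lower hM hy hsub)

lemma posDef_averageMetric (hM : IsMetricTensor Ω m mbar M) (hm : 0 < m) (hy : orient y ≠ 0)
    (hsub : simplex y ⊆ closure Ω) : (averageMetric M y).PosDef :=
  posDef_of_sub_smul_posSemidef hm (averageMetric_lower hM hy hsub)

lemma det_averageMetric_le_pow (hM : IsMetricTensor Ω m mbar M) (hm : 0 < m) (hy : orient y ≠ 0)
    (hsub : simplex y ⊆ closure Ω) : (averageMetric M y).det ≤ mbar ^ d := by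
  simpa using det_le_pow (posDef_averageMetric hM hm hy hsub).posSemidef
    (averageMetric_upper hM hy hsub)

end AverageMetric

/-! ### Coercivity -/

section ReferenceElement

variable {d : ℕ} {ξ : Fin (d + 1) → EuclideanSpace ℝ (Fin d)}

lemma transpose_edgeMatrix_mul_edgeMatrix_apply (y : Fin (d + 1) → EuclideanSpace ℝ (Fin d))
    (j k : Fin d) :
    ((edgeMatrix y).transpose * edgeMatrix y) j k = inner ℝ (y j.succ - y 0) (y k.succ - y 0) := by
  simp [Matrix.mul_apply, edgeMatrix, PiLp.inner_apply, mul_comm]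

lemma gram_edgeMatrix_of_equilateral {ℓ : ℝ} (hℓ : ∀ i j, i ≠ j → dist (ξ i) (ξ j) = ℓ) :
    (edgeMatrix ξ).transpose * edgeMatrix ξ =
      (ℓ ^ 2 / 2) • (1 + Matrix.of fun _ _ => (1 : ℝ)) := by
  ext j k
  rw [transpose_edgeMatrix_mul_edgeMatrix_apply,
    real_inner_eq_norm_mul_self_add_norm_mul_self_sub_norm_sub_mul_self_div_two,
    sub_sub_sub_cancel_right, ← dist_eq_norm, ← dist_eq_norm, ← dist_eq_norm,
    hℓ _ _ (Fin.succ_ne_zero j), hℓ _ _ (Fin.succ_ne_zero k)]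
  rcases eq_or_ne j k with rfl | hjk
  · simp only [dist_self, Matrix.smul_apply, Matrix.add_apply, Matrix.one_apply_eq,
      Matrix.of_apply, smul_eq_mul]
    ring
  · rw [hℓ _ _ fun h => hjk (Fin.succ_injective _ h)]
    simp only [Matrix.smul_apply, Matrix.add_apply, Matrix.one_apply_ne hjk, Matrix.of_apply,
      smul_eq_mul]
    ring

lemma det_one_add_ones (d : ℕ) :
    (1 + Matrix.of fun _ _ => (1 : ℝ) : Matrix (Fin d) (Fin d) ℝ).det = d + 1 := by
  have h := Matrix.det_one_add_replicateCol_mul_replicateRow (ι := Unit) (1 : Fin d → ℝ) 1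
  rw [← Matrix.vecMulVec_eq, one_dotProduct_one, Fintype.card_fin, add_comm (1 : ℝ)] at h
  simpa only [Matrix.vecMulVec, Pi.one_apply, mul_one] using h

lemma IsReferenceElement.exists_gram (hξ : IsReferenceElement ξ) :
    ∃ r : ℝ, 0 < r ∧ r ^ d * (d + 1) = (d ! : ℝ) ^ 2 ∧ orient ξ ≠ 0 ∧
      (edgeMatrix ξ).transpose * edgeMatrix ξ = r • (1 + Matrix.of fun _ _ => (1 : ℝ)) := by
  obtain ⟨⟨ℓ, hℓ₀, hℓ⟩, hvol⟩ := hξ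
  have hgram := gram_edgeMatrix_of_equilateral hℓ
  have hdet := congrArg Matrix.det hgram
  rw [Matrix.det_mul, Matrix.det_transpose, Matrix.det_smul, det_one_add_ones, Fintype.card_fin,
    ← orient_eq_det_edgeMatrix] at hdet
  have hne : orient ξ ≠ 0 := by
    have : 0 < orient ξ * orient ξ := hdet ▸ by positivity
    exact (mul_self_pos.1 this)
  refine ⟨ℓ ^ 2 / 2, by positivity, ?_, hne, hgram⟩
  rw [vol_eq hne, div_eq_one_iff_eq (by positivity)] at hvol
  rw [← hdet, ← hvol, sq_abs, pow_two]

end ReferenceElement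

section ElementEstimates

variable {d : ℕ} {ξ y : Fin (d + 1) → EuclideanSpace ℝ (Fin d)}

lemma bary_eq_stdBary (hy : orient y ≠ 0) (q : EuclideanSpace ℝ (Fin d)) (i : Fin (d + 1)) :
    bary y i q = stdBary (WithLp.toLp 2 ((edgeMatrix y)⁻¹.mulVec (q - y 0).ofLp)) i := by
  have hdet : IsUnit (edgeMatrix y).det := by
    rw [← orient_eq_det_edgeMatrix]
    exact isUnit_iff_ne_zero.2 hy
  set c : EuclideanSpace ℝ (Fin d) :=
    WithLp.toLp 2 ((edgeMatrix y)⁻¹.mulVec (q - y 0).ofLp) with hc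
  have hq : ∑ k, stdBary c k • y k = q := by
    rw [← elementMap_apply, elementMap_eq, hc, Matrix.toEuclideanCLM_toLp, Matrix.mulVec_mulVec,
      Matrix.mul_nonsing_inv _ hdet, Matrix.one_mulVec, WithLp.toLp_ofLp, add_sub_cancel]
  rw [← bary_sum_smul_vertex hy (sum_stdBary c) i, hq]

/-- The gradients of the barycentric coordinates of an element with inverse edge matrix `U`: the
rows of `U`, preceded by minus their sum. -/
def baryGradient (U : Matrix (Fin d) (Fin d) ℝ) : Fin (d + 1) → Fin d → ℝ :=
  Fin.cons (-∑ j, U j) U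

lemma baryGradient_zero (U : Matrix (Fin d) (Fin d) ℝ) : baryGradient U 0 = -∑ j, U j := rfl

lemma baryGradient_succ (U : Matrix (Fin d) (Fin d) ℝ) (j : Fin d) :
    baryGradient U j.succ = U j := rfl

lemma sum_baryGradient (U : Matrix (Fin d) (Fin d) ℝ) : ∑ k, baryGradient U k = 0 := by
  simp only [Fin.sum_univ_succ, baryGradient_zero, baryGradient_succ, neg_add_cancel]

lemma baryGradient_dotProduct (U : Matrix (Fin d) (Fin d) ℝ) (v w : Fin d → ℝ)
    (i : Fin (d + 1)) : baryGradient U i ⬝ᵥ (v - w) =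
      stdBary (WithLp.toLp 2 (U.mulVec v)) i - stdBary (WithLp.toLp 2 (U.mulVec w)) i := by
  rw [dotProduct_sub]
  refine Fin.cases ?_ (fun j => rfl) i
  have hmulVec (u : Fin d → ℝ) : ∑ j, U.mulVec u j = (∑ j, U j) ⬝ᵥ u :=
    (sum_dotProduct Finset.univ U u).symm
  simp only [baryGradient_zero, stdBary, Fin.cons_zero, neg_dotProduct, hmulVec]
  ring

lemma baryGradient_dotProduct_mulVec (hy : orient y ≠ 0) {Q : Matrix (Fin d) (Fin d) ℝ}
    (hQ : IsUnit Q.det) (q q' : EuclideanSpace ℝ (Fin d)) (i : Fin (d + 1)) :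
    baryGradient (Q * edgeMatrix y)⁻¹ i ⬝ᵥ Q.mulVec (q - q').ofLp = bary y i q - bary y i q' := by
  have hinv (v : Fin d → ℝ) :
      (Q * edgeMatrix y)⁻¹.mulVec (Q.mulVec v) = (edgeMatrix y)⁻¹.mulVec v := by
    rw [Matrix.mul_inv_rev, Matrix.mulVec_mulVec, Matrix.mul_assoc, Matrix.nonsing_inv_mul _ hQ,
      Matrix.mul_one]
  rw [bary_eq_stdBary hy, bary_eq_stdBary hy, ← hinv, ← hinv, ← baryGradient_dotProduct,
    ← Matrix.mulVec_sub, ← WithLp.ofLp_sub 2 (q - y 0), sub_sub_sub_cancel_right]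

lemma card_mul_sq_le_of_sum_eq_zero {ι : Type*} [Fintype ι] {f : ι → ℝ} (hf : ∑ k, f k = 0)
    (i : ι) : Fintype.card ι * f i ^ 2 ≤ (Fintype.card ι - 1) * ∑ k, f k ^ 2 := by
  classical
  have hsq := sq_sum_le_card_mul_sum_sq (s := Finset.univ.erase i) (f := f)
  rw [Finset.card_erase_of_mem (Finset.mem_univ i), Finset.card_univ,
    Nat.cast_pred (Fintype.card_pos_iff.2 ⟨i⟩)] at hsq
  rw [← Finset.add_sum_erase _ _ (Finset.mem_univ i)] at hf ⊢
  rw [eq_neg_of_add_eq_zero_right hf, neg_sq] at hsq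
  linarith

lemma baryGradient_sq_le (U : Matrix (Fin d) (Fin d) ℝ) (i : Fin (d + 1)) :
    ((d : ℝ) + 1) * ∑ a, baryGradient U i a ^ 2 ≤ d * ∑ k, ∑ a, baryGradient U k a ^ 2 := by
  rw [Finset.sum_comm, Finset.mul_sum, Finset.mul_sum]
  refine Finset.sum_le_sum fun a _ => ?_
  have hsum : ∑ k, baryGradient U k a = 0 := by
    rw [← Finset.sum_apply, sum_baryGradient, Pi.zero_apply]
  simpa using card_mul_sq_le_of_sum_eq_zero hsum i

/-- The matrix `(F')⁻¹ A⁻¹ (F')⁻ᵀ` of an element in the constant metric `A`. -/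
def elementMatrix (ξ y : Fin (d + 1) → EuclideanSpace ℝ (Fin d)) (A : Matrix (Fin d) (Fin d) ℝ) :
    Matrix (Fin d) (Fin d) ℝ :=
  (jacobian ξ y)⁻¹ * A⁻¹ * ((jacobian ξ y)⁻¹).transpose

lemma elementMatrix_eq (hξ : orient ξ ≠ 0) (Q : Matrix (Fin d) (Fin d) ℝ) :
    elementMatrix ξ y (Q.transpose * Q) =
      (edgeMatrix ξ * (Q * edgeMatrix y)⁻¹) * (edgeMatrix ξ * (Q * edgeMatrix y)⁻¹).transpose := by
  have hdet : IsUnit (edgeMatrix ξ).det := by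
    rw [← orient_eq_det_edgeMatrix]
    exact isUnit_iff_ne_zero.2 hξ
  rw [elementMatrix, jacobian, Matrix.mul_inv_rev, Matrix.nonsing_inv_nonsing_inv _ hdet,
    Matrix.mul_inv_rev, Matrix.mul_inv_rev, ← Matrix.transpose_nonsing_inv]
  simp only [Matrix.transpose_mul, Matrix.mul_assoc]

lemma trace_elementMatrix (hξ : orient ξ ≠ 0) {r : ℝ}
    (hr : (edgeMatrix ξ).transpose * edgeMatrix ξ = r • (1 + Matrix.of fun _ _ => (1 : ℝ)))
    (Q : Matrix (Fin d) (Fin d) ℝ) :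
    (elementMatrix ξ y (Q.transpose * Q)).trace =
      r * ∑ k, ∑ a, baryGradient (Q * edgeMatrix y)⁻¹ k a ^ 2 := by
  set U := (Q * edgeMatrix y)⁻¹ with hU
  rw [elementMatrix_eq hξ, Matrix.trace_mul_comm, Matrix.transpose_mul, Matrix.mul_assoc,
    ← Matrix.mul_assoc (edgeMatrix ξ).transpose, hr, Matrix.smul_mul, Matrix.mul_smul,
    Matrix.trace_smul, smul_eq_mul, ← hU, Fin.sum_univ_succ, Matrix.add_mul, Matrix.one_mul,
    Matrix.mul_add, Matrix.trace_add, add_comm (Matrix.trace _)]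
  simp only [Matrix.trace, Matrix.diag_apply, Matrix.mul_apply, Matrix.transpose_apply,
    Matrix.of_apply, one_mul, baryGradient_zero, baryGradient_succ, Pi.neg_apply,
    neg_sq, ← pow_two, ← Finset.sum_mul]
  rw [Finset.sum_comm (f := fun a j => U j a ^ 2)]
  congr! with a
  exact (Finset.sum_apply a Finset.univ U).symm

lemma posSemidef_elementMatrix (ξ y : Fin (d + 1) → EuclideanSpace ℝ (Fin d))
    {A : Matrix (Fin d) (Fin d) ℝ} (hA : A.PosSemidef) : (elementMatrix ξ y A).PosSemidef := by
  rw [elementMatrix, ← Matrix.conjTranspose_eq_transpose_of_trivial]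
  exact hA.inv.mul_mul_conjTranspose_same _

lemma trace_elementMatrix_pos (hd : 1 ≤ d) (hξ : orient ξ ≠ 0) (hy : orient y ≠ 0)
    {A : Matrix (Fin d) (Fin d) ℝ} (hA : A.PosDef) : 0 < (elementMatrix ξ y A).trace := by
  have : Nonempty (Fin d) := ⟨⟨0, hd⟩⟩
  rw [orient_eq_det_edgeMatrix] at hξ hy
  have hdet : IsUnit (jacobian ξ y)⁻¹ := by
    rw [Matrix.isUnit_iff_isUnit_det]
    simp [jacobian, Matrix.det_nonsing_inv, hξ, hy]
  rw [elementMatrix, ← Matrix.conjTranspose_eq_transpose_of_trivial]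
  exact (hA.inv.mul_mul_conjTranspose_same
    (Matrix.vecMul_injective_iff_isUnit.2 hdet)).trace_pos

lemma det_elementMatrix (hξ : orient ξ ≠ 0) (hvol : vol ξ = 1) (hy : orient y ≠ 0)
    {A : Matrix (Fin d) (Fin d) ℝ} (hA : A.det ≠ 0) :
    (elementMatrix ξ y A).det * (vol y ^ 2 * A.det) = 1 := by
  have hdetξ : (edgeMatrix ξ).det ^ 2 = (d ! : ℝ) ^ 2 := by
    rw [vol_eq hξ, div_eq_one_iff_eq (by positivity)] at hvol
    rw [← hvol, sq_abs, orient_eq_det_edgeMatrix]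
  have hfact : (d ! : ℝ) ≠ 0 := by positivity
  rw [vol_eq hy, div_pow, sq_abs, elementMatrix, jacobian]
  rw [orient_eq_det_edgeMatrix] at hξ hy ⊢
  simp only [Matrix.det_mul, Matrix.det_transpose, Matrix.det_nonsing_inv, Ring.inverse_eq_inv']
  field_simp
  rw [hdetξ]

lemma one_le_vol_sq_mul (hξ : orient ξ ≠ 0) (hvol : vol ξ = 1) (hy : orient y ≠ 0)
    {A : Matrix (Fin d) (Fin d) ℝ} (hA : A.PosDef) :
    1 ≤ vol y ^ 2 * A.det * ((elementMatrix ξ y A).trace / d) ^ d := by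
  have hdet := det_le_trace_div_pow (posSemidef_elementMatrix ξ y hA.posSemidef)
  rw [Fintype.card_fin] at hdet
  rw [← det_elementMatrix hξ hvol hy hA.det_pos.ne', mul_comm]
  exact mul_le_mul_of_nonneg_left hdet (mul_nonneg (sq_nonneg _) hA.det_pos.le)

lemma metricDist_eq (Q : Matrix (Fin d) (Fin d) ℝ) (q q' : EuclideanSpace ℝ (Fin d)) :
    metricDist (Q.transpose * Q) q q' = √(∑ a, Q.mulVec (q - q').ofLp a ^ 2) := by
  have hform : ∑ a, Q.mulVec (q - q').ofLp a ^ 2 =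
      (q - q').ofLp ⬝ᵥ (Q.transpose * Q).mulVec (q - q').ofLp := by
    rw [← Matrix.mulVec_mulVec, Matrix.dotProduct_mulVec, Matrix.vecMul_transpose, dotProduct]
    simp only [pow_two]
  rw [metricDist, hform]
  simp only [dotProduct, Matrix.mulVec, Finset.mul_sum, mul_assoc, PiLp.sub_apply]

/-- Cauchy–Schwarz for the difference of barycentric coordinates `1` at `y i` and `0` at `z`. -/
lemma one_le_baryGradient_sq_mul (hy : orient y ≠ 0) {Q : Matrix (Fin d) (Fin d) ℝ}
    (hQ : IsUnit Q.det) {i : Fin (d + 1)} {z : EuclideanSpace ℝ (Fin d)}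
    (hz : z ∈ affineSpan ℝ (y '' {i}ᶜ)) :
    1 ≤ (∑ a, baryGradient (Q * edgeMatrix y)⁻¹ i a ^ 2) *
      ∑ a, Q.mulVec (y i - z).ofLp a ^ 2 := by
  have hdiff : baryGradient (Q * edgeMatrix y)⁻¹ i ⬝ᵥ Q.mulVec (y i - z).ofLp = 1 := by
    rw [baryGradient_dotProduct_mulVec hy hQ, bary_vertex_self hy, bary,
      orient_update_eq_zero_of_mem_affineSpan hz, zero_div, sub_zero]
  have hCS := Finset.sum_mul_sq_le_sq_mul_sq Finset.univ
    (baryGradient (Q * edgeMatrix y)⁻¹ i) (Q.mulVec (y i - z).ofLp)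
  rwa [← dotProduct, hdiff, one_pow] at hCS

lemma le_minAltitude (hd : 1 ≤ d) (hξ : orient ξ ≠ 0) {r : ℝ} (hr₀ : 0 < r)
    (hr : (edgeMatrix ξ).transpose * edgeMatrix ξ = r • (1 + Matrix.of fun _ _ => (1 : ℝ)))
    (hy : orient y ≠ 0) {A : Matrix (Fin d) (Fin d) ℝ} (hA : A.PosDef) :
    √(r * (d + 1) / d / (elementMatrix ξ y A).trace) ≤ minAltitude A y := by
  have htrace := trace_elementMatrix_pos hd hξ hy hA
  obtain ⟨Q, rfl⟩ := exists_eq_transpose_mul_self hA.posSemidef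
  have hQ : IsUnit Q.det := by
    have := hA.det_pos
    rw [Matrix.det_mul, Matrix.det_transpose] at this
    exact isUnit_iff_ne_zero.2 (mul_self_pos.1 this)
  have : Nontrivial (Fin (d + 1)) := Fin.nontrivial_iff_two_le.2 (by omega)
  refine le_ciInf fun i => le_csInf ?_ ?_
  · obtain ⟨k, hk⟩ := exists_ne i
    exact ⟨_, y k, subset_affineSpan ℝ _ ⟨k, hk, rfl⟩, rfl⟩
  rintro _ ⟨z, hz, rfl⟩
  dsimp only
  rw [metricDist_eq]
  refine Real.sqrt_le_sqrt ?_
  rw [div_div, div_le_iff₀ (by positivity), trace_elementMatrix hξ hr]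
  set w := ∑ a, Q.mulVec (y i - z).ofLp a ^ 2
  set g := ∑ a, baryGradient (Q * edgeMatrix y)⁻¹ i a ^ 2
  set T := ∑ k, ∑ a, baryGradient (Q * edgeMatrix y)⁻¹ k a ^ 2
  calc r * ((d : ℝ) + 1) ≤ r * ((d + 1) * (g * w)) := by
        have := one_le_baryGradient_sq_mul hy hQ hz
        gcongr
        exact le_mul_of_one_le_right (by positivity) this
    _ = r * ((d + 1) * g * w) := by ring
    _ ≤ r * (d * T * w) := by
        gcongr ?_ * (?_ * _)
        exact baryGradient_sq_le _ i
    _ = w * (d * (r * T)) := by ring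

end ElementEstimates

section Coercivity

variable {d : ℕ}

lemma trace_le_sqrt_mul_frobenius (A : Matrix (Fin d) (Fin d) ℝ) :
    A.trace ≤ √d * frobenius A := by
  rw [frobenius, ← Real.sqrt_mul (Nat.cast_nonneg d)]
  refine Real.le_sqrt_of_sq_le ?_
  have hCS := sq_sum_le_card_mul_sum_sq (s := Finset.univ) (f := fun a => A a a)
  rw [Finset.card_univ, Fintype.card_fin] at hCS
  refine hCS.trans ?_
  gcongr with a
  exact Finset.single_le_sum (f := fun b => A a b ^ 2) (fun b _ => sq_nonneg _)
    (Finset.mem_univ a)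

lemma frobenius_nonneg (A : Matrix (Fin d) (Fin d) ℝ) : 0 ≤ frobenius A := Real.sqrt_nonneg _

lemma sqrt_rpow_two_mul {t : ℝ} (ht : 0 ≤ t) (p : ℝ) : √t ^ (2 * p) = t ^ p := by
  rw [Real.rpow_mul (Real.sqrt_nonneg t), Real.rpow_two, Real.sq_sqrt ht]

lemma add_rpow_le_two_rpow_mul {a b q : ℝ} (ha : 0 ≤ a) (hb : 0 ≤ b) (hq : 1 ≤ q) :
    (a + b) ^ q ≤ 2 ^ (q - 1) * (a ^ q + b ^ q) := by
  exact_mod_cast NNReal.rpow_add_le_mul_rpow_add_rpow ⟨a, ha⟩ ⟨b, hb⟩ hq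

lemma trace_rpow_sub_le_frobenius_rpow (hd : 1 ≤ d) {p : ℝ} (hp : 1 ≤ 2 * p)
    {S : Matrix (Fin d) (Fin d) ℝ} (hS : 0 ≤ S.trace) {γ : ℝ} (hγ : 0 ≤ γ) :
    2 ^ (1 - 2 * p) / (d : ℝ) ^ p * S.trace ^ (2 * p) - (γ ^ 2 * d) ^ p ≤
      frobenius (S - γ • (1 : Matrix (Fin d) (Fin d) ℝ)) ^ (2 * p) := by
  have hd₀ : (0 : ℝ) < d := by exact_mod_cast hd
  set X := frobenius (S - γ • (1 : Matrix (Fin d) (Fin d) ℝ)) with hX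
  have htrace : S.trace / √d ≤ X + √(γ ^ 2 * d) := by
    have h := trace_le_sqrt_mul_frobenius (S - γ • (1 : Matrix (Fin d) (Fin d) ℝ))
    rw [Matrix.trace_sub, Matrix.trace_smul, Matrix.trace_one, Fintype.card_fin, smul_eq_mul,
      ← hX] at h
    rw [div_le_iff₀ (by positivity), Real.sqrt_mul (sq_nonneg γ), Real.sqrt_sq hγ, add_mul,
      mul_assoc, Real.mul_self_sqrt hd₀.le]
    linarith
  have hpow : S.trace ^ (2 * p) / (d : ℝ) ^ p ≤
      2 ^ (2 * p - 1) * (X ^ (2 * p) + (γ ^ 2 * d) ^ p) := by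
    rw [← sqrt_rpow_two_mul hd₀.le, ← Real.div_rpow hS (Real.sqrt_nonneg _),
      ← sqrt_rpow_two_mul (by positivity : 0 ≤ γ ^ 2 * d) p]
    exact (Real.rpow_le_rpow (by positivity) htrace (by linarith)).trans
      (add_rpow_le_two_rpow_mul (frobenius_nonneg _) (Real.sqrt_nonneg _) hp)
  rw [← neg_sub (2 * p), Real.rpow_neg zero_le_two, tsub_le_iff_right]
  calc ((2 : ℝ) ^ (2 * p - 1))⁻¹ / (d : ℝ) ^ p * S.trace ^ (2 * p)
      = ((2 : ℝ) ^ (2 * p - 1))⁻¹ * (S.trace ^ (2 * p) / (d : ℝ) ^ p) := by ring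
    _ ≤ X ^ (2 * p) + (γ ^ 2 * d) ^ p := (inv_mul_le_iff₀ (by positivity)).2 hpow

end Coercivity

section Numerics

lemma sum_fin_add_one (n : ℕ) : ∑ i : Fin n, ((i : ℝ) + 1) = n * ((n + 1) / 2) := by
  induction n with
  | zero => simp
  | succ n ih =>
    simp only [Fin.sum_univ_castSucc, Fin.val_castSucc, Fin.val_last, ih, Nat.cast_add,
      Nat.cast_one]
    ring

lemma factorial_le_half_pow (n : ℕ) : (n ! : ℝ) ≤ (((n : ℝ) + 1) / 2) ^ n := by
  rcases n.eq_zero_or_pos with rfl | hn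
  · simp
  have hprod : ∏ i : Fin n, ((i : ℝ) + 1) = n ! := by
    rw [Fin.prod_univ_eq_prod_range (fun i => (i : ℝ) + 1),
      ← Finset.prod_range_add_one_eq_factorial]
    push_cast
    rfl
  have hAMGM := prod_le_sum_div_card_pow (w := fun i : Fin n => (i : ℝ) + 1) fun i => by positivity
  rwa [hprod, sum_fin_add_one, Fintype.card_fin, mul_div_cancel_left₀ _ (by positivity)] at hAMGM

variable {d N : ℕ} {p r : ℝ}

lemma reference_altitude_pow_eq (hd : 1 ≤ d) (hr : r ^ d * (d + 1) = (d ! : ℝ) ^ 2) :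
    (r * (d + 1) / d) ^ d * d ^ d = (d ! : ℝ) ^ 2 * ((d : ℝ) + 1) ^ (d - 1) := by
  have hd₀ : (0 : ℝ) < d := by exact_mod_cast hd
  rw [← mul_pow, div_mul_cancel₀ _ hd₀.ne', ← hr, mul_assoc, ← pow_succ',
    Nat.sub_add_cancel hd, mul_pow]

lemma reference_altitude_pow_le (hd : 1 ≤ d) (hr : r ^ d * (d + 1) = (d ! : ℝ) ^ 2) :
    (r * (d + 1) / d) ^ d ≤ (d ! : ℝ) ^ 2 * d ^ d := by
  have hd₀ : (0 : ℝ) < d := by exact_mod_cast hd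
  have hpow : (d + 1) ^ (d - 1) ≤ d ^ d * d ^ d := by
    rcases hd.eq_or_lt with rfl | h
    · simp
    · calc (d + 1) ^ (d - 1) ≤ (d * d) ^ (d - 1) := by
            gcongr
            nlinarith
        _ ≤ (d * d) ^ d := Nat.pow_le_pow_right (by positivity) (Nat.sub_le d 1)
        _ = d ^ d * d ^ d := mul_pow d d d
  refine le_of_mul_le_mul_right ?_ (pow_pos hd₀ d)
  rw [reference_altitude_pow_eq hd hr, mul_assoc]
  gcongr
  exact_mod_cast hpow

lemma log_reference_altitude (hd : 1 ≤ d) (hr₀ : 0 < r)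
    (hr : r ^ d * (d + 1) = (d ! : ℝ) ^ 2) :
    d * Real.log (r * (d + 1) / d) =
      2 * Real.log (d !) + (d - 1) * Real.log (d + 1) - d * Real.log d := by
  have _hd₀ : (0 : ℝ) < d := by exact_mod_cast hd
  have h := congrArg Real.log (reference_altitude_pow_eq hd hr)
  rw [Real.log_mul (by positivity) (by positivity), Real.log_mul (by positivity) (by positivity)]
    at h
  simp only [Real.log_pow, Nat.cast_sub hd, Nat.cast_ofNat, Nat.cast_one] at h
  linarith

lemma log_mesh_size_bound (hd : 1 ≤ d) (hdN : 2 ≤ d ∨ 2 ≤ N) (hpd : (d : ℝ) < 4 * p) :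
    Real.log (d !) + 6 * p * Real.log 2 ≤ 2 * p * Real.log d +
      (6 * p - 4 * p / d) * Real.log (d + 1) + 4 * p / d * Real.log N := by
  have hd₁ : (1 : ℝ) ≤ d := by exact_mod_cast hd
  have hp : 0 < p := by linarith
  by_cases h : 2 ≤ d
  · have hd₂ : (2 : ℝ) ≤ d := by exact_mod_cast h
    have hlog : Real.log 2 ≤ Real.log (d + 1) := Real.log_le_log two_pos (by linarith)
    have hfac : Real.log (d !) ≤ d * (Real.log (d + 1) - Real.log 2) := by
      have := Real.log_le_log (by positivity) (factorial_le_half_pow d)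
      rwa [Real.log_pow, Real.log_div (by positivity) two_ne_zero] at this
    have hdp : (d : ℝ) * (Real.log (d + 1) - Real.log 2) ≤
        4 * p * (Real.log (d + 1) - Real.log 2) :=
      mul_le_mul_of_nonneg_right hpd.le (by linarith)
    have hcoeff : 4 * p * Real.log (d + 1) ≤ (6 * p - 4 * p / d) * Real.log (d + 1) := by
      refine mul_le_mul_of_nonneg_right ?_ (Real.log_nonneg (by linarith))
      have : 4 * p / d ≤ 2 * p := by
        rw [div_le_iff₀ (by linarith)]
        nlinarith
      linarith
    have hNlog : 0 ≤ 4 * p / d * Real.log N :=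
      mul_nonneg (by positivity) (Real.log_natCast_nonneg N)
    have hd2 : 2 * p * Real.log 2 ≤ 2 * p * Real.log d := by gcongr
    linarith
  · obtain rfl : d = 1 := by omega
    have hN₂ : 2 ≤ N := by omega
    have hlog : 4 * p * Real.log 2 ≤ 4 * p * Real.log N := by
      gcongr
      exact_mod_cast hN₂
    norm_num
    linarith

lemma log_altitude_constant_le (hd : 1 ≤ d) (hdN : 2 ≤ d ∨ 2 ≤ N) (hpd : (d : ℝ) < 4 * p)
    (hr₀ : 0 < r) (hr : r ^ d * (d + 1) = (d ! : ℝ) ^ 2) :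
    6 * p * Real.log 2 + 4 * p / d * Real.log (d !) - 4 * p * Real.log d -
        (4 * p - 2 * p / d) * Real.log (d + 1) - 4 * p / d * Real.log N ≤
      (2 * p - d / 2) * Real.log (r * (d + 1) / d) + d / 2 * Real.log d := by
  have hd₀ : (0 : ℝ) < d := by exact_mod_cast hd
  have hsize := log_mesh_size_bound hd hdN hpd
  have hpow := Real.log_le_log (by positivity) (reference_altitude_pow_le hd hr)
  rw [Real.log_mul (by positivity) (by positivity)] at hpow
  simp only [Real.log_pow, Nat.cast_ofNat] at hpow
  have halt : 2 * p * Real.log (r * (d + 1) / d) = 4 * p / d * Real.log (d !) +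
      (2 * p - 2 * p / d) * Real.log (d + 1) - 2 * p * Real.log d := by
    rw [← mul_div_cancel_left₀ (Real.log (r * (d + 1) / d)) hd₀.ne',
      log_reference_altitude hd hr₀ hr]
    field_simp
    ring
  have hsplit : (6 * p - 4 * p / d) * Real.log (d + 1) =
      (4 * p - 2 * p / d) * Real.log (d + 1) + (2 * p - 2 * p / d) * Real.log (d + 1) := by ring
  linarith

variable {mbar α B V s D : ℝ}

lemma log_constC₁ (hd : 1 ≤ d) (hpd : (d : ℝ) < 4 * p) (hα : 0 < α) (hB : 0 < B) :
    (4 * p - d) * Real.log (constC₁ d p α B) =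
      6 * p * Real.log 2 + 4 * p / d * Real.log (d !) + Real.log α -
        (4 * p * Real.log d + (4 * p - 2 * p / d) * Real.log (d + 1) + Real.log B) := by
  have hd₀ : (0 : ℝ) < d := by exact_mod_cast hd
  have hfac : (0 : ℝ) < d ! := by positivity
  rw [constC₁, Real.log_rpow (by positivity), Real.log_div (by positivity) (by positivity),
    Real.log_mul (by positivity) hα.ne', Real.log_mul (by positivity) (by positivity),
    Real.log_mul (by positivity) hB.ne', Real.log_mul (by positivity) (by positivity),
    Real.log_rpow two_pos, Real.log_rpow hfac, Real.log_rpow hd₀, Real.log_rpow (by positivity),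
    ← mul_assoc, mul_one_div_cancel (sub_pos.2 hpd).ne', one_mul]

lemma log_trace_le (hd : 1 ≤ d) (hα : 0 < α) (hV : 0 < V) (hs : 0 < s) (hD : 0 < D)
    (hDle : D ≤ mbar ^ d) (hdet : 1 ≤ V ^ 2 * D * (s / d) ^ d) (hB : α * (V * s ^ (2 * p)) ≤ B) :
    (2 * p - d / 2) * Real.log s ≤
      Real.log B - Real.log α + d / 2 * (Real.log mbar - Real.log d) := by
  have hd₀ : (0 : ℝ) < d := by exact_mod_cast hd
  have hlogdet := Real.log_le_log one_pos hdet
  rw [Real.log_one, Real.log_mul (by positivity) (by positivity),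
    Real.log_mul (by positivity) hD.ne', Real.log_pow, Real.log_pow,
    Real.log_div hs.ne' hd₀.ne', Nat.cast_ofNat] at hlogdet
  have hlogB := Real.log_le_log (by positivity) hB
  rw [Real.log_mul hα.ne' (by positivity), Real.log_mul hV.ne' (by positivity),
    Real.log_rpow hs] at hlogB
  have hlogD := Real.log_le_log hD hDle
  rw [Real.log_pow] at hlogD
  linarith

lemma constC₁_pos (hd : 1 ≤ d) (hα : 0 < α) (hB : 0 < B) : 0 < constC₁ d p α B := by
  have _hd₀ : (0 : ℝ) < d := by exact_mod_cast hd
  unfold constC₁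
  positivity

lemma constC₁_mul_le_sqrt (hd : 1 ≤ d) (hN : 1 ≤ N) (hdN : 2 ≤ d ∨ 2 ≤ N)
    (hpd : (d : ℝ) < 4 * p) (hr₀ : 0 < r) (hr : r ^ d * (d + 1) = (d ! : ℝ) ^ 2)
    (hmbar : 0 < mbar) (hα : 0 < α) (hV : 0 < V) (hs : 0 < s) (hD : 0 < D) (hDle : D ≤ mbar ^ d)
    (hdet : 1 ≤ V ^ 2 * D * (s / d) ^ d) (hB : α * (V * s ^ (2 * p)) ≤ B) :
    constC₁ d p α B * mbar ^ (-(d : ℝ) / (2 * (4 * p - d))) *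
        (N : ℝ) ^ (-(4 * p) / (d * (4 * p - d))) ≤ √(r * (d + 1) / d / s) := by
  have _hd₀ : (0 : ℝ) < d := by exact_mod_cast hd
  have hN₀ : (0 : ℝ) < N := by exact_mod_cast hN
  have hδ : 0 < 4 * p - d := by linarith
  have hB₀ : 0 < B := lt_of_lt_of_le (by positivity) hB
  have hC₁ := constC₁_pos (p := p) hd hα hB₀
  have hlogC₁ := log_constC₁ hd hpd hα hB₀
  have hconst := log_altitude_constant_le hd hdN hpd hr₀ hr
  have htrace := log_trace_le hd hα hV hs hD hDle hdet hB
  rw [← Real.log_le_log_iff (by positivity) (by positivity), Real.log_sqrt (by positivity),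
    Real.log_div (by positivity) hs.ne', Real.log_mul (by positivity) (by positivity),
    Real.log_mul hC₁.ne' (by positivity), Real.log_rpow hmbar, Real.log_rpow hN₀]
  refine le_of_mul_le_mul_left ?_ hδ
  have hexp : (4 * p - d) * (Real.log (constC₁ d p α B) +
      -(d : ℝ) / (2 * (4 * p - d)) * Real.log mbar +
        -(4 * p) / (d * (4 * p - d)) * Real.log N) =
      (4 * p - d) * Real.log (constC₁ d p α B) - d / 2 * Real.log mbar -
        4 * p / d * Real.log N := by
    field_simp
    ring
  rw [hexp, hlogC₁]
  linarith

lemma sqrt_altitude_pow_le (hd : 1 ≤ d) (hr : r ^ d * (d + 1) = (d ! : ℝ) ^ 2)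
    (hr₀ : 0 < r) (hmbar : 0 < mbar) (hV : 0 < V) (hs : 0 < s) (hDle : D ≤ mbar ^ d)
    (hdet : 1 ≤ V ^ 2 * D * (s / d) ^ d) :
    √(r * (d + 1) / d / s) ^ d ≤ d ! * mbar ^ ((d : ℝ) / 2) * V := by
  have hd₀ : (0 : ℝ) < d := by exact_mod_cast hd
  have hmbar_sq : (mbar ^ ((d : ℝ) / 2)) ^ 2 = mbar ^ d := by
    rw [← Real.rpow_mul_natCast hmbar.le, Nat.cast_ofNat, div_mul_cancel₀ _ two_ne_zero,
      Real.rpow_natCast]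
  have hdV : (d : ℝ) ^ d ≤ V ^ 2 * mbar ^ d * s ^ d := by
    rw [div_pow, mul_div_assoc', one_le_div (by positivity)] at hdet
    exact hdet.trans (by gcongr)
  refine (sq_le_sq₀ (by positivity) (by positivity)).1 ?_
  rw [← pow_mul, mul_comm d, pow_mul, Real.sq_sqrt (by positivity), div_pow,
    div_le_iff₀ (by positivity)]
  calc (r * (d + 1) / d) ^ d ≤ (d ! : ℝ) ^ 2 * d ^ d := reference_altitude_pow_le hd hr
    _ ≤ (d ! : ℝ) ^ 2 * (V ^ 2 * mbar ^ d * s ^ d) := by gcongr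
    _ = (d ! * mbar ^ ((d : ℝ) / 2) * V) ^ 2 * s ^ d := by
        rw [mul_pow, mul_pow, hmbar_sq]
        ring

lemma constC₂_mul_eq (hd : 1 ≤ d) (hpd : (d : ℝ) < 4 * p) (hmbar : 0 < mbar) :
    constC₂ d p α B * mbar ^ (-(d : ℝ) ^ 2 / (2 * (4 * p - d)) - (d : ℝ) / 2) *
        (N : ℝ) ^ (-(4 * p) / (4 * p - d)) =
      (constC₁ d p α B * mbar ^ (-(d : ℝ) / (2 * (4 * p - d))) *
        (N : ℝ) ^ (-(4 * p) / (d * (4 * p - d)))) ^ d / (d ! * mbar ^ ((d : ℝ) / 2)) := by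
  have _hd₀ : (0 : ℝ) < d := by exact_mod_cast hd
  have hδ : 0 < 4 * p - d := by linarith
  have hexp_mbar : -(d : ℝ) / (2 * (4 * p - d)) * d = -(d : ℝ) ^ 2 / (2 * (4 * p - d)) := by ring
  have hexp_N : -(4 * p) / (d * (4 * p - d)) * d = -(4 * p) / (4 * p - d) := by field_simp
  rw [constC₂, mul_pow, mul_pow, ← Real.rpow_mul_natCast hmbar.le,
    ← Real.rpow_mul_natCast (Nat.cast_nonneg N), hexp_mbar, hexp_N, Real.rpow_sub hmbar]
  field_simp

lemma constC₂_mul_le (hd : 1 ≤ d) (hN : 1 ≤ N) (hdN : 2 ≤ d ∨ 2 ≤ N)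
    (hpd : (d : ℝ) < 4 * p) (hr₀ : 0 < r) (hr : r ^ d * (d + 1) = (d ! : ℝ) ^ 2)
    (hmbar : 0 < mbar) (hα : 0 < α) (hV : 0 < V) (hs : 0 < s) (hD : 0 < D) (hDle : D ≤ mbar ^ d)
    (hdet : 1 ≤ V ^ 2 * D * (s / d) ^ d) (hB : α * (V * s ^ (2 * p)) ≤ B) :
    constC₂ d p α B * mbar ^ (-(d : ℝ) ^ 2 / (2 * (4 * p - d)) - (d : ℝ) / 2) *
        (N : ℝ) ^ (-(4 * p) / (4 * p - d)) ≤ V := by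
  have hC₁ := constC₁_pos (p := p) hd hα (lt_of_lt_of_le (by positivity) hB)
  rw [constC₂_mul_eq hd hpd hmbar, div_le_iff₀' (by positivity)]
  exact (pow_le_pow_left₀ (by positivity) (constC₁_mul_le_sqrt hd hN hdN hpd hr₀ hr hmbar hα hV hs
    hD hDle hdet hB) d).trans (sqrt_altitude_pow_le hd hr hr₀ hmbar hV hs hDle hdet)

lemma alphaJ_le_alphaM (hd : 1 ≤ d) (hp : 0 ≤ p) {m : ℝ} (hm : 0 ≤ m)
    (hmbar : 0 ≤ mbar) (h : 1 ≤ √(d : ℝ) * mbar) : alphaJ d p m mbar ≤ alphaM d p m := by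
  have hd₀ : (0 : ℝ) < d := by exact_mod_cast hd
  rw [alphaJ, alphaM]
  refine div_le_div_of_nonneg_left (by positivity) (by positivity) ?_
  calc (d : ℝ) ^ p ≤ (√(d : ℝ) * mbar) ^ (2 * p) * d ^ p :=
        le_mul_of_one_le_left (by positivity) (Real.one_le_rpow h (by positivity))
    _ = mbar ^ (2 * p) * (d : ℝ) ^ (2 * p) := by
        rw [Real.mul_rpow (by positivity) hmbar, sqrt_rpow_two_mul hd₀.le, two_mul p,
          Real.rpow_add hd₀]
        ring

end Numerics

/-! ### Meshes of bounded energy -/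

section MeshBounds

variable {d N Nv : ℕ} {Ω : Set (EuclideanSpace ℝ (Fin d))} {conn : Fin N → Fin (d + 1) → Fin Nv}
  {x : Fin Nv → EuclideanSpace ℝ (Fin d)} {m mbar p : ℝ}
  {M : EuclideanSpace ℝ (Fin d) → Matrix (Fin d) (Fin d) ℝ}
  {ξ : Fin (d + 1) → EuclideanSpace ℝ (Fin d)} {σ : (Fin Nv → EuclideanSpace ℝ (Fin d)) → ℝ}

lemma IsPolyhedralDomain.volume_frontier (hΩ : IsPolyhedralDomain Ω) :
    volume (frontier Ω) = 0 := by
  obtain ⟨H, hH, hsub⟩ := hΩ.frontier_subset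
  refine measure_mono_null hsub ((measure_biUnion_null_iff H.countable_toSet).2 fun h hh => ?_)
  refine Measure.addHaar_affineSubspace _ h fun htop => ?_
  have hdim := hH h hh
  rw [htop, AffineSubspace.direction_top, finrank_top, finrank_euclideanSpace_fin] at hdim
  omega

lemma IsPolyhedralDomain.volume_closure (hΩ : IsPolyhedralDomain Ω) :
    volume.real (closure Ω) = volume.real Ω :=
  congrArg ENNReal.toReal (measure_closure_of_null_frontier hΩ.volume_frontier)

namespace IsNonsingularMesh

lemma isCompact_closure (hx : IsNonsingularMesh Ω conn x) : IsCompact (closure Ω) :=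
  hx.covers ▸ isCompact_iUnion fun _ => isCompact_simplex _

lemma volume_closure_pos (hx : IsNonsingularMesh Ω conn x) (hΩ : IsOpen Ω) (hne : Ω.Nonempty) :
    0 < volume.real (closure Ω) :=
  ENNReal.toReal_pos ((hΩ.measure_pos _ hne).trans_le (measure_mono subset_closure)).ne'
    hx.isCompact_closure.measure_lt_top.ne

lemma card_pos (hx : IsNonsingularMesh Ω conn x) (hne : Ω.Nonempty) : 1 ≤ N := by
  obtain ⟨q, hq⟩ := hne
  obtain ⟨K, -⟩ := hx.exists_mem_simplex (subset_closure hq)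
  exact K.pos

lemma sum_vol (hx : IsNonsingularMesh Ω conn x) :
    ∑ K, vol (elementVertices conn x K) = volume.real (closure Ω) := by
  have hmeas : ∀ K, MeasurableSet (simplex (elementVertices conn x K)) := fun K =>
    (isCompact_simplex _).isClosed.measurableSet
  have h := integral_congr_ae hx.ae_coveringNumber
  simp only [coveringNumber] at h
  rw [integral_indicator_one isClosed_closure.measurableSet, integral_finsetSum] at h
  · rw [← h]
    exact Finset.sum_congr rfl fun K _ => (integral_indicator_one (hmeas K)).symm
  · exact fun K _ => (integrable_indicator_iff (hmeas K)).2
      (continuousOn_const.integrableOn_compact (isCompact_simplex _))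

end IsNonsingularMesh

lemma IsMetricTensor.mbar_pos (hd : 1 ≤ d) (hM : IsMetricTensor Ω m mbar M) (hm : 0 < m)
    (hne : Ω.Nonempty) : 0 < mbar := by
  obtain ⟨q, hq⟩ := hne
  have hdiag := ((hM.upper q hq).add (hM.lower q hq)).diag_nonneg (i := ⟨0, hd⟩)
  simp only [sub_add_sub_cancel, Matrix.sub_apply, Matrix.smul_apply, Matrix.one_apply_eq,
    smul_eq_mul, mul_one, sub_nonneg] at hdiag
  exact hm.trans_le hdiag

lemma rpow_half_le_sqrt_det (hM : IsMetricTensor Ω m mbar M) (hm : 0 ≤ m)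
    (hx : IsNonsingularMesh Ω conn x) (K : Fin N) :
    m ^ ((d : ℝ) / 2) ≤ √(averageMetric M (elementVertices conn x K)).det := by
  refine Real.le_sqrt_of_sq_le ?_
  rw [← Real.rpow_mul_natCast hm, Nat.cast_ofNat, div_mul_cancel₀ _ two_ne_zero, Real.rpow_natCast]
  exact pow_le_det_averageMetric hM hm (hx.orient_ne_zero K) (hx.simplex_subset K)

lemma le_sigma (hM : IsMetricTensor Ω m mbar M) (hm : 0 ≤ m) (hx : IsNonsingularMesh Ω conn x) :
    m ^ ((d : ℝ) / 2) * volume.real (closure Ω) ≤ sigma conn M x := by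
  rw [← hx.sum_vol, Finset.mul_sum]
  refine Finset.sum_le_sum fun K _ => ?_
  rw [mul_comm]
  exact mul_le_mul_of_nonneg_left (rpow_half_le_sqrt_det hM hm hx K) measureReal_nonneg

lemma alphaM_pos (hd : 1 ≤ d) (hm : 0 < m) : 0 < alphaM d p m := by
  have _hd₀ : (0 : ℝ) < d := by exact_mod_cast hd
  unfold alphaM
  positivity

lemma alphaJ_pos (hd : 1 ≤ d) (hm : 0 < m) (hmbar : 0 < mbar) : 0 < alphaJ d p m mbar := by
  have _hd₀ : (0 : ℝ) < d := by exact_mod_cast hd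
  unfold alphaJ
  positivity

lemma gammaH_nonneg (d N : ℕ) {s : ℝ} (hs : 0 ≤ s) : 0 ≤ gammaH d N s :=
  Real.rpow_nonneg (by positivity) _

lemma gammaH_le_gammaH (d : ℕ) (hN : 1 ≤ N) {s t : ℝ} (hs : 0 < s) (hst : s ≤ t) :
    gammaH d N t ≤ gammaH d N s := by
  have _hN₀ : (0 : ℝ) < N := by exact_mod_cast hN
  refine Real.rpow_le_rpow_of_nonpos (by positivity) (by gcongr) ?_
  rw [neg_div]
  exact neg_nonpos.2 (by positivity)

lemma betaC_nonneg (d : ℕ) (p : ℝ) (hm : 0 ≤ m) (γ : ℝ) : 0 ≤ betaC d p m γ := by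
  unfold betaC
  positivity

lemma betaC_le_betaC (d : ℕ) (hp : 0 ≤ p) (hm : 0 ≤ m) {γ γ' : ℝ} (hγ : 0 ≤ γ) (h : γ ≤ γ') :
    betaC d p m γ ≤ betaC d p m γ' := by
  unfold betaC
  gcongr

lemma alphaM_mul_trace_rpow_sub_le (hd : 1 ≤ d) (hp : 1 ≤ 2 * p) (hm : 0 ≤ m)
    {S : Matrix (Fin d) (Fin d) ℝ} (hS : 0 ≤ S.trace) {γ : ℝ} (hγ : 0 ≤ γ) {w : ℝ}
    (hw : m ^ ((d : ℝ) / 2) ≤ w) :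
    alphaM d p m * S.trace ^ (2 * p) - betaC d p m γ ≤
      w * frobenius (S - γ • (1 : Matrix (Fin d) (Fin d) ℝ)) ^ (2 * p) :=
  calc alphaM d p m * S.trace ^ (2 * p) - betaC d p m γ
      = m ^ ((d : ℝ) / 2) *
          (2 ^ (1 - 2 * p) / (d : ℝ) ^ p * S.trace ^ (2 * p) - (γ ^ 2 * d) ^ p) := by
        rw [alphaM, betaC]
        ring
    _ ≤ m ^ ((d : ℝ) / 2) * frobenius (S - γ • (1 : Matrix (Fin d) (Fin d) ℝ)) ^ (2 * p) :=
        mul_le_mul_of_nonneg_left (trace_rpow_sub_le_frobenius_rpow hd hp hS hγ) (by positivity)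
    _ ≤ _ := mul_le_mul_of_nonneg_right hw (Real.rpow_nonneg (frobenius_nonneg _) _)

/-- The trace of the matrix `(F_K')⁻¹ M_K⁻¹ (F_K')⁻ᵀ` of the element `K` of a mesh. -/
def elementTrace (ξ : Fin (d + 1) → EuclideanSpace ℝ (Fin d)) (conn : Fin N → Fin (d + 1) → Fin Nv)
    (M : EuclideanSpace ℝ (Fin d) → Matrix (Fin d) (Fin d) ℝ)
    (x : Fin Nv → EuclideanSpace ℝ (Fin d)) (K : Fin N) : ℝ :=
  (elementMatrix ξ (elementVertices conn x K) (averageMetric M (elementVertices conn x K))).trace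

lemma elementTrace_nonneg (ξ : Fin (d + 1) → EuclideanSpace ℝ (Fin d)) (hm : 0 < m)
    (hM : IsMetricTensor Ω m mbar M) (hx : IsNonsingularMesh Ω conn x) (K : Fin N) :
    0 ≤ elementTrace ξ conn M x K :=
  (posSemidef_elementMatrix ξ _ (posDef_averageMetric hM hm (hx.orient_ne_zero K)
    (hx.simplex_subset K)).posSemidef).trace_nonneg

lemma sum_alphaM_mul_le (hd : 1 ≤ d) (hm : 0 < m) (hM : IsMetricTensor Ω m mbar M)
    (hp : 1 ≤ 2 * p) (hx : IsNonsingularMesh Ω conn x) (hσ : 0 ≤ σ x) :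
    ∑ K, alphaM d p m * (vol (elementVertices conn x K) * elementTrace ξ conn M x K ^ (2 * p)) ≤
      betaC d p m (gammaH d N (σ x)) * volume.real (closure Ω) + energy ξ conn M p σ x := by
  rw [← sub_le_iff_le_add', ← hx.sum_vol, Finset.mul_sum, ← Finset.sum_sub_distrib]
  refine Finset.sum_le_sum fun K _ => ?_
  have h := mul_le_mul_of_nonneg_left (alphaM_mul_trace_rpow_sub_le hd hp hm.le
    (elementTrace_nonneg ξ hm hM hx K) (gammaH_nonneg d N hσ) (rpow_half_le_sqrt_det hM hm.le hx K))
    (measureReal_nonneg : 0 ≤ vol (elementVertices conn x K))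
  refine (le_of_eq ?_).trans (h.trans_eq (mul_assoc _ _ _).symm)
  rw [elementTrace, vol]
  ring

lemma alphaM_mul_le (hd : 1 ≤ d) (hm : 0 < m) (hM : IsMetricTensor Ω m mbar M)
    (hp : 1 ≤ 2 * p) (hx : IsNonsingularMesh Ω conn x) (hσ : 0 ≤ σ x) (K : Fin N) :
    alphaM d p m * (vol (elementVertices conn x K) * elementTrace ξ conn M x K ^ (2 * p)) ≤
      betaC d p m (gammaH d N (σ x)) * volume.real (closure Ω) + energy ξ conn M p σ x :=
  (Finset.single_le_sum (f := fun K => alphaM d p m *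
      (vol (elementVertices conn x K) * elementTrace ξ conn M x K ^ (2 * p)))
    (fun K _ => mul_nonneg (alphaM_pos hd hm).le (mul_nonneg measureReal_nonneg
      (Real.rpow_nonneg (elementTrace_nonneg ξ hm hM hx K) _))) (Finset.mem_univ K)).trans
    (sum_alphaM_mul_le hd hm hM hp hx hσ)

lemma satisfiesBounds_of_energy_le (hd : 1 ≤ d) (hdN : 2 ≤ d ∨ 2 ≤ N) (hne : Ω.Nonempty)
    (hm : 0 < m) (hM : IsMetricTensor Ω m mbar M) (hp : 1 ≤ 2 * p) (hpd : (d : ℝ) < 4 * p)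
    (hξ : IsReferenceElement ξ) (hx : IsNonsingularMesh Ω conn x) (hσ : 0 ≤ σ x) {α B : ℝ}
    (hα : 0 < α) (hαM : α ≤ alphaM d p m)
    (hB : betaC d p m (gammaH d N (σ x)) * volume.real (closure Ω) + energy ξ conn M p σ x ≤ B) :
    SatisfiesBounds conn M p mbar α B x := by
  intro K
  obtain ⟨r, hr₀, hr, hξ₀, hgram⟩ := hξ.exists_gram
  have hy := hx.orient_ne_zero K
  have hsub := hx.simplex_subset K
  have hA := posDef_averageMetric hM hm hy hsub
  have htrace := trace_elementMatrix_pos hd hξ₀ hy hA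
  have hV := vol_pos hy
  have hN := hx.card_pos hne
  have hmbar := hM.mbar_pos hd hm hne
  have hD := det_averageMetric_le_pow hM hm hy hsub
  have hdet := one_le_vol_sq_mul hξ₀ hξ.2 hy hA
  have henergy := (mul_le_mul_of_nonneg_right hαM (by positivity)).trans
    ((alphaM_mul_le hd hm hM hp hx hσ K).trans hB)
  exact ⟨(constC₁_mul_le_sqrt hd hN hdN hpd hr₀ hr hmbar hα hV htrace hA.det_pos hD hdet
      henergy).trans (le_minAltitude hd hξ₀ hr₀ hgram hy hA),
    constC₂_mul_le hd hN hdN hpd hr₀ hr hmbar hα hV htrace hA.det_pos hD hdet henergy⟩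

lemma exists_lower_bound_orient (hd : 1 ≤ d) (hdN : 2 ≤ d ∨ 2 ≤ N) (hne : Ω.Nonempty)
    (hm : 0 < m) (hM : IsMetricTensor Ω m mbar M) (hp : 1 ≤ 2 * p) (hpd : (d : ℝ) < 4 * p)
    (hξ : IsReferenceElement ξ) (hN : 1 ≤ N) {c : ℝ} (hc : 0 < c) (E₀ : ℝ) :
    ∃ ε > 0, ∀ x, IsNonsingularMesh Ω conn x → c ≤ σ x → energy ξ conn M p σ x ≤ E₀ →
      ∀ K, ε ≤ |orient (elementVertices conn x K)| := by
  have hmbar := hM.mbar_pos hd hm hne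
  have hα := alphaM_pos (p := p) hd hm
  have hβ := betaC_nonneg d p hm.le (gammaH d N c)
  -- Adding `1` keeps `B` positive.
  set B := betaC d p m (gammaH d N c) * volume.real (closure Ω) + (|E₀| + 1)
  have hC₁ : 0 < constC₁ d p (alphaM d p m) B := constC₁_pos hd hα (by positivity)
  refine ⟨constC₂ d p (alphaM d p m) B * mbar ^ (-(d : ℝ) ^ 2 / (2 * (4 * p - d)) - (d : ℝ) / 2) *
    (N : ℝ) ^ (-(4 * p) / (4 * p - d)) * d !, by unfold constC₂; positivity, ?_⟩
  intro x hx hσ hE K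
  have hβx : betaC d p m (gammaH d N (σ x)) ≤ betaC d p m (gammaH d N c) :=
    betaC_le_betaC d (by linarith) hm.le (gammaH_nonneg d N (hc.le.trans hσ))
      (gammaH_le_gammaH d hN hc hσ)
  have hB : betaC d p m (gammaH d N (σ x)) * volume.real (closure Ω) + energy ξ conn M p σ x ≤ B :=
    add_le_add (by gcongr) (hE.trans ((le_abs_self E₀).trans (by simp)))
  have hvol := (satisfiesBounds_of_energy_le hd hdN hne hm hM hp hpd hξ hx (hc.le.trans hσ) hα
    le_rfl hB K).2
  rwa [vol_eq (hx.orient_ne_zero K), le_div_iff₀ (by positivity)] at hvol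

end MeshBounds

/-! ### Smoothness of the functional -/

section ParametricIntegral

variable {X H G : Type*} [TopologicalSpace X] [MeasurableSpace X] [OpensMeasurableSpace X]
  {μ : Measure X} [IsFiniteMeasureOnCompacts μ] [NormedAddCommGroup H] [NormedSpace ℝ H]
  [ProperSpace H] [NormedAddCommGroup G] [NormedSpace ℝ G] {T : Set X} {f : H → X → G}
  {f' : H → X → H →L[ℝ] G} {u : Set H} {y₀ : H}

lemma contDiffAt_setIntegral_of_hasFDerivAt (hT : IsCompact T) (hTm : MeasurableSet T)
    (hu : u ∈ 𝓝 y₀) (hf : ∀ y ∈ u, ContinuousOn (f y) T)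
    (hf' : ContinuousOn (Function.uncurry f') (u ×ˢ T))
    (hderiv : ∀ y ∈ u, ∀ s ∈ T, HasFDerivAt (fun y => f y s) (f' y s) y) :
    ContDiffAt ℝ 1 (fun y => ∫ s in T, f y s ∂μ) y₀ := by
  obtain ⟨ε, hε, hεu⟩ := Metric.nhds_basis_closedBall.mem_iff.1 hu
  have hballu : Metric.ball y₀ ε ⊆ u := Metric.ball_subset_closedBall.trans hεu
  obtain ⟨C, hC⟩ := ((isCompact_closedBall y₀ ε).prod hT).exists_bound_of_continuousOn
    (hf'.mono (Set.prod_mono_left hεu))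
  have hC' : ∀ y ∈ Metric.ball y₀ ε, ∀ s ∈ T, ‖f' y s‖ ≤ C := fun y hy s hs =>
    hC (y, s) ⟨Metric.ball_subset_closedBall hy, hs⟩
  have hCint : Integrable (fun _ => C) (μ.restrict T) :=
    continuousOn_const.integrableOn_compact' hT hTm
  have hf'T : ∀ y ∈ u, ContinuousOn (f' y) T := fun y hy =>
    hf'.comp (f := fun s => (y, s)) (by fun_prop) fun s hs => ⟨hy, hs⟩
  have hf'u : ∀ s ∈ T, ContinuousOn (fun y => f' y s) u := fun s hs =>
    hf'.comp (f := fun y => (y, s)) (by fun_prop) fun y hy => ⟨hy, hs⟩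
  refine contDiffAt_one_iff.2 ⟨fun y => ∫ s in T, f' y s ∂μ, Metric.ball y₀ ε,
    Metric.ball_mem_nhds _ hε, ?_, fun y hy => ?_⟩
  · exact continuousOn_of_dominated (bound := fun _ => C)
      (fun y hy => (hf'T y (hballu hy)).aestronglyMeasurable_of_isCompact hT hTm)
      (fun y hy => ae_restrict_of_forall_mem hTm (hC' y hy)) hCint
      (ae_restrict_of_forall_mem hTm fun s hs => (hf'u s hs).mono hballu)
  · have hball : Metric.ball y₀ ε ∈ 𝓝 y := Metric.isOpen_ball.mem_nhds hy
    exact hasFDerivAt_integral_of_dominated_of_fderiv_le (bound := fun _ => C) hball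
      (eventually_of_mem hball fun z hz =>
        (hf z (hballu hz)).aestronglyMeasurable_of_isCompact hT hTm)
      ((hf y (hballu hy)).integrableOn_compact' hT hTm)
      ((hf'T y (hballu hy)).aestronglyMeasurable_of_isCompact hT hTm)
      (ae_restrict_of_forall_mem hTm fun s hs z hz => hC' z hz s hs) hCint
      (ae_restrict_of_forall_mem hTm fun s hs z hz => hderiv z (hballu hz) s hs)

lemma contDiffAt_setIntegral_clm {E : Type*} [NormedAddCommGroup E] [NormedSpace ℝ E]
    {L : X → H →L[ℝ] E} {g : E → G} (hT : IsCompact T) (hTm : MeasurableSet T)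
    (hL : Continuous L) (hg : ∀ s ∈ T, ContDiffAt ℝ 1 g (L s y₀)) :
    ContDiffAt ℝ 1 (fun y => ∫ s in T, g (L s y) ∂μ) y₀ := by
  have hev : Continuous fun q : H × X => L q.2 q.1 :=
    (hL.comp continuous_snd).clm_apply continuous_fst
  have hu : ∀ᶠ y in 𝓝 y₀, ∀ s ∈ T, ContDiffAt ℝ 1 g (L s y) :=
    hT.eventually_forall_of_forall_eventually fun s hs =>
      hev.continuousAt.eventually ((hg s hs).eventually (by simp))
  refine contDiffAt_setIntegral_of_hasFDerivAt (f' := fun y s => (fderiv ℝ g (L s y)).comp (L s))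
    hT hTm hu (fun y hy s hs => ?_) (fun q hq => ?_) fun y hy s hs => ?_
  · exact (ContinuousAt.comp (f := fun s => L s y) (hy s hs).continuousAt
      (hL.clm_apply continuous_const).continuousAt).continuousWithinAt
  · have hg' : ContinuousAt (fderiv ℝ g) (L q.2 q.1) :=
      ((hq.1 q.2 hq.2).fderiv_right (m := 0) (by simp)).continuousAt
    exact ((hg'.comp (f := fun q : H × X => L q.2 q.1) hev.continuousAt).clm_comp
      (hL.comp continuous_snd).continuousAt).continuousWithinAt
  · exact ((hy s hs).differentiableAt one_ne_zero).hasFDerivAt.comp y (L s).hasFDerivAt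

end ParametricIntegral

section MatrixCalculus

variable {𝕜 E ι : Type*} [NontriviallyNormedField 𝕜] [NormedAddCommGroup E] [NormedSpace 𝕜 E]
  [Fintype ι] {n : WithTop ℕ∞} {F G : E → Matrix ι ι 𝕜} {z : E}

lemma contDiffAt_det [DecidableEq ι] (hF : ∀ a b, ContDiffAt 𝕜 n (fun w => F w a b) z) :
    ContDiffAt 𝕜 n (fun w => (F w).det) z := by
  simp only [Matrix.det_apply']
  exact ContDiffAt.sum fun π _ => contDiffAt_const.mul (contDiffAt_prod fun i _ => hF _ _)

lemma contDiffAt_matrix_mul (hF : ∀ a b, ContDiffAt 𝕜 n (fun w => F w a b) z)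
    (hG : ∀ a b, ContDiffAt 𝕜 n (fun w => G w a b) z) (a b : ι) :
    ContDiffAt 𝕜 n (fun w => (F w * G w) a b) z := by
  simp only [Matrix.mul_apply]
  exact ContDiffAt.sum fun c _ => (hF a c).mul (hG c b)

lemma contDiffAt_matrix_inv [DecidableEq ι]
    (hF : ∀ a b, ContDiffAt 𝕜 n (fun w => F w a b) z)
    (h₀ : (F z).det ≠ 0) (a b : ι) : ContDiffAt 𝕜 n (fun w => (F w)⁻¹ a b) z := by
  simp only [Matrix.inv_def, Ring.inverse_eq_inv', Matrix.smul_apply, smul_eq_mul,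
    Matrix.adjugate_apply]
  refine ((contDiffAt_det hF).inv h₀).mul (contDiffAt_det fun c e => ?_)
  rcases eq_or_ne c b with rfl | hc
  · simpa using contDiffAt_const
  · simpa [hc] using hF c e

lemma contDiffAt_frobenius_rpow {E : Type*} [NormedAddCommGroup E] [NormedSpace ℝ E] {d : ℕ}
    {F : E → Matrix (Fin d) (Fin d) ℝ} {z : E} {q : ℝ} (hq : 1 < q)
    (hF : ∀ a b, ContDiffAt ℝ 1 (fun w => F w a b) z) :
    ContDiffAt ℝ 1 (fun w => frobenius (F w) ^ q) z := by
  have hnorm : ∀ A : Matrix (Fin d) (Fin d) ℝ,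
      frobenius A = ‖WithLp.toLp 2 fun c : Fin d × Fin d => A c.1 c.2‖ := fun A => by
    simp [frobenius, EuclideanSpace.norm_eq, Fintype.sum_prod_type]
  simp only [hnorm]
  exact (contDiff_norm_rpow hq).contDiffAt.comp z (contDiffAt_euclidean.2 fun c => hF c.1 c.2)

end MatrixCalculus

section Energy

variable {d N Nv : ℕ} {Ω : Set (EuclideanSpace ℝ (Fin d))} {conn : Fin N → Fin (d + 1) → Fin Nv}
  {x : Fin Nv → EuclideanSpace ℝ (Fin d)} {m mbar p : ℝ}
  {M : EuclideanSpace ℝ (Fin d) → Matrix (Fin d) (Fin d) ℝ}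
  {ξ y : Fin (d + 1) → EuclideanSpace ℝ (Fin d)} {σ : (Fin Nv → EuclideanSpace ℝ (Fin d)) → ℝ}

lemma contDiffAt_edgeMatrix (y : Fin (d + 1) → EuclideanSpace ℝ (Fin d)) (a b : Fin d) :
    ContDiffAt ℝ 1 (fun z => edgeMatrix z a b) y := by
  simp only [edgeMatrix, Matrix.of_apply]
  fun_prop

lemma contDiffAt_orient (y : Fin (d + 1) → EuclideanSpace ℝ (Fin d)) :
    ContDiffAt ℝ 1 orient y := by
  simp only [funext orient_eq_det_edgeMatrix]
  exact contDiffAt_det (contDiffAt_edgeMatrix y)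

lemma eventually_orient_ne_zero (hy : orient y ≠ 0) : ∀ᶠ z in 𝓝 y, orient z ≠ 0 :=
  (contDiffAt_orient y).continuousAt.eventually_ne hy

lemma contDiffAt_vol (hy : orient y ≠ 0) : ContDiffAt ℝ 1 vol y :=
  (((contDiffAt_orient y).abs hy).div_const (d ! : ℝ)).congr_of_eventuallyEq
    ((eventually_orient_ne_zero hy).mono fun _ hz => vol_eq hz)

lemma contDiffAt_averageMetric (hM : ∀ z ∈ simplex y, ∀ a b, ContDiffAt ℝ 1 (fun w => M w a b) z)
    (hy : orient y ≠ 0) (a b : Fin d) : ContDiffAt ℝ 1 (fun z => averageMetric M z a b) y :=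
  (contDiffAt_const.mul (contDiffAt_setIntegral_clm (g := fun z => M z a b)
    (isCompact_stdElement d) (isClosed_stdElement d).measurableSet continuous_elementMap
    fun _ hs => hM _ (elementMap_mem_simplex hs y) a b)).congr_of_eventuallyEq
    ((eventually_orient_ne_zero hy).mono fun _ hz => averageMetric_eq M hz a b)

lemma contDiffAt_vol_mul_sqrt_det (hM : IsMetricTensor Ω m mbar M) (hm : 0 < m) (hy : orient y ≠ 0)
    (hsub : simplex y ⊆ closure Ω) :
    ContDiffAt ℝ 1 (fun z => vol z * √(averageMetric M z).det) y :=
  (contDiffAt_vol hy).mul ((contDiffAt_det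
    (contDiffAt_averageMetric (fun z hz => hM.smooth z (hsub hz)) hy)).sqrt
    (posDef_averageMetric hM hm hy hsub).det_pos.ne')

lemma contDiffAt_elementMatrix (hM : IsMetricTensor Ω m mbar M) (hm : 0 < m) (hξ : orient ξ ≠ 0)
    (hy : orient y ≠ 0) (hsub : simplex y ⊆ closure Ω) (a b : Fin d) :
    ContDiffAt ℝ 1 (fun z => elementMatrix ξ z (averageMetric M z) a b) y := by
  have hJ : ∀ a b, ContDiffAt ℝ 1 (fun z => jacobian ξ z a b) y :=
    contDiffAt_matrix_mul (contDiffAt_edgeMatrix y) fun _ _ => contDiffAt_const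
  have hJ₀ : (jacobian ξ y).det ≠ 0 := by
    rw [jacobian, Matrix.det_mul, Matrix.det_nonsing_inv, Ring.inverse_eq_inv',
      ← orient_eq_det_edgeMatrix, ← orient_eq_det_edgeMatrix]
    exact mul_ne_zero hy (inv_ne_zero hξ)
  have hJi := contDiffAt_matrix_inv hJ hJ₀
  have hAi := contDiffAt_matrix_inv
    (contDiffAt_averageMetric (fun z hz => hM.smooth z (hsub hz)) hy)
    (posDef_averageMetric hM hm hy hsub).det_pos.ne'
  exact contDiffAt_matrix_mul (contDiffAt_matrix_mul hJi hAi) (fun a b => hJi b a) a b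

lemma contDiff_elementVertices (conn : Fin N → Fin (d + 1) → Fin Nv) (K : Fin N) : ContDiff ℝ 1
    fun x : Fin Nv → EuclideanSpace ℝ (Fin d) => elementVertices conn x K := by
  unfold elementVertices
  fun_prop

lemma contDiffAt_sigma (hM : IsMetricTensor Ω m mbar M) (hm : 0 < m)
    (hx : IsNonsingularMesh Ω conn x) : ContDiffAt ℝ 1 (sigma conn M) x :=
  ContDiffAt.sum fun K _ => ContDiffAt.comp x
    (contDiffAt_vol_mul_sqrt_det hM hm (hx.orient_ne_zero K) (hx.simplex_subset K))
    (contDiff_elementVertices conn K).contDiffAt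

lemma contDiffAt_gammaH (d : ℕ) (hN : 1 ≤ N) {s : ℝ} (hs : 0 < s) :
    ContDiffAt ℝ 1 (gammaH d N) s :=
  (contDiffAt_id.div_const _).rpow_const_of_ne (by positivity)

lemma contDiffAt_energy (hM : IsMetricTensor Ω m mbar M) (hm : 0 < m) (hp : 1 < 2 * p)
    (hξ : orient ξ ≠ 0) (hN : 1 ≤ N) (hx : IsNonsingularMesh Ω conn x) (hσ : ContDiffAt ℝ 1 σ x)
    (hσ₀ : 0 < σ x) : ContDiffAt ℝ 1 (energy ξ conn M p σ) x := by
  refine ContDiffAt.sum fun K _ => ?_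
  have hK := hx.orient_ne_zero K
  have hsub := hx.simplex_subset K
  have hvert : ContDiffAt ℝ 1 (fun z => elementVertices conn z K) x :=
    (contDiff_elementVertices conn K).contDiffAt
  refine ((contDiffAt_vol_mul_sqrt_det hM hm hK hsub).comp x hvert).mul
    (contDiffAt_frobenius_rpow hp fun a b => ?_)
  simp only [Matrix.sub_apply, Matrix.smul_apply, smul_eq_mul]
  exact ((contDiffAt_elementMatrix hM hm hξ hK hsub a b).comp x hvert).sub
    (((contDiffAt_gammaH d hN hσ₀).comp x hσ).mul contDiffAt_const)

end Energy

section Gradient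

variable {d Nv : ℕ} {V : Fin Nv → Submodule ℝ (EuclideanSpace ℝ (Fin d))}
  {I : (Fin Nv → EuclideanSpace ℝ (Fin d)) → ℝ} {y : Fin Nv → EuclideanSpace ℝ (Fin d)}

lemma gradient_update (h : DifferentiableAt ℝ I y) (i : Fin Nv) :
    gradient (fun z => I (Function.update y i z)) (y i) =
      (InnerProductSpace.toDual ℝ (EuclideanSpace ℝ (Fin d))).symm
        ((fderiv ℝ I y).comp (ContinuousLinearMap.single ℝ
          (fun _ : Fin Nv => EuclideanSpace ℝ (Fin d)) i)) := by
  have hI : HasFDerivAt I (fderiv ℝ I y) (Function.update y i (y i)) := by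
    simpa using h.hasFDerivAt
  have hupdate := hI.comp (y i) (hasFDerivAt_update (𝕜 := ℝ) y (y i))
  rw [gradient, show (fun z => I (Function.update y i z)) = I ∘ Function.update y i from rfl,
    hupdate.fderiv]
  congr 2
  ext w j k
  rcases eq_or_ne j i with rfl | hj
  · simp
  · simp [hj]

lemma sum_inner_gradient_update (h : DifferentiableAt ℝ I y)
    (v : Fin Nv → EuclideanSpace ℝ (Fin d)) :
    ∑ i, inner ℝ (gradient (fun z => I (Function.update y i z)) (y i)) (v i) =
      fderiv ℝ I y v := by
  simp only [gradient_update h, InnerProductSpace.toDual_symm_apply,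
    ContinuousLinearMap.comp_apply, ContinuousLinearMap.single_apply]
  rw [← map_sum, Finset.univ_sum_single]

lemma continuousAt_admissibleGradient (h : ContDiffAt ℝ 1 I y) (i : Fin Nv) :
    ContinuousAt (fun z => admissibleGradient V I z i) y := by
  have hfderiv : ContinuousAt (fderiv ℝ I) y := (h.fderiv_right (m := 0) (by simp)).continuousAt
  have hproj : ContinuousAt (fun z => (V i).starProjection
      ((InnerProductSpace.toDual ℝ (EuclideanSpace ℝ (Fin d))).symm
        ((fderiv ℝ I z).comp (ContinuousLinearMap.single ℝ
          (fun _ : Fin Nv => EuclideanSpace ℝ (Fin d)) i)))) y :=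
    (V i).starProjection.continuous.continuousAt.comp
      ((LinearIsometryEquiv.continuous _).continuousAt.comp (hfderiv.clm_comp continuousAt_const))
  refine hproj.congr ?_
  filter_upwards [h.eventually (by simp)] with z hz
  rw [admissibleGradient, gradient_update (hz.differentiableAt one_ne_zero)]

/-- The rate at which the moving mesh equation dissipates the functional `I`. -/
def dissipation (V : Fin Nv → Submodule ℝ (EuclideanSpace ℝ (Fin d)))
    (I : (Fin Nv → EuclideanSpace ℝ (Fin d)) → ℝ) (τ : ℝ)
    (P : Fin Nv → (Fin Nv → EuclideanSpace ℝ (Fin d)) → ℝ)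
    (y : Fin Nv → EuclideanSpace ℝ (Fin d)) : ℝ :=
  ∑ i, P i y / τ * ‖admissibleGradient V I y i‖ ^ 2

end Gradient

/-! ### The trajectory -/

section Asymptotics

variable {E F : Type*} [NormedAddCommGroup E] [NormedSpace ℝ E] [NormedAddCommGroup F]
  [NormedSpace ℝ F] {a : ℝ}

lemma exists_tendsto_of_antitoneOn_Ici {f : ℝ → ℝ} (hf : AntitoneOn f (Set.Ici a))
    (hb : BddBelow (f '' Set.Ici a)) : ∃ L, Tendsto f atTop (𝓝 L) := by
  have hanti : Antitone fun t => f (max t a) := fun s t hst =>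
    hf (le_max_right s a) (le_max_right t a) (max_le_max_right a hst)
  have hbdd : BddBelow (Set.range fun t => f (max t a)) :=
    hb.mono (by rintro _ ⟨t, rfl⟩; exact ⟨max t a, le_max_right t a, rfl⟩)
  refine ⟨_, (tendsto_atTop_ciInf hanti hbdd).congr' ?_⟩
  filter_upwards [eventually_ge_atTop a] with t ht
  rw [max_eq_left ht]

/-- Barbalat's lemma. -/
lemma tendsto_deriv_atTop_zero {f f' : ℝ → E} (hf : ∀ t > a, HasDerivAt f (f' t) t)
    (hf' : UniformContinuousOn f' (Set.Ioi a)) {L : E} (hL : Tendsto f atTop (𝓝 L)) :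
    Tendsto f' atTop (𝓝 0) := by
  refine Metric.tendsto_nhds.2 fun ε hε => ?_
  obtain ⟨δ, hδ, hosc⟩ := Metric.uniformContinuousOn_iff.1 hf' (ε / 2) (half_pos hε)
  obtain ⟨η, hη, hηδ⟩ := exists_between hδ
  have hdiff : Tendsto (fun t => f (t + η) - f t) atTop (𝓝 0) := by
    simpa using (hL.comp (tendsto_atTop_add_const_right _ η tendsto_id)).sub hL
  filter_upwards [hdiff.norm.eventually_lt_const (u := η * (ε / 2)) (by simpa using by positivity),
    eventually_gt_atTop a] with t hsmall ht
  have hmean : ‖(f (t + η) - (t + η) • f' t) - (f t - t • f' t)‖ ≤ ε / 2 * ‖t + η - t‖ := by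
    refine (convex_Icc t (t + η)).norm_image_sub_le_of_norm_hasDerivWithin_le
      (f := fun s => f s - s • f' t) (f' := fun s => f' s - f' t) (fun s hs => ?_) (fun s hs => ?_)
      (Set.left_mem_Icc.2 (by linarith)) (Set.right_mem_Icc.2 (by linarith))
    · simpa using ((hf s (ht.trans_le hs.1)).fun_sub
        ((hasDerivAt_id' s).smul_const (f' t))).hasDerivWithinAt
    · rw [← dist_eq_norm]
      refine (hosc s (ht.trans_le hs.1) t ht ?_).le
      rw [Real.dist_eq, abs_of_nonneg (sub_nonneg.2 hs.1)]
      linarith [hs.2]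
  have hsmul : η * ‖f' t‖ < η * ε := calc
    η * ‖f' t‖ = ‖η • f' t‖ := by rw [norm_smul, Real.norm_of_nonneg hη.le]
    _ = ‖(f (t + η) - f t) - ((f (t + η) - (t + η) • f' t) - (f t - t • f' t))‖ := by
      congr 1
      module
    _ ≤ ‖f (t + η) - f t‖ + ε / 2 * ‖t + η - t‖ := (norm_sub_le _ _).trans (by gcongr)
    _ < η * (ε / 2) + ε / 2 * η := by
      rw [add_sub_cancel_left, Real.norm_of_nonneg hη.le]
      gcongr
    _ = η * ε := by ring
  simpa using lt_of_mul_lt_mul_left hsmul hη.le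

lemma tendsto_comp_zero_of_hasDerivAt {Q : Set E} (hQ : IsCompact Q) {x : ℝ → E} {v : E → E}
    {f : ℝ → F} {g : E → F} (hxQ : ∀ t > a, x t ∈ Q) (hx : ∀ t > a, HasDerivAt x (v (x t)) t)
    (hv : ContinuousOn v Q) (hg : ContinuousOn g Q) (hf : ∀ t > a, HasDerivAt f (g (x t)) t)
    {L : F} (hL : Tendsto f atTop (𝓝 L)) : Tendsto (fun t => g (x t)) atTop (𝓝 0) := by
  obtain ⟨C, hC⟩ := hQ.exists_bound_of_continuousOn hv
  have hxlip : LipschitzOnWith C.toNNReal x (Set.Ioi a) :=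
    (convex_Ioi a).lipschitzOnWith_of_nnnorm_hasDerivWithin_le
      (fun t ht => (hx t ht).hasDerivWithinAt) fun t ht =>
        NNReal.le_toNNReal_of_coe_le (hC _ (hxQ t ht))
  exact tendsto_deriv_atTop_zero hf
    ((hQ.uniformContinuousOn_of_continuous hg).comp hxlip.uniformContinuousOn hxQ) hL

/-- The continuity method: the first time at which some `ω i` fails to be positive cannot exist,
because the lower bounds `c i` pass to the limit. -/
lemma le_of_forall_pos_imp_le {ι : Type*} [Finite ι] {ω : ι → ℝ → ℝ} {c : ι → ℝ}
    (hc : ∀ i, 0 < c i) (hω : ∀ i, ContinuousOn (ω i) (Set.Ici a)) (ha : ∀ i, 0 < ω i a)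
    (h : ∀ t, a ≤ t → (∀ s ∈ Set.Icc a t, ∀ i, 0 < ω i s) → ∀ i, c i ≤ ω i t) {t : ℝ}
    (ht : a ≤ t) (i : ι) : c i ≤ ω i t := by
  suffices hpos : ∀ s ∈ Set.Icc a t, ∀ i, 0 < ω i s from h t ht hpos i
  by_contra! ⟨s, hs, j, hj⟩
  have hcompact : IsCompact (⋃ i, Set.Icc a t ∩ ω i ⁻¹' Set.Iic 0) := isCompact_iUnion fun i =>
    isCompact_Icc.of_isClosed_subset (((hω i).mono
      Set.Icc_subset_Ici_self).preimage_isClosed_of_isClosed isClosed_Icc isClosed_Iic)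
      Set.inter_subset_left
  obtain ⟨T, hT, hTmin⟩ := hcompact.exists_isLeast ⟨s, Set.mem_iUnion.2 ⟨j, hs, hj⟩⟩
  obtain ⟨k, ⟨haT, hTt⟩, hkT⟩ := Set.mem_iUnion.1 hT
  have haT' : a < T := haT.lt_of_ne fun h => (ha k).not_ge (h ▸ hkT)
  have hbelow : ∀ r ∈ Set.Ico a T, ∀ i, 0 < ω i r := fun r hr i => by
    by_contra! hi
    exact (hTmin (Set.mem_iUnion.2 ⟨i, ⟨hr.1, hr.2.le.trans hTt⟩, hi⟩)).not_gt hr.2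
  have hge : ∀ r ∈ Set.Ico a T, c k ≤ ω k r := fun r hr =>
    h r hr.1 (fun q hq => hbelow q ⟨hq.1, hq.2.trans_lt hr.2⟩) k
  have : (𝓝[Set.Ico a T] T).NeBot := by
    rw [← mem_closure_iff_nhdsWithin_neBot, closure_Ico haT'.ne]
    exact Set.right_mem_Icc.2 haT
  have hlim : c k ≤ ω k T := ge_of_tendsto ((hω k T haT).mono fun r hr => hr.1)
    (eventually_nhdsWithin_of_forall hge)
  exact ((hc k).trans_le hlim).not_ge hkT

end Asymptotics

section Trajectory

variable {d Nv : ℕ} {V : Fin Nv → Submodule ℝ (EuclideanSpace ℝ (Fin d))}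
  {I : (Fin Nv → EuclideanSpace ℝ (Fin d)) → ℝ} {τ : ℝ}
  {P : Fin Nv → (Fin Nv → EuclideanSpace ℝ (Fin d)) → ℝ}
  {x : ℝ → Fin Nv → EuclideanSpace ℝ (Fin d)} {y xlim : Fin Nv → EuclideanSpace ℝ (Fin d)}
  {Q : Set (Fin Nv → EuclideanSpace ℝ (Fin d))}

lemma dissipation_nonneg (hτ : 0 < τ) (hP : ∀ i, 0 < P i y) : 0 ≤ dissipation V I τ P y :=
  Finset.sum_nonneg fun i _ => mul_nonneg (div_pos (hP i) hτ).le (sq_nonneg _)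

lemma admissibleGradient_eq_zero_of_dissipation_eq_zero (hτ : 0 < τ) (hP : ∀ i, 0 < P i y)
    (h : dissipation V I τ P y = 0) (i : Fin Nv) : admissibleGradient V I y i = 0 := by
  have hterm := (Finset.sum_eq_zero_iff_of_nonneg fun i _ =>
    mul_nonneg (div_pos (hP i) hτ).le (sq_nonneg _)).1 h i (Finset.mem_univ i)
  simpa [(hP i).ne', hτ.ne'] using hterm

lemma inner_gradient_admissibleGradient (i : Fin Nv) :
    inner ℝ (gradient (fun z => I (Function.update y i z)) (y i)) (admissibleGradient V I y i) =
      ‖admissibleGradient V I y i‖ ^ 2 := by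
  rw [← real_inner_self_eq_norm_sq]
  unfold admissibleGradient
  rw [Submodule.inner_starProjection_left_eq_right,
    Submodule.starProjection_eq_self_iff.2 ((V i).starProjection_apply_mem _)]

lemma IsLimitMesh.mem (h : IsLimitMesh x xlim) (hQ : IsClosed Q) (hxQ : ∀ t, 0 ≤ t → x t ∈ Q) :
    xlim ∈ Q := by
  obtain ⟨t, ht, htx⟩ := h
  exact hQ.mem_of_tendsto htx ((ht.eventually_ge_atTop 0).mono fun n hn => hxQ _ hn)

lemma exists_isLimitMesh (hQ : IsCompact Q) (hxQ : ∀ t, 0 ≤ t → x t ∈ Q) :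
    ∃ xlim, IsLimitMesh x xlim := by
  obtain ⟨xlim, -, n, hn, hlim⟩ := hQ.tendsto_subseq (x := fun k : ℕ => x k)
    fun k => hxQ k k.cast_nonneg
  exact ⟨xlim, fun k => n k, tendsto_natCast_atTop_atTop.comp hn.tendsto_atTop, hlim⟩

namespace IsMMPDETrajectory

lemma sub_mem (hx : IsMMPDETrajectory V I τ P x) {t : ℝ} (ht : 0 ≤ t) (i : Fin Nv) :
    x t i - x 0 i ∈ V i := by
  obtain rfl | ht := ht.eq_or_lt
  · simp
  rw [← (V i).orthogonal_orthogonal, Submodule.mem_orthogonal]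
  intro w hw
  have hcont : ContinuousOn (fun s => inner ℝ w (x s i)) (Set.Icc 0 t) :=
    continuousOn_const.inner ((continuous_apply i).comp_continuousOn
      (hx.continuousOn.mono Set.Icc_subset_Ici_self))
  have hderiv : ∀ s > 0, HasDerivAt (fun s => inner ℝ w (x s i)) 0 s := fun s hs => by
    have horth : inner ℝ w (admissibleGradient V I (x s) i) = 0 :=
      (Submodule.mem_orthogonal' _ _).1 hw _ ((V i).starProjection_apply_mem _)
    refine ((innerSL ℝ w).hasFDerivAt.comp_hasDerivAt s (hx.equation s hs i)).congr_deriv ?_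
    rw [innerSL_apply_apply, inner_smul_right, horth, mul_zero]
  obtain ⟨-, -, hslope⟩ := exists_hasDerivAt_eq_slope _ _ ht hcont fun s hs => hderiv s hs.1
  have hconst : inner ℝ w (x t i) = inner ℝ w (x 0 i) := by
    simpa [sub_eq_zero, ht.ne'] using hslope.symm
  rw [inner_sub_right, hconst, sub_self]

lemma hasDerivAt (hx : IsMMPDETrajectory V I τ P x) {t : ℝ} (ht : 0 < t) :
    HasDerivAt x (fun i => -(P i (x t) / τ) • admissibleGradient V I (x t) i) t :=
  hasDerivAt_pi.2 (hx.equation t ht)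

lemma hasDerivAt_comp (hx : IsMMPDETrajectory V I τ P x) {t : ℝ} (ht : 0 < t)
    (hI : DifferentiableAt ℝ I (x t)) :
    HasDerivAt (fun s => I (x s)) (-dissipation V I τ P (x t)) t := by
  refine (hI.hasFDerivAt.comp_hasDerivAt t (hx.hasDerivAt ht)).congr_deriv ?_
  rw [← sum_inner_gradient_update hI, dissipation, ← Finset.sum_neg_distrib]
  refine Finset.sum_congr rfl fun i _ => ?_
  rw [inner_smul_right, inner_gradient_admissibleGradient, neg_mul]

lemma antitoneOn (hx : IsMMPDETrajectory V I τ P x) {S : Set ℝ} (hS : Convex ℝ S)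
    (hS₀ : S ⊆ Set.Ici 0) (hI : ∀ t ∈ S, DifferentiableAt ℝ I (x t))
    (hD : ∀ t ∈ S, 0 ≤ dissipation V I τ P (x t)) : AntitoneOn (fun t => I (x t)) S := by
  have hderiv : ∀ t ∈ interior S, HasDerivAt (fun s => I (x s)) (-dissipation V I τ P (x t)) t :=
    fun t ht => hx.hasDerivAt_comp (by simpa using interior_mono hS₀ ht)
      (hI t (interior_subset ht))
  refine antitoneOn_of_deriv_nonpos hS (fun t ht => ?_) (fun t ht => ?_) fun t ht => ?_
  · exact (hI t ht).continuousAt.comp_continuousWithinAt ((hx.continuousOn t (hS₀ ht)).mono hS₀)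
  · exact (hderiv t ht).differentiableAt.differentiableWithinAt
  · rw [(hderiv t ht).deriv]
    exact neg_nonpos.2 (hD t (interior_subset ht))

lemma dissipation_eq_zero (hx : IsMMPDETrajectory V I τ P x) (hQ : IsCompact Q)
    (hxQ : ∀ t, 0 ≤ t → x t ∈ Q) (hI : ∀ y ∈ Q, ContDiffAt ℝ 1 I y)
    (hP : ∀ i, ContinuousOn (P i) Q) {L : ℝ} (hL : Tendsto (fun t => I (x t)) atTop (𝓝 L))
    (hlim : IsLimitMesh x xlim) : dissipation V I τ P xlim = 0 := by
  have hgrad : ∀ i, ContinuousOn (fun z => admissibleGradient V I z i) Q := fun i y hy =>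
    (continuousAt_admissibleGradient (hI y hy) i).continuousWithinAt
  have hvelocity : ContinuousOn (fun y i => -(P i y / τ) • admissibleGradient V I y i) Q :=
    continuousOn_pi.2 fun i => ((hP i).div_const τ).neg.smul (hgrad i)
  have hD : ContinuousOn (dissipation V I τ P) Q :=
    continuousOn_finsetSum _ fun i _ => ((hP i).div_const τ).mul ((hgrad i).norm.pow 2)
  have hDx : Tendsto (fun t => -dissipation V I τ P (x t)) atTop (𝓝 0) :=
    tendsto_comp_zero_of_hasDerivAt hQ (fun t ht => hxQ t ht.le) (fun t ht => hx.hasDerivAt ht)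
      hvelocity hD.neg (fun t ht => hx.hasDerivAt_comp ht
        ((hI _ (hxQ t ht.le)).differentiableAt one_ne_zero)) hL
  have hxlim : xlim ∈ Q := hlim.mem hQ.isClosed hxQ
  obtain ⟨t, ht, htx⟩ := hlim
  have htxQ : Tendsto (fun n => x (t n)) atTop (𝓝[Q] xlim) :=
    tendsto_nhdsWithin_iff.2 ⟨htx, (ht.eventually_ge_atTop 0).mono fun n hn => hxQ _ hn⟩
  exact neg_eq_zero.1 (tendsto_nhds_unique ((hD.neg xlim hxlim).tendsto.comp htxQ) (hDx.comp ht))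

lemma convergence (hx : IsMMPDETrajectory V I τ P x) (hQ : IsCompact Q)
    (hxQ : ∀ t, 0 ≤ t → x t ∈ Q) (hI : ∀ y ∈ Q, ContDiffAt ℝ 1 I y) (hτ : 0 < τ)
    (hPpos : ∀ i, ∀ y ∈ Q, 0 < P i y) (hPcont : ∀ i, ContinuousOn (P i) Q) :
    (∃ L, Tendsto (fun t => I (x t)) atTop (𝓝 L)) ∧ (∃ xlim, IsLimitMesh x xlim) ∧
      ∀ xlim, IsLimitMesh x xlim → xlim ∈ Q ∧ I xlim ≤ I (x 0) ∧ IsCriticalMesh V I xlim := by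
  have hdiff : ∀ y ∈ Q, DifferentiableAt ℝ I y := fun y hy =>
    (hI y hy).differentiableAt one_ne_zero
  have hIcont : ContinuousOn I Q := fun y hy => (hdiff y hy).continuousAt.continuousWithinAt
  have hanti : AntitoneOn (fun t => I (x t)) (Set.Ici 0) :=
    hx.antitoneOn (convex_Ici 0) subset_rfl (fun t ht => hdiff _ (hxQ t ht)) fun t ht =>
      dissipation_nonneg hτ fun i => hPpos i _ (hxQ t ht)
  have hbdd : BddBelow ((fun t => I (x t)) '' Set.Ici 0) :=
    (hQ.bddBelow_image hIcont).mono (by rintro _ ⟨t, ht, rfl⟩; exact ⟨x t, hxQ t ht, rfl⟩)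
  obtain ⟨L, hL⟩ := exists_tendsto_of_antitoneOn_Ici hanti hbdd
  refine ⟨⟨L, hL⟩, exists_isLimitMesh hQ hxQ, fun xlim hlim => ?_⟩
  obtain ⟨hmem, hle⟩ : xlim ∈ Q ∩ I ⁻¹' Set.Iic (I (x 0)) :=
    hlim.mem (hIcont.preimage_isClosed_of_isClosed hQ.isClosed isClosed_Iic) fun t ht =>
      ⟨hxQ t ht, hanti Set.self_mem_Ici ht ht⟩
  exact ⟨hmem, hle, hdiff xlim hmem, admissibleGradient_eq_zero_of_dissipation_eq_zero hτ
    (fun i => hPpos i xlim hmem) (hx.dissipation_eq_zero hQ hxQ hI hPcont hL hlim)⟩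

end IsMMPDETrajectory

end Trajectory

section Continuation

variable {d N Nv : ℕ} {Ω : Set (EuclideanSpace ℝ (Fin d))} {conn : Fin N → Fin (d + 1) → Fin Nv}
  {V : Fin Nv → Submodule ℝ (EuclideanSpace ℝ (Fin d))}
  {I : (Fin Nv → EuclideanSpace ℝ (Fin d)) → ℝ} {τ c : ℝ}
  {P : Fin Nv → (Fin Nv → EuclideanSpace ℝ (Fin d)) → ℝ}
  {x : ℝ → Fin Nv → EuclideanSpace ℝ (Fin d)} {x₀ y : Fin Nv → EuclideanSpace ℝ (Fin d)}

/-- The meshes that arise from `x₀` by sliding boundary vertices along the boundary, whose vertices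
stay in the closure of `Ω` and whose elements keep their orientation, with a volume that is at least
`c / d!`. -/
def admissibleMeshes (Ω : Set (EuclideanSpace ℝ (Fin d))) (conn : Fin N → Fin (d + 1) → Fin Nv)
    (x₀ : Fin Nv → EuclideanSpace ℝ (Fin d)) (c : ℝ) : Set (Fin Nv → EuclideanSpace ℝ (Fin d)) :=
  {y | (∀ i, y i ∈ closure Ω) ∧ SlidesAlongBoundary Ω conn x₀ y ∧
    ∀ K, |orient (elementVertices conn x₀ K)| * c ≤
      orient (elementVertices conn x₀ K) * orient (elementVertices conn y K)}

lemma isClosed_setOf_slidesAlongBoundary (Ω : Set (EuclideanSpace ℝ (Fin d)))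
    (conn : Fin N → Fin (d + 1) → Fin Nv) (x₀ : Fin Nv → EuclideanSpace ℝ (Fin d)) :
    IsClosed {y | SlidesAlongBoundary Ω conn x₀ y} := by
  simp only [SlidesAlongBoundary, Set.ofPred_forall]
  exact isClosed_iInter fun K => isClosed_iInter fun j => isClosed_iInter fun _ =>
    isClosed_iInter fun k => isClosed_iInter fun _ =>
      (AffineSubspace.closed_of_finiteDimensional _).preimage (continuous_apply (conn K k))

lemma isCompact_admissibleMeshes (hΩ : IsCompact (closure Ω))
    (conn : Fin N → Fin (d + 1) → Fin Nv) (x₀ : Fin Nv → EuclideanSpace ℝ (Fin d)) (c : ℝ) :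
    IsCompact (admissibleMeshes Ω conn x₀ c) := by
  have horient : IsClosed {y : Fin Nv → EuclideanSpace ℝ (Fin d) |
      ∀ K, |orient (elementVertices conn x₀ K)| * c ≤
        orient (elementVertices conn x₀ K) * orient (elementVertices conn y K)} := by
    rw [Set.ofPred_forall]
    exact isClosed_iInter fun K => isClosed_le continuous_const (continuous_const.mul
      (continuous_orient.comp (contDiff_elementVertices conn K).continuous))
  have hbox : IsCompact {y : Fin Nv → EuclideanSpace ℝ (Fin d) | ∀ i, y i ∈ closure Ω} := by
    simpa [Set.pi] using isCompact_univ_pi fun _ : Fin Nv => hΩ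
  exact hbox.inter_right ((isClosed_setOf_slidesAlongBoundary Ω conn x₀).inter horient)

lemma isNonsingularMesh_of_mem_admissibleMeshes (hd : 1 ≤ d) (hΩ : IsOpen Ω)
    (hx₀ : IsNonsingularMesh Ω conn x₀) (hconf : IsConforming conn x₀) (hc : 0 < c)
    (hy : y ∈ admissibleMeshes Ω conn x₀ c) : IsNonsingularMesh Ω conn y :=
  isNonsingularMesh_of_orient_mul_pos hd hΩ hx₀ hconf hy.2.1 fun K =>
    (mul_pos (abs_pos.2 (hx₀.orient_ne_zero K)) hc).trans_le (hy.2.2 K)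

namespace IsMMPDETrajectory

lemma slidesAlongBoundary (hx : IsMMPDETrajectory V I τ P x)
    (hV : ∀ K j, facet (elementVertices conn (x 0) K) j ⊆ frontier Ω → ∀ k, k ≠ j →
      V (conn K k) ≤ (affineSpan ℝ (facet (elementVertices conn (x 0) K) j)).direction)
    {t : ℝ} (ht : 0 ≤ t) : SlidesAlongBoundary Ω conn (x 0) (x t) := fun K j hf k hk => by
  have hmove := AffineSubspace.vadd_mem_of_mem_direction
    (hV K j hf k hk (hx.sub_mem ht (conn K k))) (SlidesAlongBoundary.refl Ω conn (x 0) K j hf k hk)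
  simpa using hmove

lemma mem_admissibleMeshes (hx : IsMMPDETrajectory V I τ P x) (hd : 1 ≤ d) (hΩ : IsOpen Ω)
    (hx₀ : IsNonsingularMesh Ω conn (x 0)) (hconf : IsConforming conn (x 0))
    (hslide : ∀ t, 0 ≤ t → SlidesAlongBoundary Ω conn (x 0) (x t))
    (hI : ∀ y, IsNonsingularMesh Ω conn y → DifferentiableAt ℝ I y)
    (hD : ∀ y, IsNonsingularMesh Ω conn y → 0 ≤ dissipation V I τ P y) (hc : 0 < c)
    (hlow : ∀ y, IsNonsingularMesh Ω conn y → I y ≤ I (x 0) → ∀ K,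
      c ≤ |orient (elementVertices conn y K)|) {t : ℝ} (ht : 0 ≤ t) :
    x t ∈ admissibleMeshes Ω conn (x 0) c := by
  have horient : ∀ K, |orient (elementVertices conn (x 0) K)| * c ≤
      orient (elementVertices conn (x 0) K) * orient (elementVertices conn (x t) K) := by
    refine le_of_forall_pos_imp_le (c := fun K => |orient (elementVertices conn (x 0) K)| * c)
      (ω := fun K s => orient (elementVertices conn (x 0) K) *
        orient (elementVertices conn (x s) K))
      (fun K => mul_pos (abs_pos.2 (hx₀.orient_ne_zero K)) hc)
      (fun K => continuousOn_const.mul ((continuous_orient.comp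
        (contDiff_elementVertices conn K).continuous).comp_continuousOn hx.continuousOn))
      (fun K => mul_self_pos.2 (hx₀.orient_ne_zero K)) (fun t ht hpos K => ?_) ht
    have hmesh : ∀ s ∈ Set.Icc 0 t, IsNonsingularMesh Ω conn (x s) := fun s hs =>
      isNonsingularMesh_of_orient_mul_pos hd hΩ hx₀ hconf (hslide s hs.1) (hpos s hs)
    have ht' : t ∈ Set.Icc 0 t := Set.right_mem_Icc.2 ht
    have hle : I (x t) ≤ I (x 0) :=
      hx.antitoneOn (convex_Icc 0 t) Set.Icc_subset_Ici_self (fun s hs => hI _ (hmesh s hs))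
        (fun s hs => hD _ (hmesh s hs)) (Set.left_mem_Icc.2 ht) ht' ht
    rw [← abs_of_pos (hpos t ht' K), abs_mul]
    exact mul_le_mul_of_nonneg_left (hlow _ (hmesh t ht') hle K) (abs_nonneg _)
  have hmesh : IsNonsingularMesh Ω conn (x t) :=
    isNonsingularMesh_of_orient_mul_pos hd hΩ hx₀ hconf (hslide t ht) fun K =>
      (mul_pos (abs_pos.2 (hx₀.orient_ne_zero K)) hc).trans_le (horient K)
  refine ⟨fun i => ?_, hslide t ht, horient⟩
  obtain ⟨K, j, rfl⟩ := hconf.vertex_mem i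
  exact hmesh.simplex_subset K (vertex_mem_simplex (elementVertices conn (x t) K) j)

end IsMMPDETrajectory

end Continuation

lemma contDiffAt_and_exists_le_of_eq_sigma_or_const {d N Nv : ℕ}
    {Ω : Set (EuclideanSpace ℝ (Fin d))} {conn : Fin N → Fin (d + 1) → Fin Nv}
    {x : Fin Nv → EuclideanSpace ℝ (Fin d)} {m mbar : ℝ}
    {M : EuclideanSpace ℝ (Fin d) → Matrix (Fin d) (Fin d) ℝ}
    {σ : (Fin Nv → EuclideanSpace ℝ (Fin d)) → ℝ} (hΩ : IsOpen Ω) (hne : Ω.Nonempty) (hm : 0 < m)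
    (hM : IsMetricTensor Ω m mbar M) (hx : IsNonsingularMesh Ω conn x)
    (hσ : σ = sigma conn M ∨ ∃ c : ℝ, 0 < c ∧ σ = fun _ => c) :
    (∀ y, IsNonsingularMesh Ω conn y → ContDiffAt ℝ 1 σ y) ∧
      ∃ s > 0, ∀ y, IsNonsingularMesh Ω conn y → s ≤ σ y := by
  obtain rfl | ⟨c, hc, rfl⟩ := hσ
  · exact ⟨fun y hy => contDiffAt_sigma hM hm hy, _,
      mul_pos (Real.rpow_pos_of_pos hm _) (hx.volume_closure_pos hΩ hne),
      fun y hy => le_sigma hM hm.le hy⟩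
  · exact ⟨fun _ _ => contDiffAt_const, c, hc, fun _ _ => le_rfl⟩

end MovingMesh

end

open MovingMesh in
theorem corollary4p2_general {d N Nv : ℕ} (hd : 1 ≤ d) (hdN : 2 ≤ d ∨ 2 ≤ N)
    (Ω : Set (EuclideanSpace ℝ (Fin d))) (hΩ : IsOpen Ω) (hne : Ω.Nonempty)
    (m mbar : ℝ) (hm : 0 < m) (M : EuclideanSpace ℝ (Fin d) → Matrix (Fin d) (Fin d) ℝ)
    (hM : IsMetricTensor Ω m mbar M) (p : ℝ) (hp : 1 < 2 * p) (hpd : (d : ℝ) < 4 * p)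
    (ξ : Fin (d + 1) → EuclideanSpace ℝ (Fin d)) (hξ : IsReferenceElement ξ)
    (conn : Fin N → Fin (d + 1) → Fin Nv) (σ : (Fin Nv → EuclideanSpace ℝ (Fin d)) → ℝ)
    (hσ : ∀ y, IsNonsingularMesh Ω conn y → ContDiffAt ℝ 1 σ y) (s : ℝ) (hs : 0 < s)
    (hsσ : ∀ y, IsNonsingularMesh Ω conn y → s ≤ σ y) (τ : ℝ) (hτ : 0 < τ)
    (P : Fin Nv → (Fin Nv → EuclideanSpace ℝ (Fin d)) → ℝ)
    (hPpos : ∀ i y, IsNonsingularMesh Ω conn y → 0 < P i y)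
    (hPcont : ∀ i, ContinuousOn (P i) {y | IsNonsingularMesh Ω conn y})
    (V : Fin Nv → Submodule ℝ (EuclideanSpace ℝ (Fin d)))
    (x : ℝ → Fin Nv → EuclideanSpace ℝ (Fin d)) (hx₀ : IsNonsingularMesh Ω conn (x 0))
    (hx₀conf : IsConforming conn (x 0))
    (hV : ∀ K j, facet (elementVertices conn (x 0) K) j ⊆ frontier Ω → ∀ k, k ≠ j →
      V (conn K k) ≤ (affineSpan ℝ (facet (elementVertices conn (x 0) K) j)).direction)
    (hx : IsMMPDETrajectory V (energy ξ conn M p σ) τ P x) :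
    (∀ t, 0 ≤ t → IsNonsingularMesh Ω conn (x t)) ∧
    (∃ L : ℝ, Tendsto (fun t => energy ξ conn M p σ (x t)) atTop (𝓝 L)) ∧
    (∃ xlim, IsLimitMesh x xlim) ∧
    (∀ xlim, IsLimitMesh x xlim →
      IsNonsingularMesh Ω conn xlim ∧
      SatisfiesBounds conn M p mbar (alphaM d p m) (betaC d p m (gammaH d N (σ xlim)) *
        volume.real (closure Ω) + energy ξ conn M p σ (x 0)) xlim ∧
      (1 ≤ √(d : ℝ) * mbar →
        SatisfiesBounds conn M p mbar (alphaJ d p m mbar) (betaC d p m (gammaH d N (σ xlim)) *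
          volume.real (closure Ω) + energy ξ conn M p σ (x 0)) xlim)) ∧
    (∀ xlim, IsLimitMesh x xlim → IsCriticalMesh V (energy ξ conn M p σ) xlim) := by
  have hN : 1 ≤ N := hx₀.card_pos hne
  have hmbar : 0 < mbar := hM.mbar_pos hd hm hne
  obtain ⟨-, -, -, hξ₀, -⟩ := hξ.exists_gram
  have hsmooth : ∀ y, IsNonsingularMesh Ω conn y → ContDiffAt ℝ 1 (energy ξ conn M p σ) y :=
    fun y hy => contDiffAt_energy hM hm hp hξ₀ hN hy (hσ y hy) (hs.trans_le (hsσ y hy))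
  obtain ⟨c, hc, hlow⟩ := exists_lower_bound_orient (conn := conn) (σ := σ) hd hdN hne hm hM hp.le
    hpd hξ hN hs (energy ξ conn M p σ (x 0))
  have hQ := isCompact_admissibleMeshes hx₀.isCompact_closure conn (x 0) c
  have hQmesh : ∀ y ∈ admissibleMeshes Ω conn (x 0) c, IsNonsingularMesh Ω conn y := fun y hy =>
    isNonsingularMesh_of_mem_admissibleMeshes hd hΩ hx₀ hx₀conf hc hy
  have hxQ : ∀ t, 0 ≤ t → x t ∈ admissibleMeshes Ω conn (x 0) c := fun t ht =>
    hx.mem_admissibleMeshes hd hΩ hx₀ hx₀conf (fun t ht => hx.slidesAlongBoundary hV ht)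
      (fun y hy => (hsmooth y hy).differentiableAt one_ne_zero)
      (fun y hy => dissipation_nonneg hτ fun i => hPpos i y hy) hc
      (fun y hy => hlow y hy (hsσ y hy)) ht
  obtain ⟨hL, hlim, hlimit⟩ := hx.convergence hQ hxQ (fun y hy => hsmooth y (hQmesh y hy)) hτ
    (fun i y hy => hPpos i y (hQmesh y hy)) fun i => (hPcont i).mono hQmesh
  refine ⟨fun t ht => hQmesh _ (hxQ t ht), hL, hlim, fun xlim h => ?_, fun xlim h =>
    (hlimit xlim h).2.2⟩
  obtain ⟨hxlim, hle, -⟩ := hlimit xlim h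
  have hmesh := hQmesh xlim hxlim
  have hbounds (α : ℝ) (hα : 0 < α) (hαM : α ≤ alphaM d p m) :=
    satisfiesBounds_of_energy_le hd hdN hne hm hM hp.le hpd hξ hmesh (hs.le.trans (hsσ _ hmesh))
      hα hαM (add_le_add_right hle _)
  exact ⟨hmesh, hbounds _ (alphaM_pos hd hm) le_rfl, fun h =>
    hbounds _ (alphaJ_pos hd hm hmbar) (alphaJ_le_alphaM hd (by linarith) hm.le hmbar.le h)⟩

theorem corollary4p2 {d N Nv : ℕ} (hd : 1 ≤ d) (hdN : 2 ≤ d ∨ 2 ≤ N)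
    (Ω : Set (EuclideanSpace ℝ (Fin d))) (hΩ : MovingMesh.IsPolyhedralDomain Ω)
    (m mbar : ℝ) (hm : 0 < m)
    (M : EuclideanSpace ℝ (Fin d) → Matrix (Fin d) (Fin d) ℝ)
    (hM : MovingMesh.IsMetricTensor Ω m mbar M)
    (p : ℝ) (hp : 1 < p) (hpd : (d : ℝ) < 4 * p)
    (ξ : Fin (d + 1) → EuclideanSpace ℝ (Fin d)) (hξ : MovingMesh.IsReferenceElement ξ)
    (conn : Fin N → Fin (d + 1) → Fin Nv)
    (σ : (Fin Nv → EuclideanSpace ℝ (Fin d)) → ℝ)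
    -- `σ` is the mesh-dependent `σ_h`, or is frozen at a positive constant
    (hσ : σ = MovingMesh.sigma conn M ∨ ∃ c : ℝ, 0 < c ∧ σ = fun _ => c)
    (τ : ℝ) (hτ : 0 < τ)
    (P : Fin Nv → (Fin Nv → EuclideanSpace ℝ (Fin d)) → ℝ)
    (hPpos : ∀ i y, MovingMesh.IsNonsingularMesh Ω conn y → 0 < P i y)
    (hPcont : ∀ i, ContinuousOn (P i) {y | MovingMesh.IsNonsingularMesh Ω conn y})
    (V : Fin Nv → Submodule ℝ (EuclideanSpace ℝ (Fin d)))
    (x : ℝ → Fin Nv → EuclideanSpace ℝ (Fin d))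
    (hx₀ : MovingMesh.IsNonsingularMesh Ω conn (x 0))
    (hx₀conf : MovingMesh.IsConforming conn (x 0))
    (hV : MovingMesh.IsBoundaryRule Ω conn (x 0) V)
    (hx : MovingMesh.IsMMPDETrajectory V (MovingMesh.energy ξ conn M p σ) τ P x) :
    -- the trajectory consists of nonsingular meshes
    (∀ t, 0 ≤ t → MovingMesh.IsNonsingularMesh Ω conn (x t)) ∧
    -- (a)
    (∃ L : ℝ, Tendsto (fun t => MovingMesh.energy ξ conn M p σ (x t)) atTop (𝓝 L)) ∧
    -- (b)
    (∃ xlim, MovingMesh.IsLimitMesh x xlim) ∧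
    (∀ xlim, MovingMesh.IsLimitMesh x xlim →
      MovingMesh.IsNonsingularMesh Ω conn xlim ∧
      MovingMesh.SatisfiesBounds conn M p mbar (MovingMesh.alphaM d p m)
        (MovingMesh.betaC d p m (MovingMesh.gammaH d N (σ xlim)) * volume.real Ω +
          MovingMesh.energy ξ conn M p σ (x 0)) xlim ∧
      (1 ≤ √(d : ℝ) * mbar →
        MovingMesh.SatisfiesBounds conn M p mbar (MovingMesh.alphaJ d p m mbar)
          (MovingMesh.betaC d p m (MovingMesh.gammaH d N (σ xlim)) * volume.real Ω +
            MovingMesh.energy ξ conn M p σ (x 0)) xlim)) ∧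
    -- (c)
    (∀ xlim, MovingMesh.IsLimitMesh x xlim →
      MovingMesh.IsCriticalMesh V (MovingMesh.energy ξ conn M p σ) xlim) := by
  obtain ⟨hσ₁, s, hs, hsσ⟩ := MovingMesh.contDiffAt_and_exists_le_of_eq_sigma_or_const hΩ.isOpen
    hΩ.isConnected.nonempty hm hM hx₀ hσ
  simpa only [hΩ.volume_closure] using corollary4p2_general hd hdN Ω hΩ.isOpen
    hΩ.isConnected.nonempty m mbar hm M hM p (by linarith) hpd ξ hξ conn σ hσ₁ s hs hsσ τ hτ P
    hPpos hPcont V x hx₀ hx₀conf hV.boundary_tangent hx
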